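/- Let $n\in\{3,4,5,6\}$, let $\eta=\mathrm{diag}(-1,1,\dots,1)$ be the Lorentz metric on $\mathbb R^n$, and let either $m=1$, $\gamma=0$ (Maxwell) or $m=3$ and $\gamma^a_{bc}$ be completely antisymmetric with $\gamma^1_{23}=1$ ($SU(2)$ Yang–Mills). On the vector space $M$ with coordinates $x^i$, $A^a_i$, $F^a_{ij}=-F^a_{ji}$ ($1\le i,j\le n$, $1\le a\le m$) put $$A^a=A^a_i\,dx^i,\qquad F^a=\tfrac12F^a_{ij}\,dx^i\wedge dx^j,\qquad {*F}_a=\tfrac1{2(n-2)!}F^a_{ij}\,\epsilon^{ij}{}_{k_1\cdots k_{n-2}}\,dx^{k_1}\wedge\cdots\wedge dx^{k_{n-2}},$$ $$\theta^a=dA^a-F^a+\tfrac18\gamma^a_{bc}A^b\wedge A^c,\qquad \psi_a=-d{*F}_a-\tfrac14\gamma^c_{ab}A^b\wedge{*F}_c,$$ where repeated indices are summed and indices of the Levi-Civita symbol are raised with $\eta$. Let $I$ be the ideal of smooth differential forms generated by the $\theta^a$, $d\theta^a$ and $\psi_a$. A subspace $E\subset T_pM$ is an integral element if all forms of $I$ vanish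 on it. Its polar space is $H(E)=\{v:\varphi(v,w_1,\dots,w_k)=0 \text{ for all } k\ge 0,\ \varphi\in I \text{ of degree } k+1,\ w_1,\dots,w_k\in E\}$, and its polar rank is $\operatorname{codim}H(E)$. An integral element is regular if its polar rank is maximal among all integral elements of the same dimension (at all points). A vector $v\in T_pM$ is a Cauchy vector if contraction with $v$ maps $I_p$ into $I_p$. A generic chain of integral elements at $p$ is $E_k=\langle e_1,\dots,e_k\rangle$, $0\le k\le n$, where successively $e_{k+1}$ is taken from a dense open subset of $H(E_k)$ (which may depend on $e_1,\dots,e_k$). We write $N[s_0,\dots,s_{n-1}]n+s_n$ if the following hold: 1. $\dim M=N$, the ideal $I$ is closed under $d$, and there are no nonzero Cauchy vectors. 2. At every point $p$, for a generic chain of integral elements, every $E_k$ ($0\le k\le n$) is a regular integral element of polar rank $s_0+s_1+\dots+s_k$ (so the $s_k$ are the Cartan characters), $dx^1,\dots,dx^n$ are linearly independent on $E_n$, and $H(E_n)=E_n$ (the genus is $n$). 3. The system passes Cartan's test, i.e. it is well posed with gauge freedom $s_n$: $N=s_0+\dots+s_n+n$; and at every point the $n$-dimensional integral elements on which the $dx^i$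 are independent, written as linear sections $\mathbb R^n\to T_pM$ of $dx$, form a nonempty affine space of dimension $s_1+2s_2+\dots+ns_n$. Then for $n=3,4,5,6$ the Maxwell system satisfies, respectively, $$9[0,2,3]3+1,\quad 14[0,1,3,5]4+1,\quad 20[0,1,2,4,7]5+1,\quad 27[0,1,2,3,5,9]6+1,$$ and the $SU(2)$ Yang–Mills system satisfies, respectively, $$21[0,6,9]3+3,\quad 34[0,3,9,15]4+3,\quad 50[0,3,6,12,21]5+3,\quad 69[0,3,6,9,15,27]6+3.$$ -/

import Mathlib

open scoped ContDiff

noncomputable section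

namespace EDS

/-! ### Differential forms on a finite-dimensional real vector space -/

/-- Differential forms of degree `k` on `M` (smoothness is required where it is needed). -/
abbrev Form (M : Type) [NormedAddCommGroup M] [NormedSpace ℝ M] (k : ℕ) : Type :=
  M → M [⋀^Fin k]→L[ℝ] ℝ

section General

variable {M : Type} [NormedAddCommGroup M] [NormedSpace ℝ M]

/-- A covector field, regarded as a differential form of degree one. -/
def oneForm (α : M → M →L[ℝ] ℝ) : Form M 1 :=
  fun p => ContinuousAlternatingMap.ofSubsingleton ℝ M ℝ (0 : Fin 1) (α p)

/-- The exterior product `α ∧ φ` of a `1`-form and a `k`-form,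
`(α ∧ φ)(v₀, …, v_k) = ∑ i, (-1)^i α(v_i) φ(v₀, …, v̂_i, …, v_k)`. -/
def wedge {k : ℕ} (α : M → M →L[ℝ] ℝ) (φ : Form M k) : Form M (k + 1) :=
  fun p => ContinuousAlternatingMap.alternatizeUncurryFin ((α p).smulRight (φ p))

/-- The (algebraic) ideal of smooth forms generated by a family `G` of homogeneous forms:
`Ideal G k φ` says that `φ` is an element of degree `k`. Since the algebra of smooth forms on a
vector space is generated by functions and `1`-forms, it is enough to close under exterior
multiplication with these. -/
inductive Ideal (G : ∀ k : ℕ, Form M k → Prop) : ∀ k : ℕ, Form M k → Prop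
  | gen {k : ℕ} {φ : Form M k} : G k φ → Ideal G k φ
  | zero {k : ℕ} : Ideal G k (fun _ => 0)
  | add {k : ℕ} {φ χ : Form M k} : Ideal G k φ → Ideal G k χ → Ideal G k (fun p => φ p + χ p)
  | smul {k : ℕ} {φ : Form M k} (f : M → ℝ) :
      ContDiff ℝ ∞ f → Ideal G k φ → Ideal G k (fun p => f p • φ p)
  | wedge {k : ℕ} {φ : Form M k} (α : M → M →L[ℝ] ℝ) :
      ContDiff ℝ ∞ α → Ideal G k φ → Ideal G (k + 1) (wedge α φ)

/-! ### Integral elements, polar spaces, regularity, Cauchy vectors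

Below `I k φ` means that the form `φ` of degree `k` belongs to the ideal `I`, and the tangent
space of the vector space `M` at each point is `M`. -/

/-- The subspace `E` of the tangent space at `p` is an integral element: all forms of the ideal
vanish on it. -/
def IsIntegralElement (I : ∀ k : ℕ, Form M k → Prop) (p : M) (E : Submodule ℝ M) : Prop :=
  ∀ (k : ℕ) (φ : Form M k), I k φ → ∀ w : Fin k → M, (∀ i, w i ∈ E) → φ p w = 0

/-- The polar space `H(E)`: the vectors `v` at `p` with `φ(v, w₁, …, w_k) = 0` for all forms `φ`
of the ideal and all `w₁, …, w_k ∈ E`. If `E` is an integral element these are the `v`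
for which `E + ℝ v` is again an integral element. -/
def polarSpace (I : ∀ k : ℕ, Form M k → Prop) (p : M) (E : Submodule ℝ M) : Submodule ℝ M where
  carrier := {v | ∀ (k : ℕ) (φ : Form M (k + 1)), I (k + 1) φ →
    ∀ w : Fin k → M, (∀ i, w i ∈ E) → (φ p).curryLeft v w = 0}
  add_mem' := by
    intro a b ha hb k φ hφ w hw
    simp only [map_add, ContinuousAlternatingMap.add_apply, ha k φ hφ w hw, hb k φ hφ w hw,
      add_zero]
  zero_mem' := by
    intro k φ _ w _
    rw [map_zero]
    rfl
  smul_mem' := by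
    intro c a ha k φ hφ w hw
    simp only [map_smul, ContinuousAlternatingMap.smul_apply, ha k φ hφ w hw, smul_zero]

/-- The rank of the polar equations of `E`, that is, the codimension of `H(E)`. -/
def polarRank (I : ∀ k : ℕ, Form M k → Prop) (p : M) (E : Submodule ℝ M) : ℕ :=
  Module.finrank ℝ (M ⧸ polarSpace I p E)

/-- A regular integral element: its polar equations have the largest rank among all integral
elements of the same dimension, at all points. -/
def IsRegular (I : ∀ k : ℕ, Form M k → Prop) (p : M) (E : Submodule ℝ M) : Prop :=
  IsIntegralElement I p E ∧
    ∀ (q : M) (E' : Submodule ℝ M), IsIntegralElement I q E' →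
      Module.finrank ℝ E' = Module.finrank ℝ E → polarRank I q E' ≤ polarRank I p E

/-- `v` is a Cauchy (characteristic) vector at `p`: contraction with `v` maps the ideal at `p`
into itself. -/
def IsCauchyVector (I : ∀ k : ℕ, Form M k → Prop) (p v : M) : Prop :=
  ∀ (k : ℕ) (φ : Form M (k + 1)), I (k + 1) φ →
    ∃ χ : Form M k, I k χ ∧ χ p = (φ p).curryLeft v

/-! ### Generic nested integral elements -/

/-- `P` holds for generic vectors of the subspace `H` (on a dense open subset of it). -/
def ForGeneric (H : Submodule ℝ M) (P : M → Prop) : Prop :=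
  ∃ U : Set H, IsOpen U ∧ Dense U ∧ ∀ v ∈ U, P v

/-- `P` holds for generic integral frames `(e₁, …, e_k)` at `p`: `e₁` is generic in the polar space
of `0`, then `e₂` is generic in the polar space of `⟨e₁⟩`, then `e₃` is generic in the polar
space of `⟨e₁, e₂⟩`, and so on. -/
def ForGenericIntegralFrame (I : ∀ k : ℕ, Form M k → Prop) (p : M) :
    (k : ℕ) → ((Fin k → M) → Prop) → Prop
  | 0, P => P Fin.elim0
  | k + 1, P => ForGenericIntegralFrame I p k fun e =>
      ForGeneric (polarSpace I p (Submodule.span ℝ (Set.range e))) fun v => P (Fin.snoc e v)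

/-- The subspace `E_k` spanned by the first `k` vectors of a frame. -/
def flag {n : ℕ} (e : Fin n → M) (k : ℕ) : Submodule ℝ M :=
  Submodule.span ℝ {v | ∃ i : Fin n, (i : ℕ) < k ∧ e i = v}

/-- The meaning of the symbol `N[s₀, …, s_{n-1}]n + s_n` for an ideal `I` of forms on `M`, with
independent variables `x : M → ℝⁿ`, for a system which is well posed in the sense that it
passes Cartan's test. -/
structure HasCartanTable (I : ∀ k : ℕ, Form M k → Prop) {n : ℕ} (x : M →L[ℝ] (Fin n → ℝ))
    (N : ℕ) (s : Fin (n + 1) → ℕ) : Prop where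
  /-- The system lives in `N` variables. -/
  dim : Module.finrank ℝ M = N
  /-- The ideal is closed under exterior differentiation. -/
  closed : ∀ (k : ℕ) (φ : Form M k), I k φ → I (k + 1) (extDeriv φ)
  /-- There are no Cauchy vectors. -/
  no_cauchy : ∀ p v : M, IsCauchyVector I p v → v = 0
  /-- At every point, for a generic chain `0 = E₀ ⊂ E₁ ⊂ ⋯ ⊂ E_n` of integral elements, each `E_k`
  is regular, the rank of the polar equations of `E_k` is `s₀ + ⋯ + s_k`, the `dxⁱ` are
  linearly independent on `E_n`, and `E_n` cannot be enlarged: the genus is `n`. -/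
  characters : ∀ p : M, ForGenericIntegralFrame I p n fun e =>
    (∀ k : Fin (n + 1), IsRegular I p (flag e k) ∧
      polarRank I p (flag e k) = ∑ j ∈ Finset.Iic k, s j) ∧
    LinearIndependent ℝ (fun i => x (e i)) ∧
    polarSpace I p (flag e n) = flag e n
  /-- The first integer is the sum of the others. -/
  sum_eq : N = (∑ j, s j) + n
  /-- Cartan's test by dimension count: at every point the integral elements of dimension `n` on
  which the `dxⁱ` are independent, written as ranges of sections `L` of `x`, form a nonempty affine
  space of dimension `s₁ + 2 s₂ + ⋯ + n s_n`. -/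
  cartan_test : ∀ p : M, ∃ Q : AffineSubspace ℝ ((Fin n → ℝ) →ₗ[ℝ] M),
    (Q : Set ((Fin n → ℝ) →ₗ[ℝ] M)) =
      {L | (∀ u, x (L u) = u) ∧ IsIntegralElement I p (LinearMap.range L)} ∧
    (Q : Set ((Fin n → ℝ) →ₗ[ℝ] M)).Nonempty ∧
    Module.finrank ℝ Q.direction = ∑ j : Fin (n + 1), (j : ℕ) * s j

end General

/-! ### The gauge field systems -/

/-- The Levi-Civita symbol: the sign of the permutation `σ`, and `0` if `σ` is not one. -/
def leviCivita {n : ℕ} (σ : Fin n → Fin n) : ℝ :=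
  Matrix.det ((1 : Matrix (Fin n) (Fin n) ℝ).submatrix σ id)

/-- The diagonal entries of the Lorentz metric `diag(-1, 1, …, 1)`, which is its own inverse. -/
def lorentz {n : ℕ} (i : Fin n) : ℝ := if (i : ℕ) = 0 then -1 else 1

/-- The space of the variables `xⁱ`, `Aᵃ_i` and `Fᵃ_{ij}`, `i < j`, where `a` takes `m` values. -/
abbrev FieldSpace (n m : ℕ) : Type :=
  (Fin n → ℝ) × (Fin m → Fin n → ℝ) × (Fin m → {q : Fin n × Fin n // q.1 < q.2} → ℝ)

section Gauge

variable {n m : ℕ}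

/-- The independent variables. -/
def xProj (n m : ℕ) : FieldSpace n m →L[ℝ] (Fin n → ℝ) := ContinuousLinearMap.fst ℝ _ _

/-- The covector field `dxⁱ`. -/
def dx (i : Fin n) : FieldSpace n m → FieldSpace n m →L[ℝ] ℝ :=
  fun _ => (ContinuousLinearMap.proj i).comp (xProj n m)

/-- The exterior product `dx^{κ₁} ∧ ⋯ ∧ dx^{κ_r}`. -/
def dxs : {r : ℕ} → (Fin r → Fin n) → Form (FieldSpace n m) r
  | 0, _ => fun _ => ContinuousAlternatingMap.constOfIsEmpty ℝ (FieldSpace n m) (Fin 0) (1 : ℝ)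
  | _ + 1, κ => wedge (dx (κ 0)) (dxs (Fin.tail κ))

/-- The function `Fᵃ_{ij} = -Fᵃ_{ji}`. -/
def fieldStrength (a : Fin m) (i j : Fin n) (p : FieldSpace n m) : ℝ :=
  if h : i < j then p.2.2 a ⟨(i, j), h⟩ else if h : j < i then -p.2.2 a ⟨(j, i), h⟩ else 0

/-- `Aᵃ = Aᵃ_i dxⁱ`. -/
def formA (a : Fin m) : FieldSpace n m → FieldSpace n m →L[ℝ] ℝ :=
  fun p => ∑ i, p.2.1 a i • dx i p

/-- `Fᵃ = ½ Fᵃ_{ij} dxⁱ ∧ dxʲ`. -/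
def formF (a : Fin m) : Form (FieldSpace n m) 2 :=
  fun p => (1 / 2 : ℝ) • ∑ i, ∑ j, fieldStrength a i j p • wedge (dx i) (oneForm (dx j)) p

/-- `θᵃ = dAᵃ - Fᵃ + ⅛ γᵃ_{bc} Aᵇ ∧ Aᶜ`, where `γ a b c` stands for `γᵃ_{bc}`. -/
def theta (γ : Fin m → Fin m → Fin m → ℝ) (a : Fin m) : Form (FieldSpace n m) 2 :=
  fun p => extDeriv (oneForm (formA a)) p - formF a p +
    (1 / 8 : ℝ) • ∑ b, ∑ c, γ a b c • wedge (formA b) (oneForm (formA c)) p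

/-- The dual form in dimension `n = r + 2`,
`*F_a = 1 / (2 (n-2)!) Fᵃ_{ij} ε^{ij}_{k…l} dxᵏ ∧ ⋯ ∧ dxˡ`,
two indices of the Levi-Civita symbol being raised with the Lorentz metric. -/
def starF {r : ℕ} (a : Fin m) : Form (FieldSpace (r + 2) m) r :=
  fun p => (1 / (2 * (r.factorial : ℝ))) • ∑ i : Fin (r + 2), ∑ j : Fin (r + 2),
    ∑ κ : Fin r → Fin (r + 2),
      (fieldStrength a i j p * (lorentz i * lorentz j *
        leviCivita (Matrix.vecCons i (Matrix.vecCons j κ)))) • dxs κ p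

/-- `ψ_a = - d *F_a - ¼ γᶜ_{ab} Aᵇ ∧ *F_c`, a form of degree `n - 1 = r + 1`. -/
def psi {r : ℕ} (γ : Fin m → Fin m → Fin m → ℝ) (a : Fin m) :
    Form (FieldSpace (r + 2) m) (r + 1) :=
  fun p => -extDeriv (starF a) p -
    (1 / 4 : ℝ) • ∑ b, ∑ c, γ c a b • wedge (formA b) (starF c) p

/-- The generators `θᵃ`, `dθᵃ`, `ψ_a` of the system in dimension `n = r + 2`. -/
inductive GaugeGenerator (r : ℕ) (γ : Fin m → Fin m → Fin m → ℝ) :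
    ∀ k : ℕ, Form (FieldSpace (r + 2) m) k → Prop
  | theta (a : Fin m) : GaugeGenerator r γ 2 (theta γ a)
  | dtheta (a : Fin m) : GaugeGenerator r γ 3 (extDeriv (theta γ a))
  | psi (a : Fin m) : GaugeGenerator r γ (r + 1) (psi γ a)

end Gauge

/-- The exterior differential system of the vacuum Maxwell equations in `r + 2` dimensions. -/
def maxwell (r : ℕ) : ∀ k : ℕ, Form (FieldSpace (r + 2) 1) k → Prop :=
  Ideal (GaugeGenerator r fun _ _ _ => 0)

/-- The exterior differential system of the `SU(2)` Yang–Mills equations in `r + 2` dimensions; the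
structure constants are completely antisymmetric with `γ¹₂₃ = 1`. -/
def yangMills (r : ℕ) : ∀ k : ℕ, Form (FieldSpace (r + 2) 3) k → Prop :=
  Ideal (GaugeGenerator r fun a b c => leviCivita ![a, b, c])

end EDS

end

open scoped ContDiff

noncomputable section

namespace EDS

/-! ### Alternating forms on a subspace enlarged by one vector -/

section Alternating

variable {M : Type*} [AddCommGroup M] [Module ℝ M] {k : ℕ}

/-! Put n = r + 2. At a fixed point, up to sign and up to terms in the dxⁱ alone, the generators are
dAᵃ_i ∧ dxⁱ, dFᵃ and d*F_a; for dθᵃ this holds modulo multiples of the θᵇ. Hence integral elements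
are the subspaces killed by three families of model forms, each a symbol, linear in the vertical
components, plus a horizontal term (`exists_isModelElement_iff`).

Polar ranks: for an integral element E of dimension k, contracting the model forms with v gives
forms of degrees 1, 2 and r on E, so the rank is at most m (k + C(k,2) + C(k,r)). The bound is
attained if E projects injectively into a hyperplane that is not null, because vertical vectors then
realise every right-hand side. For dA this is clear. For dF it is the solvability of a
noncharacteristic Cauchy problem: a two-form corresponds bijectively to the restrictions of itself
and of its dual to such a hyperplane (`twoForm_eq_zero`, `exists_twoForm`), the dimensions agreeing
by C(n,2) = C(n-1,2) + (n-1). Since vertical vectors suffice, H(E) projects onto ℝⁿ, and a generic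
extension stays inside some non-null hyperplane as long as its dimension is below n
(`IsNonNull.exists_contDiff`). In dimension n the element projects isomorphically, so H(E) = E and
the rank is N - n, which is maximal because E ≤ H(E) always.

Cartan's test: integral sections of x solve an inhomogeneous linear system whose linear part is
surjective (`sectionMap_surjective`). The essential point is that the exterior derivative and the
divergence of a field of two-forms can be prescribed independently (`exists_field`). Rank-nullity
then gives the dimension.

Cauchy vectors: such a vector lies in every integral element that equals its polar space, in
particular in the range of every integral section; comparing two sections forces it to vanish.

Closure: only dψ needs work. After substituting for dA and d*F modulo the ideal, the terms F ∧ *F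
cancel by symmetry against the antisymmetric structure constants, and the terms A ∧ A ∧ *F cancel by
the Jacobi identity (`extDeriv_psi`). -/

theorem alternatingMap_curryLeft_apply (f : M [⋀^Fin (k + 1)]→ₗ[ℝ] ℝ) (v : M) (w : Fin k → M) :
    f.curryLeft v w = f (Fin.cons v w) := rfl

/-- Split the first argument as u + c v and induct on the degree: the contraction with v vanishes
when v occurs again, and the contraction with u ∈ E satisfies the same hypotheses. This is why
adjoining a vector of the polar space keeps an element integral. -/
theorem eq_zero_on_sup_span (f : M [⋀^Fin (k + 1)]→ₗ[ℝ] ℝ) (E : Submodule ℝ M) (v : M)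
    (h₁ : ∀ w : Fin (k + 1) → M, (∀ i, w i ∈ E) → f w = 0)
    (h₂ : ∀ w : Fin k → M, (∀ i, w i ∈ E) → f.curryLeft v w = 0)
    (w : Fin (k + 1) → M) (hw : ∀ i, w i ∈ E ⊔ Submodule.span ℝ {v}) : f w = 0 := by
  induction k with
  | zero =>
    obtain ⟨u, hu, c, hc⟩ := Submodule.mem_sup.1 (hw 0)
    obtain ⟨c, rfl⟩ := Submodule.mem_span_singleton.1 hc.1
    have : f w = f.curryLeft u (Fin.tail w) + c • f.curryLeft v (Fin.tail w) := by
      rw [← AlternatingMap.smul_apply, ← map_smul,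
        ← AlternatingMap.add_apply, ← map_add, hc.2, alternatingMap_curryLeft_apply,
        Fin.cons_self_tail]
    rw [this, h₂ _ fun i => i.elim0, alternatingMap_curryLeft_apply, h₁ _ fun i => by
      have : i = 0 := Fin.fin_one_eq_zero i
      subst this; simpa using hu]
    simp
  | succ k ih =>
    obtain ⟨u, hu, c, hc⟩ := Submodule.mem_sup.1 (hw 0)
    obtain ⟨c, rfl⟩ := Submodule.mem_span_singleton.1 hc.1
    have : f w = f.curryLeft u (Fin.tail w) + c • f.curryLeft v (Fin.tail w) := by
      rw [← AlternatingMap.smul_apply, ← map_smul,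
        ← AlternatingMap.add_apply, ← map_add, hc.2, alternatingMap_curryLeft_apply,
        Fin.cons_self_tail]
    rw [this, ih (f.curryLeft u), ih (f.curryLeft v)]
    · simp
    · exact h₂
    · intro w _
      exact f.map_eq_zero_of_eq (i := 0) (j := 1) _ rfl (by simp)
    · exact fun i => hw i.succ
    · intro w hw
      exact h₁ _ fun i => by cases i using Fin.cases <;> simp [hu, hw]
    · intro w hw
      have h := h₂ (Fin.cons u w) fun i => by cases i using Fin.cases <;> simp [hu, hw]
      -- The hypothesis on v has v in front of u, while the induction contracts with u first; a
      -- transposition exchanges them.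
      have h' := f.map_swap (Fin.cons v (Fin.cons u w)) (i := 0) (j := 1) (by simp)
      rw [alternatingMap_curryLeft_apply] at h
      rw [h, neg_zero] at h'
      rw [alternatingMap_curryLeft_apply, alternatingMap_curryLeft_apply, ← h']
      congr 1
      funext i
      refine Fin.cases ?_ (fun i => Fin.cases ?_ (fun i => ?_) i) i
      · simp
      · simp [show (Fin.succ 0 : Fin (k + 2)) = 1 from rfl]
      · rw [Function.comp_apply, Equiv.swap_apply_of_ne_of_ne (by simp)
          (by simp [Fin.ext_iff])]
        rfl
    · exact fun i => hw i.succ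

end Alternating

/-! ### Exterior products and derivatives, ideals and integral elements -/

section General

variable {M : Type} [NormedAddCommGroup M] [NormedSpace ℝ M] {k : ℕ}

/-- The exterior product of a covector and an alternating form, as a continuous bilinear map. -/
def wedgeL : (M →L[ℝ] ℝ) →L[ℝ] (M [⋀^Fin k]→L[ℝ] ℝ) →L[ℝ] (M [⋀^Fin (k + 1)]→L[ℝ] ℝ) :=
  (ContinuousLinearMap.compL ℝ _ _ _
    (ContinuousAlternatingMap.alternatizeUncurryFinCLM ℝ M ℝ)).comp
    (ContinuousLinearMap.smulRightL ℝ M (M [⋀^Fin k]→L[ℝ] ℝ))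

theorem wedgeL_eq (a : M →L[ℝ] ℝ) (f : M [⋀^Fin k]→L[ℝ] ℝ) :
    wedgeL a f = ContinuousAlternatingMap.alternatizeUncurryFin (a.smulRight f) := rfl

theorem wedge_eq (α : M → M →L[ℝ] ℝ) (φ : Form M k) (p : M) :
    wedge α φ p = wedgeL (α p) (φ p) := rfl

theorem alternatizeUncurryFin_apply_real (f : M →L[ℝ] M [⋀^Fin k]→L[ℝ] ℝ) (w : Fin (k + 1) → M) :
    ContinuousAlternatingMap.alternatizeUncurryFin f w =
      ∑ i : Fin (k + 1), (-1) ^ (i : ℕ) * f (w i) (i.removeNth w) := by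
  rw [ContinuousAlternatingMap.alternatizeUncurryFin_apply]
  refine Finset.sum_congr rfl fun i _ => ?_
  rcases Nat.even_or_odd (i : ℕ) with h | h <;> simp [h.neg_one_pow]

theorem wedgeL_apply (a : M →L[ℝ] ℝ) (f : M [⋀^Fin k]→L[ℝ] ℝ) (w : Fin (k + 1) → M) :
    wedgeL a f w = ∑ i : Fin (k + 1), (-1) ^ (i : ℕ) * (a (w i) * f (i.removeNth w)) := by
  rw [wedgeL_eq, alternatizeUncurryFin_apply_real]
  rfl

/-- Alternating a bilinear family twice is antisymmetric in the two linear arguments. -/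
theorem alternatize_alternatize_flip (f : M →L[ℝ] M →L[ℝ] M [⋀^Fin k]→L[ℝ] ℝ) :
    ContinuousAlternatingMap.alternatizeUncurryFin
      ((ContinuousAlternatingMap.alternatizeUncurryFinCLM ℝ M ℝ).comp f) =
    -ContinuousAlternatingMap.alternatizeUncurryFin
      ((ContinuousAlternatingMap.alternatizeUncurryFinCLM ℝ M ℝ).comp f.flip) := by
  rw [eq_neg_iff_add_eq_zero, ← ContinuousAlternatingMap.alternatizeUncurryFin_add,
    ← ContinuousLinearMap.comp_add]
  -- `f + f.flip` is symmetric in its two linear arguments, so alternating twice kills it, as in d²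
  -- = 0.
  apply ContinuousAlternatingMap.alternatizeUncurryFin_alternatizeUncurryFinCLM_comp_of_symmetric
  intro x y
  simp [add_comm]

/-- Interchanging the slot of the covector with the direction of differentiation costs a sign. It
becomes the minus sign in d(α ∧ φ) = dα ∧ φ - α ∧ dφ. -/
theorem alternatize_wedgeL (a : M →L[ℝ] ℝ) (f : M →L[ℝ] M [⋀^Fin k]→L[ℝ] ℝ) :
    ContinuousAlternatingMap.alternatizeUncurryFin ((wedgeL a).comp f) =
      -wedgeL a (ContinuousAlternatingMap.alternatizeUncurryFin f) := by
  have h := alternatize_alternatize_flip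
    ((ContinuousLinearMap.smulRightL ℝ M (M [⋀^Fin k]→L[ℝ] ℝ) a).comp f)
  convert h using 2
  · rfl
  rw [wedgeL_eq]
  congr 1
  ext x w
  simp only [ContinuousLinearMap.smulRight_apply, ContinuousAlternatingMap.smul_apply,
    alternatizeUncurryFin_apply_real, Finset.mul_sum, smul_eq_mul, ContinuousLinearMap.comp_apply,
    ContinuousAlternatingMap.alternatizeUncurryFinCLM_apply, ContinuousLinearMap.flip_apply]
  exact Finset.sum_congr rfl fun i _ => mul_left_comm _ _ _

theorem wedgeL_anticomm (a b : M →L[ℝ] ℝ) (f : M [⋀^Fin k]→L[ℝ] ℝ) :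
    wedgeL a (wedgeL b f) = -wedgeL b (wedgeL a f) := by
  rw [wedgeL_eq b f, eq_neg_iff_add_eq_zero, ← neg_eq_iff_add_eq_zero, ← alternatize_wedgeL,
    wedgeL_eq b]
  congr 1
  ext x w
  simp

theorem wedgeL_comm_even (a b c : M →L[ℝ] ℝ) (f : M [⋀^Fin k]→L[ℝ] ℝ) :
    wedgeL a (wedgeL b (wedgeL c f)) = wedgeL c (wedgeL a (wedgeL b f)) := by
  rw [wedgeL_anticomm b c, map_neg, wedgeL_anticomm a c, neg_neg]

/-! ### Exterior derivatives of products -/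

theorem extDeriv_wedge {α : M → M →L[ℝ] ℝ} {φ : Form M k} {p : M}
    (hα : DifferentiableAt ℝ α p) (hφ : DifferentiableAt ℝ φ p) :
    extDeriv (wedge α φ) p =
      ContinuousAlternatingMap.alternatizeUncurryFin
        ((wedgeL.flip (φ p)).comp (fderiv ℝ α p)) - wedgeL (α p) (extDeriv φ p) := by
  have h : HasFDerivAt (wedge α φ) _ p :=
    wedgeL.hasFDerivAt_of_bilinear hα.hasFDerivAt hφ.hasFDerivAt
  rw [extDeriv, h.fderiv, ContinuousAlternatingMap.alternatizeUncurryFin_add, extDeriv,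
    sub_eq_neg_add, ← alternatize_wedgeL]
  congr 2

/-- This expresses dα ∧ φ through products with covectors only, which are the products available in
the inductive definition of an ideal. -/
theorem alternatize_wedgeL_sum {ι : Type*} [Fintype ι] (g c : ι → M →L[ℝ] ℝ)
    (A : M →L[ℝ] M →L[ℝ] ℝ) (hA : ∀ v, A v = ∑ i, g i v • c i) (f : M [⋀^Fin k]→L[ℝ] ℝ) :
    ContinuousAlternatingMap.alternatizeUncurryFin ((wedgeL.flip f).comp A) =
      ∑ i, wedgeL (g i) (wedgeL (c i) f) := by
  have : (wedgeL.flip f).comp A = ∑ i, (g i).smulRight (wedgeL (c i) f) := by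
    ext v w
    simp [hA]
  rw [this, ← ContinuousAlternatingMap.alternatizeUncurryFinCLM_apply, map_sum]
  rfl

theorem extDeriv_smul_function {f : M → ℝ} {φ : Form M k} {p : M}
    (hf : DifferentiableAt ℝ f p) (hφ : DifferentiableAt ℝ φ p) :
    extDeriv (fun p => f p • φ p) p = wedgeL (fderiv ℝ f p) (φ p) + f p • extDeriv φ p := by
  rw [extDeriv, (hf.hasFDerivAt.fun_smul hφ.hasFDerivAt).fderiv,
    ContinuousAlternatingMap.alternatizeUncurryFin_add,
    ContinuousAlternatingMap.alternatizeUncurryFin_smul]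
  exact add_comm _ _

theorem contDiff_wedge {α : M → M →L[ℝ] ℝ} {φ : Form M k} (hα : ContDiff ℝ ∞ α)
    (hφ : ContDiff ℝ ∞ φ) : ContDiff ℝ ∞ (wedge α φ) := by
  have : ContDiff ℝ ∞ fun p => wedgeL (α p) (φ p) :=
    ((ContinuousLinearMap.contDiff _).comp hα).clm_apply hφ
  exact this

theorem contDiff_extDeriv {φ : Form M k} (hφ : ContDiff ℝ ∞ φ) : ContDiff ℝ ∞ (extDeriv φ) := by
  have h : ContDiff ℝ ∞ (fderiv ℝ φ) := hφ.fderiv_right (by simp)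
  have : ContDiff ℝ ∞ fun p =>
    ContinuousAlternatingMap.alternatizeUncurryFinCLM ℝ M ℝ (fderiv ℝ φ p) :=
    (ContinuousLinearMap.contDiff _).comp h
  exact this

theorem extDeriv_extDeriv_of_smooth {φ : Form M k} (hφ : ContDiff ℝ ∞ φ) :
    extDeriv (extDeriv φ) = 0 :=
  extDeriv_extDeriv hφ (by simpa using WithTop.coe_le_coe.2 (le_top (a := (2 : ℕ∞))))

/-! ### Ideals of forms -/

section Ideal

variable {G : ∀ k : ℕ, Form M k → Prop}

theorem Ideal.sum {ι : Type*} (s : Finset ι) (φ : ι → Form M k)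
    (h : ∀ i ∈ s, Ideal G k (φ i)) : Ideal G k (fun p => ∑ i ∈ s, φ i p) := by
  classical
  induction s using Finset.induction_on with
  | empty => simpa using Ideal.zero
  | insert a s ha ih =>
    simp only [Finset.sum_insert ha]
    exact (h a (by simp)).add (ih fun i hi => h i (by simp [hi]))

theorem Ideal.const_smul {φ : Form M k} (c : ℝ) (h : Ideal G k φ) :
    Ideal G k (fun p => c • φ p) :=
  h.smul (fun _ => c) contDiff_const

theorem Ideal.sub {φ χ : Form M k} (h : Ideal G k φ) (h' : Ideal G k χ) :
    Ideal G k (fun p => φ p - χ p) := by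
  convert h.add (h'.const_smul (-1)) using 1
  funext p
  ext w
  simp [sub_eq_add_neg]

theorem Ideal.contDiff (hG : ∀ k φ, G k φ → ContDiff ℝ ∞ φ) {φ : Form M k}
    (h : Ideal G k φ) : ContDiff ℝ ∞ φ := by
  induction h with
  | gen h => exact hG _ _ h
  | zero => exact contDiff_const
  | add _ _ h h' => exact h.add h'
  | smul f hf _ h => exact hf.smul h
  | wedge α hα _ h => exact contDiff_wedge hα h

/-- An ideal is closed under exterior differentiation if it contains the exterior derivatives of
its generators. -/
theorem Ideal.extDeriv_mem [FiniteDimensional ℝ M] (hG : ∀ k φ, G k φ → ContDiff ℝ ∞ φ)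
    (hd : ∀ k φ, G k φ → Ideal G (k + 1) (extDeriv φ)) {φ : Form M k} (h : Ideal G k φ) :
    Ideal G (k + 1) (extDeriv φ) := by
  induction h with
  | gen h => exact hd _ _ h
  | @zero k =>
    convert Ideal.zero using 1
    funext p
    have := extDeriv_smul (𝕜 := ℝ) (x := p) 0 (fun _ : M => (0 : M [⋀^Fin k]→L[ℝ] ℝ))
    rw [zero_smul, zero_smul] at this
    exact this
  | @add k φ χ h₁ h₂ ih₁ ih₂ =>
    convert ih₁.add ih₂ using 1
    funext p
    exact extDeriv_fun_add ((h₁.contDiff hG).differentiable (by simp) p)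
      ((h₂.contDiff hG).differentiable (by simp) p)
  | @smul k φ f hf h ih =>
    convert (h.wedge (fderiv ℝ f) (hf.fderiv_right (by simp))).add (ih.smul f hf) using 1
    funext p
    exact extDeriv_smul_function (hf.differentiable (by simp) p)
      ((h.contDiff hG).differentiable (by simp) p)
  | @wedge k φ α hα h ih =>
    -- The ideal is closed under products with 1-forms, whereas dα is a 2-form. In a basis, dα = ∑
    -- gᵢ ∧ cᵢ with cᵢ the constant dual covectors and gᵢ the differential of the i-th component of
    -- α.
    let b := Module.finBasis ℝ M
    let c : Fin (Module.finrank ℝ M) → M →L[ℝ] ℝ := fun i => (b.coord i).toContinuousLinearMap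
    let g : Fin (Module.finrank ℝ M) → M → M →L[ℝ] ℝ := fun i p =>
      (ContinuousLinearMap.apply ℝ ℝ (b i)).comp (fderiv ℝ α p)
    have hg : ∀ i, ContDiff ℝ ∞ (g i) := fun i =>
      contDiff_const.clm_comp (hα.fderiv_right (by simp))
    have := (Ideal.sum Finset.univ (fun i => EDS.wedge (g i) (EDS.wedge (fun _ => c i) φ))
      fun i _ => (h.wedge (fun _ => c i) contDiff_const).wedge (g i) (hg i)).sub (ih.wedge α hα)
    convert this using 1
    funext p
    rw [extDeriv_wedge (hα.differentiable (by simp) p)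
      ((h.contDiff hG).differentiable (by simp) p),
      alternatize_wedgeL_sum (fun i => g i p) c]
    · rfl
    · intro v
      ext u
      conv_lhs => rw [← b.sum_repr u, map_sum]
      simp [g, c, mul_comm]

/-! ### Integral elements -/

theorem Ideal.apply_eq_zero {φ : Form M k} (h : Ideal G k φ) {p : M} {E : Submodule ℝ M}
    (hE : ∀ k φ, G k φ → ∀ w : Fin k → M, (∀ i, w i ∈ E) → φ p w = 0)
    (w : Fin k → M) (hw : ∀ i, w i ∈ E) : φ p w = 0 := by
  induction h with
  | gen h => exact hE _ _ h w hw
  | zero => simp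
  | add _ _ h h' => simp [h w hw, h' w hw]
  | smul f hf _ h => simp [h w hw]
  | wedge α hα _ h =>
    rw [wedge_eq, wedgeL_apply]
    refine Finset.sum_eq_zero fun i _ => ?_
    rw [h (i.removeNth w) fun j => hw _, mul_zero, mul_zero]

theorem isIntegralElement_ideal_iff {p : M} {E : Submodule ℝ M} :
    IsIntegralElement (Ideal G) p E ↔
      ∀ k φ, G k φ → ∀ w : Fin k → M, (∀ i, w i ∈ E) → φ p w = 0 :=
  ⟨fun h k φ hφ => h k φ (.gen hφ), fun h _ _ hφ w hw => hφ.apply_eq_zero h w hw⟩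

end Ideal

section Polar

variable {I : ∀ k : ℕ, Form M k → Prop} {p : M} {E : Submodule ℝ M}

theorem IsIntegralElement.le_polarSpace (hE : IsIntegralElement I p E) : E ≤ polarSpace I p E := by
  intro v hv k φ hφ w hw
  exact hE _ φ hφ _ fun i => by cases i using Fin.cases <;> simp [hv, hw]

theorem IsIntegralElement.sup_span (hE : IsIntegralElement I p E) {v : M}
    (hv : v ∈ polarSpace I p E) : IsIntegralElement I p (E ⊔ Submodule.span ℝ {v}) := by
  intro k φ hφ w hw
  cases k with
  | zero => exact hE _ φ hφ w fun i => i.elim0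
  | succ k => exact eq_zero_on_sup_span (φ p).toAlternatingMap E v (hE _ φ hφ) (hv k φ hφ) w hw

end Polar

end General

theorem removeNth_succ_cons {E : Type*} {k : ℕ} (y : E) (w : Fin (k + 1) → E) (j : Fin (k + 1)) :
    j.succ.removeNth (Fin.cons y w : Fin (k + 2) → E) = Fin.cons y (j.removeNth w) := by
  funext i
  cases i using Fin.cases <;> simp [Fin.removeNth]

/-! ### Dimensions and evaluation of alternating forms -/

section Alternating

variable {E : Type*} [AddCommGroup E] [Module ℝ E]

instance alternatingMap_finite [FiniteDimensional ℝ E] (d : ℕ) :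
    Module.Finite ℝ (E [⋀^Fin d]→ₗ[ℝ] ℝ) :=
  Module.Finite.equiv (exteriorPower.alternatingMapLinearEquiv (R := ℝ) (M := E) (n := d)).symm

theorem finrank_alternatingMap [FiniteDimensional ℝ E] (d : ℕ) :
    Module.finrank ℝ (E [⋀^Fin d]→ₗ[ℝ] ℝ) = (Module.finrank ℝ E).choose d := by
  rw [(exteriorPower.alternatingMapLinearEquiv (R := ℝ) (M := E) (n := d)).finrank_eq,
    Module.finrank_linearMap_self, exteriorPower.finrank_eq]

theorem alternatingMap_sum_apply {ι κ : Type*} (s : Finset ι) (f : ι → E [⋀^κ]→ₗ[ℝ] ℝ)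
    (w : κ → E) : (∑ i ∈ s, f i) w = ∑ i ∈ s, f i w :=
  map_sum ((⟨⟨fun g => g w, rfl⟩, fun _ _ => rfl⟩ : (E [⋀^κ]→ₗ[ℝ] ℝ) →+ ℝ)) f s

theorem alternatingMap_alternatizeUncurryFin_apply_real {k : ℕ} (f : E →ₗ[ℝ] E [⋀^Fin k]→ₗ[ℝ] ℝ)
    (w : Fin (k + 1) → E) : AlternatingMap.alternatizeUncurryFin f w =
      ∑ i : Fin (k + 1), (-1) ^ (i : ℕ) * f (w i) (i.removeNth w) := by
  rw [AlternatingMap.alternatizeUncurryFin_apply]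
  refine Finset.sum_congr rfl fun i _ => ?_
  rcases Nat.even_or_odd (i : ℕ) with h | h <;> simp [h.neg_one_pow]

end Alternating

/-! ### The volume form -/

section Volume

variable {n r : ℕ}

/-- The volume form of `ℝⁿ`. -/
def vol (n : ℕ) : (Fin n → ℝ) [⋀^Fin n]→ₗ[ℝ] ℝ := Matrix.detRowAlternating

/-- The standard basis vectors. -/
def stdVec (i : Fin n) : Fin n → ℝ := Pi.single i 1

theorem sum_smul_stdVec (u : Fin n → ℝ) : ∑ i, u i • stdVec i = u := by
  funext j
  simp [stdVec, Finset.sum_apply, Pi.single_apply]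

theorem vol_stdVec : vol n (fun i => stdVec i) = 1 := by
  have : Matrix.of (fun i : Fin n => stdVec i) = 1 := by
    ext i j
    simp [stdVec, Matrix.one_apply, Pi.single_apply, eq_comm]
  exact (congrArg Matrix.det this).trans Matrix.det_one

theorem vol_stdVec_comp (σ : Fin n → Fin n) : vol n (fun i => stdVec (σ i)) = leviCivita σ := by
  have : (fun i => stdVec (σ i) : Matrix (Fin n) (Fin n) ℝ) =
      (1 : Matrix (Fin n) (Fin n) ℝ).submatrix σ id := by
    ext i j
    simp [stdVec, Matrix.one_apply, Pi.single_apply, eq_comm]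
  rw [leviCivita, ← this]
  rfl

/-- A form of degree larger than the dimension vanishes. -/
theorem covector_wedge_vol (l : (Fin n → ℝ) →ₗ[ℝ] ℝ) (w : Fin (n + 1) → Fin n → ℝ) :
    ∑ i : Fin (n + 1), (-1) ^ (i : ℕ) * (l (w i) * vol n (i.removeNth w)) = 0 := by
  have h : AlternatingMap.alternatizeUncurryFin (l.smulRight (vol n)) w = 0 := by
    apply AlternatingMap.map_linearDependent
    intro h
    simpa using h.fintype_card_le_finrank
  rw [alternatingMap_alternatizeUncurryFin_apply_real] at h
  exact h

/-- Contract the identity l ∧ vol = 0 with y. -/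
theorem covector_mul_vol (l : (Fin (n + 1) → ℝ) →ₗ[ℝ] ℝ) (y : Fin (n + 1) → ℝ)
    (w : Fin (n + 1) → Fin (n + 1) → ℝ) :
    l y * vol (n + 1) w =
      ∑ j : Fin (n + 1), (-1) ^ (j : ℕ) * (l (w j) * (vol (n + 1)).curryLeft y (j.removeNth w)) := by
  have h := covector_wedge_vol l (Fin.cons y w)
  rw [Fin.sum_univ_succ] at h
  simp only [removeNth_succ_cons, Fin.cons_succ, Fin.cons_zero, Fin.val_succ, pow_succ] at h
  simp only [Fin.val_zero, pow_zero, one_mul, mul_neg, mul_one, neg_mul, Finset.sum_neg_distrib,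
    Fin.removeNth_zero, Fin.tail_cons] at h
  exact add_neg_eq_zero.1 h

theorem vol_curryLeft_injective : Function.Injective (vol (n + 1)).curryLeft := by
  rw [← LinearMap.ker_eq_bot, LinearMap.ker_eq_bot']
  intro y hy
  funext i
  have h := covector_mul_vol (LinearMap.proj i) y (fun i => stdVec i)
  rw [vol_stdVec, hy] at h
  simpa using h

theorem vol_curryLeft_surjective : Function.Surjective (vol (n + 1)).curryLeft := by
  apply (LinearMap.injective_iff_surjective_of_finrank_eq_finrank _).1 vol_curryLeft_injective
  rw [finrank_alternatingMap]
  simp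

/-- The contraction of the volume form with two vectors. -/
def vol₂ (y z : Fin (r + 2) → ℝ) : (Fin (r + 2) → ℝ) [⋀^Fin r]→ₗ[ℝ] ℝ :=
  ((vol (r + 2)).curryLeft y).curryLeft z

theorem vol₂_apply (y z : Fin (r + 2) → ℝ) (w : Fin r → Fin (r + 2) → ℝ) :
    vol₂ y z w = vol (r + 2) (Fin.cons y (Fin.cons z w)) := rfl

theorem vol₂_self (y : Fin (r + 2) → ℝ) : vol₂ y y = 0 := by
  ext w
  exact (vol (r + 2)).map_eq_zero_of_eq (i := 0) (j := 1) _ rfl (by simp)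

/-- The contraction of the volume form with two vectors, as a bilinear map. -/
def vol₂L : (Fin (r + 2) → ℝ) →ₗ[ℝ] (Fin (r + 2) → ℝ) →ₗ[ℝ]
    (Fin (r + 2) → ℝ) [⋀^Fin r]→ₗ[ℝ] ℝ :=
  LinearMap.mk₂ ℝ vol₂ (by intros; simp [vol₂]) (by intros; simp [vol₂])
    (by intros; simp [vol₂]) (by intros; simp [vol₂])

theorem vol₂_swap (y z : Fin (r + 2) → ℝ) : vol₂ y z = -vol₂ z y := by
  have h := vol₂_self (y + z)
  change vol₂L (y + z) (y + z) = 0 at h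
  simp only [map_add, LinearMap.add_apply] at h
  change vol₂ y y + vol₂ z y + (vol₂ y z + vol₂ z z) = 0 at h
  rw [vol₂_self, vol₂_self, zero_add, add_zero] at h
  exact eq_neg_of_add_eq_zero_right h

/-- Contracting l ∧ vol = 0 with both y and z gives this identity. It yields the divergence formula
and also the nondegeneracy used for duals on hyperplanes. -/
theorem covector_vol₂ (l : (Fin (r + 2) → ℝ) →ₗ[ℝ] ℝ) (y z : Fin (r + 2) → ℝ)
    (w : Fin (r + 1) → Fin (r + 2) → ℝ) :
    ∑ s : Fin (r + 1), (-1) ^ (s : ℕ) * (l (w s) * vol₂ y z (s.removeNth w)) =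
      l z * (vol (r + 2)).curryLeft y w - l y * (vol (r + 2)).curryLeft z w := by
  have h := covector_mul_vol l y (Fin.cons z w)
  rw [Fin.sum_univ_succ] at h
  simp only [removeNth_succ_cons, Fin.cons_succ, Fin.cons_zero, Fin.val_succ, pow_succ] at h
  simp only [Fin.val_zero, pow_zero, one_mul, mul_neg, mul_one, neg_mul, Finset.sum_neg_distrib,
    Fin.removeNth_zero, Fin.tail_cons] at h
  have h' : vol (r + 2) (Fin.cons z w) = (vol (r + 2)).curryLeft z w := rfl
  rw [h'] at h
  change _ = _ + -∑ s : Fin (r + 1), (-1) ^ (s : ℕ) * (l (w s) * vol₂ y z (s.removeNth w)) at h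
  linarith

/-! ### Two-forms and their duals -/

/-- Raising an index with the Lorentz metric. -/
def sharp : (Fin n → ℝ) →ₗ[ℝ] (Fin n → ℝ) where
  toFun ν i := lorentz i * ν i
  map_add' _ _ := by ext; simp [mul_add]
  map_smul' _ _ := by ext; simp [mul_left_comm]

theorem sharp_apply (ν : Fin n → ℝ) (i : Fin n) : sharp ν i = lorentz i * ν i := rfl

theorem lorentz_mul_self (i : Fin n) : lorentz i * lorentz i = 1 := by
  unfold lorentz; split <;> norm_num

/-- The Lorentz quadratic form. -/
def lorentzSq (ν : Fin n → ℝ) : ℝ := ∑ i, lorentz i * ν i ^ 2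

theorem dotProduct_sharp (ν : Fin n → ℝ) : ν ⬝ᵥ sharp ν = lorentzSq ν := by
  simp only [dotProduct, lorentzSq, sharp_apply]
  exact Finset.sum_congr rfl fun i _ => by ring

/-- The dual of a two-form. -/
def dualForm : ((Fin (r + 2) → ℝ) [⋀^Fin 2]→ₗ[ℝ] ℝ) →ₗ[ℝ] (Fin (r + 2) → ℝ) [⋀^Fin r]→ₗ[ℝ] ℝ where
  toFun τ := (1 / 2 : ℝ) • ∑ i, ∑ j,
    (τ ![stdVec i, stdVec j] * (lorentz i * lorentz j)) • vol₂ (stdVec i) (stdVec j)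
  map_add' _ _ := by simp [add_mul, add_smul, Finset.sum_add_distrib]
  map_smul' _ _ := by simp [Finset.smul_sum, smul_smul, mul_assoc, mul_left_comm]

theorem dualForm_apply (τ : (Fin (r + 2) → ℝ) [⋀^Fin 2]→ₗ[ℝ] ℝ) : dualForm τ = (1 / 2 : ℝ) • ∑ i, ∑ j,
    (τ ![stdVec i, stdVec j] * (lorentz i * lorentz j)) • vol₂ (stdVec i) (stdVec j) := rfl

theorem sum_smul_vol₂ (y z : Fin (r + 2) → ℝ) :
    ∑ i, ∑ j, (y i * z j) • vol₂ (stdVec i) (stdVec j) = vol₂ y z := by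
  change _ = vol₂L y z
  conv_rhs => rw [← sum_smul_stdVec y, ← sum_smul_stdVec z]
  simp only [map_sum, LinearMap.sum_apply, map_smul, LinearMap.smul_apply, Finset.smul_sum,
    smul_smul]
  rw [Finset.sum_comm]
  refine Finset.sum_congr rfl fun i _ => Finset.sum_congr rfl fun j _ => ?_
  rw [mul_comm]
  rfl

/-- The two terms of ν ∧ β contribute equally, by antisymmetry of `vol₂`, and cancel the factor 1/2.
-/
theorem dualForm_of_wedge (τ : (Fin (r + 2) → ℝ) [⋀^Fin 2]→ₗ[ℝ] ℝ) (ν β : Fin (r + 2) → ℝ)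
    (h : ∀ i j, τ ![stdVec i, stdVec j] = ν i * β j - ν j * β i) :
    dualForm τ = vol₂ (sharp ν) (sharp β) := by
  have h₁ := sum_smul_vol₂ (sharp ν) (sharp β)
  have h₂ := sum_smul_vol₂ (sharp β) (sharp ν)
  rw [vol₂_swap (sharp β)] at h₂
  have h₃ : ∑ i, ∑ j, (τ ![stdVec i, stdVec j] * (lorentz i * lorentz j)) •
      vol₂ (r := r) (stdVec i) (stdVec j) = vol₂ (sharp ν) (sharp β) - -vol₂ (sharp ν) (sharp β) := by
    rw [← h₂]
    nth_rw 1 [← h₁]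
    simp only [← Finset.sum_sub_distrib]
    refine Finset.sum_congr rfl fun i _ => Finset.sum_congr rfl fun j _ => ?_
    rw [h, sharp_apply, sharp_apply, sharp_apply, sharp_apply]
    refine Eq.trans ?_ (sub_smul _ _ _)
    congr 1
    ring
  rw [dualForm_apply, h₃, sub_neg_eq_add, ← two_smul ℝ, smul_smul]
  norm_num

theorem twoForm_ext {τ τ' : (Fin n → ℝ) [⋀^Fin 2]→ₗ[ℝ] ℝ}
    (h : ∀ i j, τ ![stdVec i, stdVec j] = τ' ![stdVec i, stdVec j]) : τ = τ' := by
  refine Module.Basis.ext_alternating (Pi.basisFun ℝ (Fin n)) fun v _ => ?_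
  have : (fun i => Pi.basisFun ℝ (Fin n) (v i)) = ![stdVec (v 0), stdVec (v 1)] := by
    funext i
    fin_cases i <;> simp [stdVec]
  rw [this, h]

theorem twoForm_swap (τ : (Fin n → ℝ) [⋀^Fin 2]→ₗ[ℝ] ℝ) (u v : Fin n → ℝ) :
    τ ![u, v] = -τ ![v, u] := by
  rw [← τ.map_swap ![v, u] (i := 0) (j := 1) (by simp)]
  congr 1
  funext i
  fin_cases i <;> simp

theorem twoForm_self (τ : (Fin n → ℝ) [⋀^Fin 2]→ₗ[ℝ] ℝ) (u : Fin n → ℝ) : τ ![u, u] = 0 :=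
  τ.map_eq_zero_of_eq (i := 0) (j := 1) _ rfl (by simp)

/-- A two-form as a bilinear map. -/
def twoForm₂ (τ : (Fin n → ℝ) [⋀^Fin 2]→ₗ[ℝ] ℝ) : (Fin n → ℝ) →ₗ[ℝ] (Fin n → ℝ) →ₗ[ℝ] ℝ :=
  LinearMap.mk₂ ℝ (fun u v => τ ![u, v]) 
    (fun u u' v => by 
      have := τ.curryLeft.map_add u u'
      exact congrArg (fun f => f ![v]) this)
    (fun c u v => by 
      have := τ.curryLeft.map_smul c u
      exact congrArg (fun f => f ![v]) this)
    (fun u v v' => by 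
      have := (τ.curryLeft u).curryLeft.map_add v v'
      exact congrArg (fun f => f ![]) this)
    (fun c u v => by 
      have := (τ.curryLeft u).curryLeft.map_smul c v
      exact congrArg (fun f => f ![]) this)

theorem twoForm₂_apply (τ : (Fin n → ℝ) [⋀^Fin 2]→ₗ[ℝ] ℝ) (u v : Fin n → ℝ) :
    twoForm₂ τ u v = τ ![u, v] := rfl

theorem linear_eq_sum (l : (Fin n → ℝ) →ₗ[ℝ] ℝ) (u : Fin n → ℝ) :
    l u = ∑ i, u i * l (stdVec i) := by
  conv_lhs => rw [← sum_smul_stdVec u, map_sum]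
  simp

/-- A two-form which vanishes together with its dual on a hyperplane that is not null is zero. -/
theorem twoForm_eq_zero (ν : Fin (r + 2) → ℝ) (hν : lorentzSq ν ≠ 0)
    (τ : (Fin (r + 2) → ℝ) [⋀^Fin 2]→ₗ[ℝ] ℝ)
    (h₁ : ∀ u v, ν ⬝ᵥ u = 0 → ν ⬝ᵥ v = 0 → τ ![u, v] = 0)
    (h₂ : ∀ w : Fin r → Fin (r + 2) → ℝ, (∀ i, ν ⬝ᵥ w i = 0) → dualForm τ w = 0) : τ = 0 := by
  set q := lorentzSq ν with hq
  set N := sharp ν with hN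
  have hνN : ν ⬝ᵥ N = q := dotProduct_sharp ν
  let β : Fin (r + 2) → ℝ := fun j => τ ![N, stdVec j] / q
  let l : (Fin (r + 2) → ℝ) →ₗ[ℝ] ℝ := dotProductBilin ℝ ℝ ν
  have hl : ∀ u, l u = ν ⬝ᵥ u := fun u => rfl
  -- Since ν(N) = q ≠ 0, subtracting multiples of N moves u and v into the hyperplane, where τ
  -- vanishes. Hence τ = ν ∧ β.
  have hdec : ∀ u v, τ ![u, v] = (ν ⬝ᵥ u) * (τ ![N, v] / q) - (ν ⬝ᵥ v) * (τ ![N, u] / q) := by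
    intro u v
    have h := h₁ (u - ((ν ⬝ᵥ u) / q) • N) (v - ((ν ⬝ᵥ v) / q) • N)
      (by simp [dotProduct_sub, hνN, hν]) (by simp [dotProduct_sub, hνN, hν])
    rw [← twoForm₂_apply] at h
    simp only [map_sub, map_smul, LinearMap.sub_apply, LinearMap.smul_apply, twoForm₂_apply,
      smul_eq_mul, twoForm_self, twoForm_swap τ u N] at h
    linear_combination h
  have hτ : ∀ i j, τ ![stdVec i, stdVec j] = ν i * β j - ν j * β i := by
    intro i j
    rw [hdec]
    simp [stdVec, β]
  have hstar : dualForm τ = vol₂ N (sharp β) := dualForm_of_wedge τ ν β hτ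
  have hb : l (sharp β) = 0 := by
    have h : twoForm₂ τ N N = 0 := twoForm_self τ N
    rw [linear_eq_sum] at h
    rw [hl]
    simp only [dotProduct, sharp_apply, β]
    have : ∑ i, ν i * (lorentz i * (τ ![N, stdVec i] / q)) =
      (∑ i, N i * (twoForm₂ τ N) (stdVec i)) / q := by
      rw [Finset.sum_div]
      refine Finset.sum_congr rfl fun i _ => ?_
      rw [hN, sharp_apply, twoForm₂_apply]
      ring
    rw [this, h, zero_div]
  -- The dual of ν ∧ β vanishes on the hyperplane by hypothesis, and also when N is inserted because
  -- N is then repeated. The hyperplane and N span everything.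
  have hzero : vol₂ N (sharp β) = 0 := by
    ext w
    rw [AlternatingMap.zero_apply]
    rw [hstar] at h₂
    have htop : ∀ u, u ∈ LinearMap.ker l ⊔ Submodule.span ℝ {N} := by
      intro u
      refine Submodule.mem_sup.2 ⟨u - ((ν ⬝ᵥ u) / q) • N, ?_, ((ν ⬝ᵥ u) / q) • N,
        Submodule.smul_mem _ _ (Submodule.mem_span_singleton_self N), by simp⟩
      rw [LinearMap.mem_ker, hl]
      simp [dotProduct_sub, hνN, hν]
    cases r with
    | zero => exact h₂ w fun i => i.elim0
    | succ r =>
      refine eq_zero_on_sup_span (vol₂ N (sharp β)) (LinearMap.ker l) N (fun w hw => h₂ w hw)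
        (fun w _ => ?_) w fun i => htop _
      exact (vol (r + 3)).map_eq_zero_of_eq (i := 0) (j := Fin.succ (Fin.succ 0)) _ rfl
        (Fin.succ_ne_zero _).symm
  have hb0 : sharp β = 0 := by
    apply vol_curryLeft_injective
    rw [map_zero]
    ext w
    -- As l(β♯) = 0 and l(N) = q ≠ 0, only q times the contraction of the volume form with β♯ is
    -- left; hence β♯ = 0.
    have h := covector_vol₂ l N (sharp β) w
    rw [hzero, hb, hl, hνN] at h
    simpa [hν] using h
  apply twoForm_ext
  intro i j
  have : ∀ i, β i = 0 := fun i => by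
    have h := congrFun hb0 i
    rw [sharp_apply] at h
    have := lorentz_mul_self i
    simp only [Pi.zero_apply, mul_eq_zero] at h
    rcases h with h | h
    · simp [h] at this
    · exact h
  rw [hτ, this, this]
  simp

/-- The exterior derivative of the dual of a field of two-forms is its divergence. -/
theorem alternatize_dualForm (Φ : (Fin (r + 2) → ℝ) →ₗ[ℝ] (Fin (r + 2) → ℝ) [⋀^Fin 2]→ₗ[ℝ] ℝ) :
    AlternatingMap.alternatizeUncurryFin (dualForm.comp Φ) = -(vol (r + 2)).curryLeft
      (sharp fun j => ∑ i, lorentz i * Φ (stdVec i) ![stdVec i, stdVec j]) := by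
  ext w
  let l : Fin (r + 2) → Fin (r + 2) → (Fin (r + 2) → ℝ) →ₗ[ℝ] ℝ := fun i j =>
    { toFun := fun u => Φ u ![stdVec i, stdVec j]
      map_add' := by simp
      map_smul' := by simp }
  let V : Fin (r + 2) → ℝ := fun i => (vol (r + 2)).curryLeft (stdVec i) w
  have h₀ : ∀ y : Fin (r + 2) → ℝ, (vol (r + 2)).curryLeft y w = ∑ j, y j * V j := by
    intro y
    conv_lhs => rw [← sum_smul_stdVec y, map_sum]
    simp [V, alternatingMap_sum_apply]
  have h₁ : AlternatingMap.alternatizeUncurryFin (dualForm.comp Φ) w =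
      (1 / 2 : ℝ) * ∑ i, ∑ j, (lorentz i * lorentz j) *
        ∑ s : Fin (r + 1), (-1) ^ (s : ℕ) * (l i j (w s) * vol₂ (stdVec i) (stdVec j) (s.removeNth w)) := by
    rw [alternatingMap_alternatizeUncurryFin_apply_real]
    simp only [LinearMap.comp_apply, dualForm_apply, AlternatingMap.smul_apply,
      alternatingMap_sum_apply, smul_eq_mul, Finset.mul_sum]
    rw [Finset.sum_comm]
    refine Finset.sum_congr rfl fun i _ => ?_
    rw [Finset.sum_comm]
    refine Finset.sum_congr rfl fun j _ => Finset.sum_congr rfl fun s _ => ?_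
    change _ = 1 / 2 * (lorentz i * lorentz j * ((-1) ^ (s : ℕ) * (Φ (w s) ![stdVec i, stdVec j] * _)))
    ring
  rw [h₁]
  simp only [covector_vol₂]
  rw [AlternatingMap.neg_apply, h₀]
  have hl : ∀ i j u, l i j u = -l j i u := fun i j u => twoForm_swap _ _ _
  -- Antisymmetry in i and j makes the two halves equal; the factor -2 leaves the overall minus sign
  -- after the 1/2 is absorbed.
  have h₂ : ∑ i, ∑ j, lorentz i * lorentz j * (l i j (stdVec j) * V i - l i j (stdVec i) * V j) =
      -2 * ∑ j, ∑ i, lorentz i * lorentz j * (l i j (stdVec i) * V j) := by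
    simp only [mul_sub, Finset.sum_sub_distrib]
    rw [Finset.sum_comm (f := fun i j => lorentz i * lorentz j * (l i j (stdVec i) * V j))]
    have : ∀ i j, lorentz i * lorentz j * (l i j (stdVec j) * V i) =
      -(lorentz j * lorentz i * (l j i (stdVec j) * V i)) := fun i j => by rw [hl i j]; ring
    simp only [this, Finset.sum_neg_distrib]
    ring
  change 1 / 2 * ∑ i, ∑ j, lorentz i * lorentz j * (l i j (stdVec j) * V i - l i j (stdVec i) * V j) = _
  rw [h₂]
  simp only [sharp_apply, Finset.mul_sum, Finset.sum_mul, ← Finset.sum_neg_distrib]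
  refine Finset.sum_congr rfl fun j _ => Finset.sum_congr rfl fun i _ => ?_
  change 1 / 2 * (-2 * (_ * (Φ (stdVec i) ![stdVec i, stdVec j] * V j))) = _
  ring

/-- Pulling back alternating forms, as a linear map. -/
def pullback {E F : Type*} [AddCommGroup E] [Module ℝ E] [AddCommGroup F] [Module ℝ F] {d : ℕ}
    (g : E →ₗ[ℝ] F) : (F [⋀^Fin d]→ₗ[ℝ] ℝ) →ₗ[ℝ] (E [⋀^Fin d]→ₗ[ℝ] ℝ) where
  toFun f := f.compLinearMap g
  map_add' _ _ := rfl
  map_smul' _ _ := rfl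

theorem pullback_apply {E F : Type*} [AddCommGroup E] [Module ℝ E] [AddCommGroup F] [Module ℝ F]
    {d : ℕ} (g : E →ₗ[ℝ] F) (f : F [⋀^Fin d]→ₗ[ℝ] ℝ) (w : Fin d → E) :
    pullback g f w = f fun i => g (w i) := rfl

/-- On a hyperplane that is not null, the restrictions of a two-form and of its dual can be
prescribed. -/
theorem exists_twoForm (ν : Fin (r + 2) → ℝ) (hν : lorentzSq ν ≠ 0)
    {E : Type*} [AddCommGroup E] [Module ℝ E] (x : E →ₗ[ℝ] Fin (r + 2) → ℝ)
    (hx : Function.Injective x) (hxν : ∀ e, ν ⬝ᵥ x e = 0)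
    (b : E [⋀^Fin 2]→ₗ[ℝ] ℝ) (c : E [⋀^Fin r]→ₗ[ℝ] ℝ) :
    ∃ τ : (Fin (r + 2) → ℝ) [⋀^Fin 2]→ₗ[ℝ] ℝ, pullback x τ = b ∧ pullback x (dualForm τ) = c := by
  let l : (Fin (r + 2) → ℝ) →ₗ[ℝ] ℝ := dotProductBilin ℝ ℝ ν
  have hl : ∀ u, l u = ν ⬝ᵥ u := fun u => rfl
  let W := LinearMap.ker l
  have hl0 : l ≠ 0 := by
    intro h
    apply hν
    rw [← dotProduct_sharp, ← hl, h, LinearMap.zero_apply]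
  have hW : Module.finrank ℝ W = r + 1 := by
    have h := Module.Dual.finrank_ker_add_one_of_ne_zero (f := l) hl0
    simpa using h
  let R : ((Fin (r + 2) → ℝ) [⋀^Fin 2]→ₗ[ℝ] ℝ) →ₗ[ℝ] (W [⋀^Fin 2]→ₗ[ℝ] ℝ) × (W [⋀^Fin r]→ₗ[ℝ] ℝ) :=
    (pullback W.subtype).prod ((pullback W.subtype).comp dualForm)
  have hR : Function.Injective R := by
    rw [← LinearMap.ker_eq_bot, LinearMap.ker_eq_bot']
    intro τ hτ
    have h₁ : pullback W.subtype τ = 0 := congrArg Prod.fst hτ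
    have h₂ : pullback W.subtype (dualForm τ) = 0 := congrArg Prod.snd hτ
    refine twoForm_eq_zero ν hν τ (fun u v hu hv => ?_) fun w hw => ?_
    · have := congrArg (fun f => f ![(⟨u, hu⟩ : W), ⟨v, hv⟩]) h₁
      simp only [pullback_apply, AlternatingMap.zero_apply] at this
      rw [← this]
      congr 1
      funext i
      fin_cases i <;> rfl
    · exact congrArg (fun f => f fun i => (⟨w i, hw i⟩ : W)) h₂
  -- Source and target have equal dimension: C(r+2,2) = C(r+1,2) + (r+1), and C(r+1,r) = r+1.
  have hRs : Function.Surjective R := by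
    apply (LinearMap.injective_iff_surjective_of_finrank_eq_finrank _).1 hR
    rw [Module.finrank_prod, finrank_alternatingMap, finrank_alternatingMap,
      finrank_alternatingMap, hW]
    simp only [Module.finrank_fintype_fun_eq_card, Fintype.card_fin]
    rw [Nat.choose_succ_succ (r + 1) 1]
    simp [Nat.add_comm]
  let x' : E →ₗ[ℝ] W := x.codRestrict W fun e => hxν e
  have hx' : LinearMap.ker x' = ⊥ := by
    rw [LinearMap.ker_eq_bot]
    intro e e' h
    exact hx (congrArg Subtype.val h)
  -- E may be smaller than the hyperplane; the left inverse extends the prescribed data from E to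
  -- it.
  obtain ⟨g, hg⟩ := x'.exists_leftInverse_of_injective hx'
  obtain ⟨τ, hτ⟩ := hRs (pullback g b, pullback g c)
  have h₁ : pullback W.subtype τ = pullback g b := congrArg Prod.fst hτ
  have h₂ : pullback W.subtype (dualForm τ) = pullback g c := congrArg Prod.snd hτ
  have hgx : ∀ e, g (x' e) = e := fun e => LinearMap.congr_fun hg e
  refine ⟨τ, ?_, ?_⟩
  · ext w
    have := congrArg (fun f => f fun i => x' (w i)) h₁
    simp only [pullback_apply, hgx] at this
    exact this
  · ext w
    have := congrArg (fun f => f fun i => x' (w i)) h₂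
    simp only [pullback_apply, hgx] at this
    exact this

/-- The product of two covectors. -/
def covector₂ (a b : (Fin n → ℝ) →ₗ[ℝ] ℝ) : (Fin n → ℝ) [⋀^Fin 2]→ₗ[ℝ] ℝ :=
  AlternatingMap.alternatizeUncurryFin
    (a.smulRight (AlternatingMap.ofSubsingleton ℝ (Fin n → ℝ) ℝ (0 : Fin 1) b))

theorem covector₂_apply (a b : (Fin n → ℝ) →ₗ[ℝ] ℝ) (w : Fin 2 → Fin n → ℝ) :
    covector₂ a b w = a (w 0) * b (w 1) - a (w 1) * b (w 0) := by
  rw [covector₂, alternatingMap_alternatizeUncurryFin_apply_real, Fin.sum_univ_two]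
  simp [Fin.removeNth, sub_eq_add_neg, Fin.tail]

/-- The exterior derivative and the divergence of a field of two-forms can be prescribed. -/
theorem exists_field (T : (Fin (r + 2) → ℝ) [⋀^Fin 3]→ₗ[ℝ] ℝ)
    (S : (Fin (r + 2) → ℝ) [⋀^Fin (r + 1)]→ₗ[ℝ] ℝ) :
    ∃ Φ : (Fin (r + 2) → ℝ) →ₗ[ℝ] (Fin (r + 2) → ℝ) [⋀^Fin 2]→ₗ[ℝ] ℝ,
      AlternatingMap.alternatizeUncurryFin Φ = T ∧
      AlternatingMap.alternatizeUncurryFin (dualForm.comp Φ) = S := by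
  obtain ⟨y, hy⟩ := vol_curryLeft_surjective S
  -- The field u ↦ u♭ ∧ s has divergence (n - 1) s = (r + 1) s, whence the constant; the sign
  -- matches the one in `alternatize_dualForm`.
  let s : (Fin (r + 2) → ℝ) →ₗ[ℝ] ℝ := dotProductBilin ℝ ℝ (-((1 / (r + 1) : ℝ) • sharp y))
  let Φ₂ : (Fin (r + 2) → ℝ) →ₗ[ℝ] (Fin (r + 2) → ℝ) [⋀^Fin 2]→ₗ[ℝ] ℝ :=
    { toFun := fun u => covector₂ (dotProductBilin ℝ ℝ (sharp u)) s
      map_add' := fun u v => by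
        ext w
        simp [covector₂_apply]
        ring
      map_smul' := fun c u => by
        ext w
        simp [covector₂_apply]
        ring }
  have hΦ₂ : ∀ u w, Φ₂ u w = (sharp u ⬝ᵥ w 0) * s (w 1) - (sharp u ⬝ᵥ w 1) * s (w 0) :=
    fun u w => covector₂_apply _ _ w
  have hsymm : ∀ u v : Fin (r + 2) → ℝ, sharp u ⬝ᵥ v = sharp v ⬝ᵥ u := fun u v => by
    simp only [dotProduct, sharp_apply]
    exact Finset.sum_congr rfl fun i _ => by ring
  -- The two summands separate the requirements: contractions of T alternate to 3T and have no
  -- divergence, as e_i is repeated, while Φ₂ has no exterior derivative because the metric is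
  -- symmetric.
  refine ⟨(1 / 3 : ℝ) • T.curryLeft + Φ₂, ?_, ?_⟩
  · rw [AlternatingMap.alternatizeUncurryFin_add, AlternatingMap.alternatizeUncurryFin_smul,
      AlternatingMap.alternatizeUncurryFin_curryLeft]
    have : AlternatingMap.alternatizeUncurryFin Φ₂ = 0 := by
      ext w
      rw [alternatingMap_alternatizeUncurryFin_apply_real, Fin.sum_univ_three, hΦ₂, hΦ₂, hΦ₂,
        AlternatingMap.zero_apply]
      have e₀ : (0 : Fin 3).removeNth w = ![w 1, w 2] := by funext i; fin_cases i <;> rfl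
      have e₁ : (1 : Fin 3).removeNth w = ![w 0, w 2] := by funext i; fin_cases i <;> rfl
      have e₂ : (2 : Fin 3).removeNth w = ![w 0, w 1] := by funext i; fin_cases i <;> rfl
      rw [e₀, e₁, e₂]
      simp only [Matrix.cons_val_zero, Matrix.cons_val_one]
      rw [hsymm (w 1) (w 0), hsymm (w 2) (w 0), hsymm (w 2) (w 1)]
      norm_num
    rw [this, add_zero]
    ext w
    simp
  · rw [alternatize_dualForm, ← map_neg, ← hy]
    congr 1
    rw [neg_eq_iff_eq_neg]
    funext j
    rw [sharp_apply]
    have h₁ : ∀ i, T.curryLeft (stdVec i) ![stdVec i, stdVec j] = 0 := fun i =>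
      T.map_eq_zero_of_eq (i := 0) (j := 1) _ rfl (by simp)
    have h₂ : ∀ (u : Fin (r + 2) → ℝ) (i : Fin (r + 2)), sharp u ⬝ᵥ stdVec i = lorentz i * u i := by
      intro u i
      simp [stdVec, sharp_apply]
    have hs : ∀ i, s (stdVec i) = -((1 / (r + 1) : ℝ) * (lorentz i * y i)) := by
      intro i
      change (-((1 / (r + 1) : ℝ) • sharp y)) ⬝ᵥ stdVec i = _
      simp [stdVec, sharp_apply]
    have h₃ : ∀ i, lorentz i * ((1 / 3 : ℝ) • T.curryLeft + Φ₂) (stdVec i) ![stdVec i, stdVec j] =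
        s (stdVec j) - (if i = j then s (stdVec j) else 0) := by
      intro i
      rw [LinearMap.add_apply, LinearMap.smul_apply, AlternatingMap.add_apply,
        AlternatingMap.smul_apply, h₁, hΦ₂]
      simp only [Matrix.cons_val_zero, Matrix.cons_val_one]
      rw [h₂, h₂]
      by_cases hij : i = j
      · subst hij
        simp
      · simp [stdVec, hij, Ne.symm hij, ← mul_assoc, lorentz_mul_self]
    rw [Finset.sum_congr rfl fun i _ => h₃ i]
    simp only [Finset.sum_sub_distrib, Finset.sum_const, Finset.card_univ, Fintype.card_fin,
      Finset.sum_ite_eq', Finset.mem_univ, if_true, nsmul_eq_mul, hs, Pi.neg_apply]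
    have hr : (r + 1 : ℝ) ≠ 0 := by positivity
    have := lorentz_mul_self j
    push_cast
    field_simp
    linear_combination (-(r + 1) * y j) * this

/-! ### Coordinates of two-forms -/

/-- The antisymmetric components of a two-form given by the components above the diagonal. -/
def comp₂ (φ : {q : Fin n × Fin n // q.1 < q.2} → ℝ) (i j : Fin n) : ℝ :=
  if h : i < j then φ ⟨(i, j), h⟩ else if h : j < i then -φ ⟨(j, i), h⟩ else 0

/-- The two-form with given components. -/
def twoForm : ({q : Fin n × Fin n // q.1 < q.2} → ℝ) →ₗ[ℝ] (Fin n → ℝ) [⋀^Fin 2]→ₗ[ℝ] ℝ where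
  toFun φ := ∑ q, φ q • covector₂ (LinearMap.proj q.1.1) (LinearMap.proj q.1.2)
  map_add' _ _ := by simp [add_smul, Finset.sum_add_distrib]
  map_smul' _ _ := by simp [Finset.smul_sum, smul_smul]

theorem twoForm_apply (φ : {q : Fin n × Fin n // q.1 < q.2} → ℝ) (w : Fin 2 → Fin n → ℝ) :
    twoForm φ w = ∑ q, φ q * (w 0 q.1.1 * w 1 q.1.2 - w 1 q.1.1 * w 0 q.1.2) := by
  change (∑ q, φ q • covector₂ (LinearMap.proj q.1.1) (LinearMap.proj q.1.2)) w = _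
  rw [alternatingMap_sum_apply]
  simp [covector₂_apply]

theorem twoForm_stdVec_of_lt (φ : {q : Fin n × Fin n // q.1 < q.2} → ℝ)
    (q : {q : Fin n × Fin n // q.1 < q.2}) :
    twoForm φ ![stdVec q.1.1, stdVec q.1.2] = φ q := by
  rw [twoForm_apply, Finset.sum_eq_single q]
  · have := q.2.ne
    simp [stdVec, this]
  · rintro ⟨⟨i, j⟩, hij⟩ _ h
    obtain ⟨⟨i', j'⟩, hij'⟩ := q
    simp only at hij hij'
    have h₁ : i = i' → j ≠ j' := by rintro rfl rfl; exact h rfl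
    have h₂ : i = j' → j ≠ i' := by rintro rfl rfl; exact lt_asymm hij hij'
    simp only [Matrix.cons_val_zero, Matrix.cons_val_one, stdVec, Pi.single_apply]
    by_cases e₁ : i = i' <;> by_cases e₂ : i = j' <;> simp_all
  · simp

theorem twoForm_stdVec (φ : {q : Fin n × Fin n // q.1 < q.2} → ℝ) (i j : Fin n) :
    twoForm φ ![stdVec i, stdVec j] = comp₂ φ i j := by
  unfold comp₂
  split
  · next h => exact twoForm_stdVec_of_lt φ ⟨(i, j), h⟩
  split
  · next h =>
    rw [twoForm_swap]
    exact congrArg Neg.neg (twoForm_stdVec_of_lt φ ⟨(j, i), h⟩)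
  · obtain rfl : i = j := by order
    exact twoForm_self _ _

/-- Two-forms are given by their components above the diagonal. -/
def twoFormEquiv (n : ℕ) :
    ({q : Fin n × Fin n // q.1 < q.2} → ℝ) ≃ₗ[ℝ] (Fin n → ℝ) [⋀^Fin 2]→ₗ[ℝ] ℝ :=
  { twoForm with
    invFun := fun τ q => τ ![stdVec q.1.1, stdVec q.1.2]
    left_inv := fun φ => funext (twoForm_stdVec_of_lt φ)
    right_inv := fun τ => by
      refine twoForm_ext fun i j => ?_
      refine (twoForm_stdVec _ i j).trans ?_
      unfold comp₂
      split
      · rfl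
      split
      · rw [twoForm_swap τ]
      · obtain rfl : i = j := by order
        exact (twoForm_self _ _).symm }

/-- An alternating form as a combination of products of coordinate covectors. -/
theorem alternatingMap_eq_sum_det (f : (Fin n → ℝ) [⋀^Fin r]→ₗ[ℝ] ℝ) (w : Fin r → Fin n → ℝ) :
    ∑ κ : Fin r → Fin n, f (fun i => stdVec (κ i)) *
      Matrix.det (Matrix.of fun i j : Fin r => w j (κ i)) = r.factorial * f w := by
  have h₁ : ∀ v : Fin r → Fin n → ℝ,
      f v = ∑ κ : Fin r → Fin n, (∏ i, v i (κ i)) * f (fun i => stdVec (κ i)) := by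
    intro v
    have h := f.toMultilinearMap.map_sum (fun i j => v i j • stdVec j)
    simp only [sum_smul_stdVec] at h
    refine h.trans (Finset.sum_congr rfl fun κ _ => ?_)
    exact f.toMultilinearMap.map_smul_univ (fun i => v i (κ i)) fun i => stdVec (κ i)
  simp only [Matrix.det_apply', Finset.mul_sum]
  rw [Finset.sum_comm]
  -- Each term of the determinant is the multilinear expansion of f at permuted arguments; its sign
  -- undoes the permutation, so r! equal terms arise.
  have h₂ : ∀ σ : Equiv.Perm (Fin r), ∑ κ : Fin r → Fin n, f (fun i => stdVec (κ i)) *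
      (((Equiv.Perm.sign σ : ℤ) : ℝ) * ∏ i, Matrix.of (fun i j : Fin r => w j (κ i)) (σ i) i) = f w := by
    intro σ
    have h := h₁ (w ∘ σ.symm)
    rw [f.map_perm, Equiv.Perm.sign_symm] at h
    have h' : f w = ((Equiv.Perm.sign σ : ℤ) : ℝ) * (Equiv.Perm.sign σ • f w) := by
      rcases Int.units_eq_one_or (Equiv.Perm.sign σ) with h | h <;> simp [h]
    rw [h', h, Finset.mul_sum]
    refine Finset.sum_congr rfl fun κ _ => ?_
    have : ∏ i, Matrix.of (fun i j : Fin r => w j (κ i)) (σ i) i =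
        ∏ i, (w ∘ σ.symm) i (κ i) := by
      rw [← Equiv.prod_comp σ fun i => (w ∘ σ.symm) i (κ i)]
      simp
    rw [this]
    ring
  simp only [h₂, Finset.sum_const, Finset.card_univ, Fintype.card_perm, Fintype.card_fin,
    nsmul_eq_mul]

end Volume

/-! ### Exterior derivatives of sums and of forms with linear coefficients -/

section General

variable {M : Type} [NormedAddCommGroup M] [NormedSpace ℝ M] {k : ℕ}

theorem extDeriv_fun_sum {ι : Type*} (s : Finset ι) {φ : ι → Form M k} {p : M}
    (h : ∀ i, ContDiff ℝ ∞ (φ i)) :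
    extDeriv (fun p => ∑ i ∈ s, φ i p) p = ∑ i ∈ s, extDeriv (φ i) p := by
  rw [extDeriv, fderiv_fun_sum fun i _ => (h i).differentiable (by simp) p,
    ← ContinuousAlternatingMap.alternatizeUncurryFinCLM_apply, map_sum]
  rfl

theorem extDeriv_fun_const_smul (c : ℝ) (φ : Form M k) (p : M) :
    extDeriv (fun p => c • φ p) p = c • extDeriv φ p :=
  extDeriv_fun_smul c φ

theorem extDeriv_fun_sub {φ χ : Form M k} {p : M} (h : ContDiff ℝ ∞ φ) (h' : ContDiff ℝ ∞ χ) :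
    extDeriv (fun p => φ p - χ p) p = extDeriv φ p - extDeriv χ p := by
  rw [extDeriv, fderiv_fun_sub (h.differentiable (by simp) p) (h'.differentiable (by simp) p),
    ← ContinuousAlternatingMap.alternatizeUncurryFinCLM_apply, map_sub]
  rfl

theorem extDeriv_fun_neg (φ : Form M k) (p : M) :
    extDeriv (fun p => -φ p) p = -extDeriv φ p := by
  rw [extDeriv, fderiv_fun_neg, ← ContinuousAlternatingMap.alternatizeUncurryFinCLM_apply, map_neg]
  rfl

theorem contDiff_of_isLinearMap [FiniteDimensional ℝ M] {φ : Form M k} (h : IsLinearMap ℝ φ) :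
    ContDiff ℝ ∞ φ :=
  (LinearMap.toContinuousLinearMap (IsLinearMap.mk' φ h)).contDiff

theorem extDeriv_apply_of_isLinearMap [FiniteDimensional ℝ M] {φ : Form M k}
    (h : IsLinearMap ℝ φ) (p : M) (w : Fin (k + 1) → M) :
    extDeriv φ p w = ∑ i : Fin (k + 1), (-1) ^ (i : ℕ) * φ (w i) (i.removeNth w) := by
  have : HasFDerivAt φ (LinearMap.toContinuousLinearMap (IsLinearMap.mk' φ h)) p :=
    (LinearMap.toContinuousLinearMap (IsLinearMap.mk' φ h)).hasFDerivAt
  rw [extDeriv, this.fderiv, alternatizeUncurryFin_apply_real]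
  rfl

theorem contDiff_sub_add {φ χ ζ : Form M k} (hφ : ContDiff ℝ ∞ φ) (hχ : ContDiff ℝ ∞ χ)
    (hζ : ContDiff ℝ ∞ ζ) : ContDiff ℝ ∞ fun p => φ p - χ p + ζ p :=
  (hφ.sub hχ).add hζ

theorem contDiff_neg_sub {φ χ : Form M k} (hφ : ContDiff ℝ ∞ φ) (hχ : ContDiff ℝ ∞ χ) :
    ContDiff ℝ ∞ fun p => -φ p - χ p :=
  hφ.neg.sub hχ

theorem contDiff_smul_sum_sum {ι : Type*} [Fintype ι] (t : ℝ) (g : ι → ι → ℝ)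
    {φ : ι → ι → Form M k} (h : ∀ b c, ContDiff ℝ ∞ (φ b c)) :
    ContDiff ℝ ∞ fun p => t • ∑ b, ∑ c, g b c • φ b c p :=
  ContDiff.const_smul t (ContDiff.sum fun b _ => ContDiff.sum fun c _ =>
    ContDiff.const_smul (g b c) (h b c))

theorem extDeriv_smul_sum_sum {ι : Type*} [Fintype ι] (t : ℝ) (g : ι → ι → ℝ)
    {φ : ι → ι → Form M k} (h : ∀ b c, ContDiff ℝ ∞ (φ b c)) (p : M) :
    extDeriv (fun p => t • ∑ b, ∑ c, g b c • φ b c p) p =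
      t • ∑ b, ∑ c, g b c • extDeriv (φ b c) p := by
  have hc : ∀ b c, ContDiff ℝ ∞ fun p => g b c • φ b c p := fun b c =>
    ContDiff.const_smul (g b c) (h b c)
  rw [extDeriv_fun_const_smul, extDeriv_fun_sum _ fun b => ContDiff.sum fun c _ => hc b c]
  congr 1
  refine Finset.sum_congr rfl fun b _ => ?_
  rw [extDeriv_fun_sum _ (hc b)]
  exact Finset.sum_congr rfl fun c _ => extDeriv_fun_const_smul _ _ _

theorem extDeriv_sub_add {φ χ ζ : Form M k} (hφ : ContDiff ℝ ∞ φ) (hχ : ContDiff ℝ ∞ χ)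
    (hζ : ContDiff ℝ ∞ ζ) (p : M) :
    extDeriv (fun p => φ p - χ p + ζ p) p = extDeriv φ p - extDeriv χ p + extDeriv ζ p := by
  rw [← extDeriv_fun_sub hφ hχ]
  exact extDeriv_fun_add ((hφ.sub hχ).differentiable (by simp) p) (hζ.differentiable (by simp) p)

/-- The constant `0`-form `1`. -/
def unitForm (M : Type) [NormedAddCommGroup M] [NormedSpace ℝ M] : M [⋀^Fin 0]→L[ℝ] ℝ :=
  ContinuousAlternatingMap.constOfIsEmpty ℝ M (Fin 0) (1 : ℝ)

theorem oneForm_eq (α : M → M →L[ℝ] ℝ) (p : M) : oneForm α p = wedgeL (α p) (unitForm M) := by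
  ext w
  rw [wedgeL_apply]
  simp [oneForm, unitForm]

end General

section Gauge

variable {n m r : ℕ}

/-! ### Coordinate expressions of the basic forms -/

/-- The covector `dxⁱ`. -/
def dxCov (i : Fin n) : FieldSpace n m →L[ℝ] ℝ := dx i 0

/-- The covector `dAᵃ_i`. -/
def potCov (a : Fin m) (i : Fin n) : FieldSpace n m →L[ℝ] ℝ :=
  (ContinuousLinearMap.proj (R := ℝ) (φ := fun _ : Fin n => ℝ) i).comp
    ((ContinuousLinearMap.proj (R := ℝ) (φ := fun _ : Fin m => Fin n → ℝ) a).comp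
      ((ContinuousLinearMap.fst ℝ _ _).comp (ContinuousLinearMap.snd ℝ _ _)))

theorem potCov_apply (a : Fin m) (i : Fin n) (v : FieldSpace n m) : potCov a i v = v.2.1 a i := rfl

theorem dx_eq (i : Fin n) (p : FieldSpace n m) : dx i p = dxCov i := rfl

theorem dxCov_apply (i : Fin n) (v : FieldSpace n m) : dxCov i v = v.1 i := rfl

theorem formA_apply (a : Fin m) (p v : FieldSpace n m) : formA a p v = p.2.1 a ⬝ᵥ v.1 := by
  simp [formA, dx_eq, dxCov_apply, dotProduct]

theorem dxs_apply (κ : Fin r → Fin n) (p : FieldSpace n m) (w : Fin r → FieldSpace n m) :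
    dxs κ p w = Matrix.det (Matrix.of fun i j : Fin r => (w j).1 (κ i)) := by
  induction r with
  | zero => simp [dxs]
  | succ r ih =>
    rw [dxs, wedge_eq, wedgeL_apply, Matrix.det_succ_row_zero]
    refine Finset.sum_congr rfl fun i _ => ?_
    rw [ih, dx_eq, dxCov_apply, mul_assoc]
    rfl

theorem fieldStrength_eq (a : Fin m) (i j : Fin n) (p : FieldSpace n m) :
    fieldStrength a i j p = twoForm (p.2.2 a) ![stdVec i, stdVec j] := by
  rw [twoForm_stdVec]
  rfl

/-- The ordered pairs (i, j) and (j, i) contribute equally, which the factor 1/2 compensates. -/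
theorem formF_apply (a : Fin m) (p : FieldSpace n m) (w : Fin 2 → FieldSpace n m) :
    formF a p w = twoForm (p.2.2 a) fun i => (w i).1 := by
  have h : twoForm (p.2.2 a) (fun i => (w i).1) = ∑ i, ∑ j, (w 0).1 i * (w 1).1 j *
      fieldStrength a i j p := by
    have : (fun i => (w i).1) = ![(w 0).1, (w 1).1] := by
      funext i; fin_cases i <;> rfl
    rw [this, ← twoForm₂_apply, linear_eq_sum]
    rw [Finset.sum_comm]
    refine Finset.sum_congr rfl fun j _ => ?_
    rw [twoForm₂_apply, twoForm_swap, ← twoForm₂_apply, linear_eq_sum, ← neg_mul_eq_mul_neg,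
      Finset.mul_sum, ← Finset.sum_neg_distrib]
    refine Finset.sum_congr rfl fun i _ => ?_
    rw [fieldStrength_eq, twoForm_swap _ (stdVec i), twoForm₂_apply]
    ring
  have h' : ∑ i, ∑ j, (w 0).1 i * (w 1).1 j * fieldStrength a i j p =
      -∑ i, ∑ j, (w 1).1 i * (w 0).1 j * fieldStrength a i j p := by
    rw [Finset.sum_comm, ← Finset.sum_neg_distrib]
    refine Finset.sum_congr rfl fun j _ => ?_
    rw [← Finset.sum_neg_distrib]
    refine Finset.sum_congr rfl fun i _ => ?_
    rw [fieldStrength_eq, fieldStrength_eq, twoForm_swap _ (stdVec i)]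
    ring
  have h'' : formF a p w = (1 / 2 : ℝ) * ∑ i, ∑ j, fieldStrength a i j p *
      ((w 0).1 i * (w 1).1 j - (w 1).1 i * (w 0).1 j) := by
    simp only [formF, ContinuousAlternatingMap.smul_apply, ContinuousAlternatingMap.sum_apply,
      smul_eq_mul]
    congr 1
    refine Finset.sum_congr rfl fun i _ => Finset.sum_congr rfl fun j _ => ?_
    rw [wedge_eq, wedgeL_apply, Fin.sum_univ_two]
    simp [oneForm, dx_eq, dxCov_apply, Fin.removeNth, Fin.tail]
    ring_nf
    simp
  rw [h'', h]
  have : ∑ i, ∑ j, fieldStrength a i j p * ((w 0).1 i * (w 1).1 j - (w 1).1 i * (w 0).1 j) =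
      ∑ i, ∑ j, (w 0).1 i * (w 1).1 j * fieldStrength a i j p -
        ∑ i, ∑ j, (w 1).1 i * (w 0).1 j * fieldStrength a i j p := by
    rw [← Finset.sum_sub_distrib]
    refine Finset.sum_congr rfl fun i _ => ?_
    rw [← Finset.sum_sub_distrib]
    exact Finset.sum_congr rfl fun j _ => by ring
  rw [this]
  linarith

/-- The Levi-Civita coefficients are the components of `vol₂`; summing over all multi-indices counts
each component r! times, which cancels the factorial in the definition. -/
theorem starF_apply (a : Fin m) (p : FieldSpace (r + 2) m) (w : Fin r → FieldSpace (r + 2) m) :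
    starF a p w = dualForm (twoForm (p.2.2 a)) fun i => (w i).1 := by
  simp only [starF, ContinuousAlternatingMap.smul_apply, ContinuousAlternatingMap.sum_apply,
    smul_eq_mul, dualForm_apply, AlternatingMap.smul_apply, alternatingMap_sum_apply, dxs_apply]
  have h : ∀ i j : Fin (r + 2), ∑ κ : Fin r → Fin (r + 2), fieldStrength a i j p *
      (lorentz i * lorentz j * leviCivita (Matrix.vecCons i (Matrix.vecCons j κ))) *
        Matrix.det (Matrix.of fun i j : Fin r => (w j).1 (κ i)) =
      r.factorial * (fieldStrength a i j p * (lorentz i * lorentz j) *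
        vol₂ (stdVec i) (stdVec j) fun i => (w i).1) := by
    intro i j
    have := alternatingMap_eq_sum_det (vol₂ (stdVec i) (stdVec j)) fun i => (w i).1
    rw [mul_left_comm, ← this, Finset.mul_sum]
    refine Finset.sum_congr rfl fun κ _ => ?_
    have e : vol₂ (stdVec i) (stdVec j) (fun i => stdVec (κ i)) =
        leviCivita (Matrix.vecCons i (Matrix.vecCons j κ)) := by
      rw [← vol_stdVec_comp, vol₂_apply]
      congr 1
      funext s
      refine Fin.cases rfl (fun s => Fin.cases rfl (fun s => rfl) s) s
    rw [e]
    ring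
  simp only [h]
  simp only [← Finset.mul_sum, fieldStrength_eq]
  have : (r.factorial : ℝ) ≠ 0 := by positivity
  field_simp

theorem isLinearMap_starF (a : Fin m) : IsLinearMap ℝ (starF (r := r) a) where
  map_add p q := by ext w; simp [starF_apply]
  map_smul c p := by ext w; simp [starF_apply]

theorem isLinearMap_formF (a : Fin m) : IsLinearMap ℝ (formF (n := n) a) where
  map_add p q := by ext w; simp [formF_apply]
  map_smul c p := by ext w; simp [formF_apply]

theorem hasFDerivAt_formA (a : Fin m) (p : FieldSpace n m) :
    HasFDerivAt (formA a) (∑ i, (potCov a i).smulRight (dxCov i)) p := by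
  have : formA a = ⇑(∑ i, (potCov (n := n) a i).smulRight (dxCov (m := m) i)) := by
    funext q
    refine ContinuousLinearMap.ext fun v => ?_
    simp [formA, dx_eq, potCov_apply]
  rw [this]
  exact ContinuousLinearMap.hasFDerivAt _

theorem contDiff_formA (a : Fin m) : ContDiff ℝ ∞ (formA (n := n) a) := by
  have : formA a = ⇑(∑ i, (potCov (n := n) a i).smulRight (dxCov (m := m) i)) := by
    funext q
    refine ContinuousLinearMap.ext fun v => ?_
    simp [formA, dx_eq, potCov_apply]
  rw [this]
  exact ContinuousLinearMap.contDiff _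

/-- The exterior product with `dAᵃ`. -/
def dPot {k : ℕ} (a : Fin m) : (FieldSpace n m [⋀^Fin k]→L[ℝ] ℝ) →L[ℝ]
    (FieldSpace n m [⋀^Fin (k + 1 + 1)]→L[ℝ] ℝ) :=
  ∑ i, (wedgeL (potCov a i)).comp (wedgeL (dxCov i))

theorem dPot_apply {k : ℕ} (a : Fin m) (f : FieldSpace n m [⋀^Fin k]→L[ℝ] ℝ) :
    dPot a f = ∑ i, wedgeL (potCov a i) (wedgeL (dxCov i) f) := by
  simp [dPot]

theorem dPot_wedgeL {k : ℕ} (a : Fin m) (c : FieldSpace n m →L[ℝ] ℝ)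
    (f : FieldSpace n m [⋀^Fin k]→L[ℝ] ℝ) : dPot a (wedgeL c f) = wedgeL c (dPot a f) := by
  rw [dPot_apply, dPot_apply, map_sum]
  exact Finset.sum_congr rfl fun i _ => wedgeL_comm_even _ _ _ _

theorem extDeriv_formA_wedge {k : ℕ} (a : Fin m) {φ : Form (FieldSpace n m) k}
    (hφ : ContDiff ℝ ∞ φ) (p : FieldSpace n m) :
    extDeriv (wedge (formA a) φ) p = dPot a (φ p) - wedgeL (formA a p) (extDeriv φ p) := by
  rw [extDeriv_wedge (hasFDerivAt_formA a p).differentiableAt (hφ.differentiable (by simp) p),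
    (hasFDerivAt_formA a p).fderiv, dPot_apply,
    alternatize_wedgeL_sum (fun i => potCov a i) fun i => dxCov i]
  intro v
  simp

theorem oneForm_formA (a : Fin m) :
    oneForm (formA (n := n) a) = wedge (formA a) fun _ => unitForm _ :=
  funext fun p => oneForm_eq _ p

theorem contDiff_oneForm_formA (a : Fin m) : ContDiff ℝ ∞ (oneForm (formA (n := n) a)) := by
  rw [oneForm_formA]
  exact contDiff_wedge (contDiff_formA a) contDiff_const

theorem extDeriv_oneForm_formA (a : Fin m) (p : FieldSpace n m) :
    extDeriv (oneForm (formA a)) p = dPot a (unitForm _) := by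
  rw [oneForm_formA, extDeriv_formA_wedge a contDiff_const]
  have : extDeriv (fun _ : FieldSpace n m => unitForm (FieldSpace n m)) p = 0 := by
    rw [extDeriv, fderiv_fun_const, ← ContinuousAlternatingMap.alternatizeUncurryFinCLM_apply]
    exact map_zero _
  rw [this, map_zero, sub_zero]

theorem dPot_unitForm_apply (a : Fin m) (w : Fin 2 → FieldSpace n m) :
    dPot a (unitForm _) w = (w 0).2.1 a ⬝ᵥ (w 1).1 - (w 1).2.1 a ⬝ᵥ (w 0).1 := by
  rw [dPot_apply, ContinuousAlternatingMap.sum_apply]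
  simp only [dotProduct, ← Finset.sum_sub_distrib]
  refine Finset.sum_congr rfl fun i _ => ?_
  rw [wedgeL_apply, Fin.sum_univ_two, wedgeL_apply, wedgeL_apply]
  simp [unitForm, potCov_apply, dxCov_apply, Fin.removeNth, sub_eq_add_neg]

variable (γ : Fin m → Fin m → Fin m → ℝ)

theorem contDiff_theta (a : Fin m) : ContDiff ℝ ∞ (theta (n := n) γ a) :=
  contDiff_sub_add (contDiff_extDeriv (contDiff_oneForm_formA a))
    (contDiff_of_isLinearMap (isLinearMap_formF a)) (contDiff_smul_sum_sum _ _ fun b c =>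
      contDiff_wedge (contDiff_formA b) (contDiff_oneForm_formA c))

theorem contDiff_starF (a : Fin m) : ContDiff ℝ ∞ (starF (r := r) a) :=
  contDiff_of_isLinearMap (isLinearMap_starF a)

theorem contDiff_psi (a : Fin m) : ContDiff ℝ ∞ (psi (r := r) γ a) :=
  contDiff_neg_sub (contDiff_extDeriv (contDiff_starF a)) (contDiff_smul_sum_sum _ _ fun b c =>
    contDiff_wedge (contDiff_formA b) (contDiff_starF c))

theorem GaugeGenerator.contDiff {k : ℕ} {φ : Form (FieldSpace (r + 2) m) k}
    (h : GaugeGenerator r γ k φ) : ContDiff ℝ ∞ φ := by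
  cases h with
  | theta a => exact contDiff_theta γ a
  | dtheta a => exact contDiff_extDeriv (contDiff_theta γ a)
  | psi a => exact contDiff_psi γ a

theorem theta_eq (a : Fin m) (p : FieldSpace n m) :
    theta γ a p = dPot a (unitForm _) - formF a p +
      (1 / 8 : ℝ) • ∑ b, ∑ c, γ a b c • wedgeL (formA b p) (wedgeL (formA c p) (unitForm _)) := by
  rw [theta, extDeriv_oneForm_formA]
  simp only [wedge_eq, oneForm_eq]

theorem extDeriv_theta (a : Fin m) (p : FieldSpace n m) :
    extDeriv (theta γ a) p = -extDeriv (formF a) p + (1 / 8 : ℝ) • ∑ b, ∑ c, γ a b c •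
      (wedgeL (formA c p) (dPot b (unitForm _)) - wedgeL (formA b p) (dPot c (unitForm _))) := by
  refine (extDeriv_sub_add (contDiff_extDeriv (contDiff_oneForm_formA a))
    (contDiff_of_isLinearMap (isLinearMap_formF a)) (contDiff_smul_sum_sum _ _ fun b c =>
      contDiff_wedge (contDiff_formA b) (contDiff_oneForm_formA c)) p).trans ?_
  rw [extDeriv_extDeriv_of_smooth (contDiff_oneForm_formA a), Pi.zero_apply, zero_sub,
    extDeriv_smul_sum_sum _ _ fun b c =>
      contDiff_wedge (contDiff_formA b) (contDiff_oneForm_formA c)]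
  congr 2
  refine Finset.sum_congr rfl fun b _ => Finset.sum_congr rfl fun c _ => ?_
  rw [extDeriv_formA_wedge b (contDiff_oneForm_formA c), extDeriv_oneForm_formA, oneForm_eq,
    dPot_wedgeL]

end Gauge

/-! ### Closure of the gauge ideal under exterior differentiation -/

section Closed

variable {n m r : ℕ}

/-- Either σ permutes the factors of det η or the symbol is zero. This trades raising two indices of
the symbol for raising the remaining ones. -/
theorem leviCivita_mul_prod_lorentz (σ : Fin n → Fin n) :
    leviCivita σ * ∏ i, lorentz (σ i) = leviCivita σ * ∏ i : Fin n, lorentz i := by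
  by_cases hσ : Function.Injective σ
  · rw [(Function.Bijective.prod_comp (Finite.injective_iff_bijective.1 hσ) fun i => lorentz i)]
  · simp only [Function.Injective, not_forall] at hσ
    obtain ⟨i, j, hij, hne⟩ := hσ
    have : leviCivita σ = 0 := by
      rw [← vol_stdVec_comp]
      exact (vol n).map_eq_zero_of_eq (i := i) (j := j) _ (by rw [hij]) hne
    rw [this, zero_mul, zero_mul]

theorem dxs_eq_leviCivita (κ : Fin n → Fin n) (p : FieldSpace n m) :
    dxs κ p = leviCivita κ • dxs id p := by
  ext w
  rw [ContinuousAlternatingMap.smul_apply, dxs_apply, dxs_apply, leviCivita, smul_eq_mul,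
    ← Matrix.det_mul]
  congr 1
  ext i j
  simp [Matrix.mul_apply, Matrix.one_apply]

/-- The exterior product with `Fᵃ`. -/
def wedgeF {k : ℕ} (a : Fin m) (p : FieldSpace n m) : (FieldSpace n m [⋀^Fin k]→L[ℝ] ℝ) →L[ℝ]
    (FieldSpace n m [⋀^Fin (k + 1 + 1)]→L[ℝ] ℝ) :=
  (1 / 2 : ℝ) • ∑ i, ∑ j, fieldStrength a i j p • (wedgeL (dxCov i)).comp (wedgeL (dxCov j))

theorem wedgeF_apply {k : ℕ} (a : Fin m) (p : FieldSpace n m)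
    (f : FieldSpace n m [⋀^Fin k]→L[ℝ] ℝ) : wedgeF a p f =
      (1 / 2 : ℝ) • ∑ i, ∑ j, fieldStrength a i j p • wedgeL (dxCov i) (wedgeL (dxCov j) f) := by
  simp [wedgeF]

theorem wedgeF_unitForm (a : Fin m) (p : FieldSpace n m) : wedgeF a p (unitForm _) = formF a p := by
  rw [wedgeF_apply, formF]
  simp only [wedge_eq, oneForm_eq, dx_eq]

theorem wedgeF_wedgeL {k : ℕ} (a : Fin m) (p : FieldSpace n m) (c : FieldSpace n m →L[ℝ] ℝ)
    (f : FieldSpace n m [⋀^Fin k]→L[ℝ] ℝ) :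
    wedgeF a p (wedgeL c f) = wedgeL c (wedgeF a p f) := by
  rw [wedgeF_apply, wedgeF_apply, map_smul, map_sum]
  simp only [map_sum, map_smul]
  congr 1
  exact Finset.sum_congr rfl fun i _ => Finset.sum_congr rfl fun j _ => by rw [wedgeL_comm_even]

/-- The product of a field strength with the dual of another one. -/
theorem wedgeF_starF (b c : Fin m) (p : FieldSpace (r + 2) m) :
    wedgeF b p (starF c p) = ((1 / 2 : ℝ) * (1 / (2 * (r.factorial : ℝ))) *
      ∑ i, ∑ j, ∑ k, ∑ l, ∑ κ : Fin r → Fin (r + 2),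
        (fieldStrength b i j p * fieldStrength c k l p * (lorentz k * lorentz l *
          (leviCivita (Matrix.vecCons i (Matrix.vecCons j κ)) *
            leviCivita (Matrix.vecCons k (Matrix.vecCons l κ)))))) • dxs id p := by
  have h : ∀ i j (κ : Fin r → Fin (r + 2)), wedgeL (dxCov i) (wedgeL (dxCov j) (dxs κ p)) =
      leviCivita (Matrix.vecCons i (Matrix.vecCons j κ)) • dxs (m := m) id p := by
    intro i j κ
    rw [← dxs_eq_leviCivita]
    rfl
  rw [wedgeF_apply, starF]
  simp only [map_smul, map_sum, h, mul_smul, Finset.sum_smul, Finset.smul_sum]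
  refine Finset.sum_congr rfl fun i _ => Finset.sum_congr rfl fun j _ =>
    Finset.sum_congr rfl fun k _ => Finset.sum_congr rfl fun l _ =>
    Finset.sum_congr rfl fun κ _ => ?_
  simp only [smul_smul]
  congr 1
  ring

/-- This is the symmetry of the scalar product of two-forms. The metric factors of the raised pair
can be replaced by det η and those of the remaining indices κ, which both Levi-Civita symbols share;
then the two pairs can be exchanged. -/
theorem wedgeF_starF_comm (b c : Fin m) (p : FieldSpace (r + 2) m) :
    wedgeF b p (starF c p) = wedgeF c p (starF b p) := by
  have hL : ∀ k l (κ : Fin r → Fin (r + 2)),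
      lorentz k * lorentz l * leviCivita (Matrix.vecCons k (Matrix.vecCons l κ)) =
      (∏ i, lorentz (κ i)) * (∏ i : Fin (r + 2), lorentz i) *
        leviCivita (Matrix.vecCons k (Matrix.vecCons l κ)) := by
    intro k l κ
    have h := leviCivita_mul_prod_lorentz (Matrix.vecCons k (Matrix.vecCons l κ))
    rw [Fin.prod_univ_succ, Fin.prod_univ_succ] at h
    simp only [Matrix.cons_val_zero, Matrix.cons_val_succ] at h
    have hκ : (∏ i, lorentz (κ i)) * (∏ i, lorentz (κ i)) = 1 := by
      rw [← Finset.prod_mul_distrib]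
      simp [lorentz_mul_self]
    linear_combination (-lorentz k * lorentz l *
      leviCivita (Matrix.vecCons k (Matrix.vecCons l κ))) * hκ + (∏ i, lorentz (κ i)) * h
  rw [wedgeF_starF, wedgeF_starF]
  congr 2
  have hswap : ∀ f : Fin (r + 2) → Fin (r + 2) → Fin (r + 2) → Fin (r + 2) → ℝ,
      ∑ i, ∑ j, ∑ k, ∑ l, f i j k l = ∑ i, ∑ j, ∑ k, ∑ l, f k l i j := by
    intro f
    calc ∑ i, ∑ j, ∑ k, ∑ l, f i j k l = ∑ i, ∑ k, ∑ j, ∑ l, f i j k l :=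
          Finset.sum_congr rfl fun i _ => Finset.sum_comm
      _ = ∑ k, ∑ i, ∑ j, ∑ l, f i j k l := Finset.sum_comm
      _ = ∑ k, ∑ i, ∑ l, ∑ j, f i j k l :=
          Finset.sum_congr rfl fun k _ => Finset.sum_congr rfl fun i _ => Finset.sum_comm
      _ = ∑ k, ∑ l, ∑ i, ∑ j, f i j k l := Finset.sum_congr rfl fun k _ => Finset.sum_comm
  rw [hswap]
  refine Finset.sum_congr rfl fun i _ => Finset.sum_congr rfl fun j _ =>
    Finset.sum_congr rfl fun k _ => Finset.sum_congr rfl fun l _ =>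
    Finset.sum_congr rfl fun κ _ => ?_
  linear_combination (fieldStrength b k l p * fieldStrength c i j p *
    leviCivita (Matrix.vecCons k (Matrix.vecCons l κ))) * hL i j κ -
    (fieldStrength b k l p * fieldStrength c i j p *
      leviCivita (Matrix.vecCons i (Matrix.vecCons j κ))) * hL k l κ

variable (γ : Fin m → Fin m → Fin m → ℝ)

/-- The exterior product with `θᵃ`. -/
def wedgeTheta {k : ℕ} (a : Fin m) (p : FieldSpace n m) : (FieldSpace n m [⋀^Fin k]→L[ℝ] ℝ) →L[ℝ]
    (FieldSpace n m [⋀^Fin (k + 1 + 1)]→L[ℝ] ℝ) :=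
  dPot a - wedgeF a p +
    (1 / 8 : ℝ) • ∑ b, ∑ c, γ a b c • (wedgeL (formA b p)).comp (wedgeL (formA c p))

theorem wedgeTheta_apply {k : ℕ} (a : Fin m) (p : FieldSpace n m)
    (f : FieldSpace n m [⋀^Fin k]→L[ℝ] ℝ) : wedgeTheta γ a p f = dPot a f - wedgeF a p f +
      (1 / 8 : ℝ) • ∑ b, ∑ c, γ a b c • wedgeL (formA b p) (wedgeL (formA c p) f) := by
  simp [wedgeTheta]

theorem wedgeTheta_unitForm (a : Fin m) (p : FieldSpace n m) :
    wedgeTheta γ a p (unitForm _) = theta γ a p := by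
  rw [wedgeTheta_apply, theta_eq, wedgeF_unitForm]

theorem wedgeTheta_wedgeL {k : ℕ} (a : Fin m) (p : FieldSpace n m) (c : FieldSpace n m →L[ℝ] ℝ)
    (f : FieldSpace n m [⋀^Fin k]→L[ℝ] ℝ) :
    wedgeTheta γ a p (wedgeL c f) = wedgeL c (wedgeTheta γ a p f) := by
  rw [wedgeTheta_apply, wedgeTheta_apply, dPot_wedgeL, wedgeF_wedgeL, map_add, map_sub, map_smul,
    map_sum]
  simp only [map_sum, map_smul]
  congr 2
  exact Finset.sum_congr rfl fun i _ => Finset.sum_congr rfl fun j _ => by rw [wedgeL_comm_even]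

/-- A two-form commutes with covectors, so θᵃ ∧ dx^κ is reached from θᵃ by multiplying with one
covector at a time. -/
theorem wedgeTheta_dxs_mem {k : ℕ} (a : Fin m) (κ : Fin k → Fin (r + 2)) :
    Ideal (GaugeGenerator r γ) (k + 1 + 1) fun p => wedgeTheta γ a p (dxs κ p) := by
  induction k with
  | zero =>
    have : (fun p => wedgeTheta γ a p (dxs κ p)) = theta (n := r + 2) γ a :=
      funext fun p => wedgeTheta_unitForm γ a p
    rw [this]
    exact Ideal.gen (GaugeGenerator.theta a)
  | succ k ih =>
    have : (fun p => wedgeTheta γ a p (dxs κ p)) =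
        wedge (dx (κ 0)) fun p => wedgeTheta γ a p (dxs (Fin.tail κ) p) :=
      funext fun p => wedgeTheta_wedgeL γ a p _ _
    rw [this]
    exact (ih (Fin.tail κ)).wedge _ contDiff_const

theorem contDiff_fieldStrength (a : Fin m) (i j : Fin n) :
    ContDiff ℝ ∞ (fieldStrength (n := n) a i j) := by
  let l : FieldSpace n m →ₗ[ℝ] ℝ :=
    { toFun := fieldStrength a i j
      map_add' := fun p q => by simp [fieldStrength_eq]
      map_smul' := fun c p => by simp [fieldStrength_eq] }
  exact (LinearMap.toContinuousLinearMap l).contDiff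

theorem wedgeTheta_starF_mem (a c : Fin m) :
    Ideal (GaugeGenerator r γ) (r + 1 + 1) fun p => wedgeTheta γ a p (starF c p) := by
  simp only [starF, map_smul, map_sum]
  refine Ideal.const_smul _ (Ideal.sum _ _ fun i _ => Ideal.sum _ _ fun j _ =>
    Ideal.sum _ _ fun κ _ => (wedgeTheta_dxs_mem γ a κ).smul _ ?_)
  exact (contDiff_fieldStrength c i j).mul contDiff_const

/-- The hypothesis `hJ` is the Jacobi identity and x stands for A ∧ A ∧ *F. By antisymmetry of x
only the antisymmetrized product of structure constants matters, and it appears twice on the right: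
this is why 1/4 in ψ goes with 1/8 in θ. -/
theorem structure_constants_sum (hJ : ∀ a c d e, ∑ f, γ f a d * γ c f e - ∑ f, γ f a e * γ c f d =
      ∑ f, γ c a f * γ f d e)
    (x : Fin m → Fin m → Fin m → ℝ) (hx : ∀ d e c, x d e c = -x e d c) (a : Fin m) :
    ∑ b, ∑ c, γ c a b * (1 / 4 * ∑ d, ∑ e, γ e c d * x b d e) =
      ∑ b, ∑ c, γ c a b * (1 / 8 * ∑ d, ∑ e, γ b d e * x d e c) := by
  let G : Fin m → Fin m → Fin m → ℝ := fun d e c => ∑ f, γ f a d * γ c f e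
  have h₁ : ∑ b, ∑ c, γ c a b * (1 / 4 * ∑ d, ∑ e, γ e c d * x b d e) =
      1 / 4 * ∑ d, ∑ e, ∑ c, G d e c * x d e c := by
    simp only [G, Finset.mul_sum, Finset.sum_mul]
    refine Finset.sum_congr rfl fun b _ => ?_
    rw [Finset.sum_comm]
    refine Finset.sum_congr rfl fun d _ => ?_
    rw [Finset.sum_comm]
    exact Finset.sum_congr rfl fun e _ => Finset.sum_congr rfl fun c _ => by ring
  have h₂ : ∑ b, ∑ c, γ c a b * (1 / 8 * ∑ d, ∑ e, γ b d e * x d e c) =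
      1 / 8 * ∑ d, ∑ e, ∑ c, (G d e c - G e d c) * x d e c := by
    simp only [G, hJ, Finset.mul_sum, Finset.sum_mul]
    calc _ = ∑ b, ∑ d, ∑ e, ∑ c, γ c a b * (1 / 8 * (γ b d e * x d e c)) := by
          refine Finset.sum_congr rfl fun b _ => ?_
          rw [Finset.sum_comm]
          exact Finset.sum_congr rfl fun d _ => Finset.sum_comm
      _ = ∑ d, ∑ e, ∑ c, ∑ b, γ c a b * (1 / 8 * (γ b d e * x d e c)) := by
          rw [Finset.sum_comm]
          refine Finset.sum_congr rfl fun d _ => ?_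
          rw [Finset.sum_comm]
          exact Finset.sum_congr rfl fun e _ => Finset.sum_comm
      _ = _ := Finset.sum_congr rfl fun d _ => Finset.sum_congr rfl fun e _ =>
          Finset.sum_congr rfl fun c _ => Finset.sum_congr rfl fun b _ => by ring
  have h₃ : ∑ d, ∑ e, ∑ c, G e d c * x d e c = -∑ d, ∑ e, ∑ c, G d e c * x d e c := by
    rw [Finset.sum_comm]
    simp only [← Finset.sum_neg_distrib]
    exact Finset.sum_congr rfl fun d _ => Finset.sum_congr rfl fun e _ =>
      Finset.sum_congr rfl fun c _ => by rw [hx e d]; ring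
  rw [h₁, h₂]
  simp only [sub_mul, Finset.sum_sub_distrib]
  rw [h₃]
  ring

theorem extDeriv_starF_eq (c : Fin m) (p : FieldSpace (r + 2) m) :
    extDeriv (starF c) p = -psi γ c p - (1 / 4 : ℝ) • ∑ d, ∑ e, γ e c d •
      wedgeL (formA d p) (starF e p) := by
  simp only [psi, wedge_eq]
  abel

theorem extDeriv_psi_eq (a : Fin m) (p : FieldSpace (r + 2) m) :
    extDeriv (psi γ a) p =
      -((1 / 4 : ℝ) • ∑ b, ∑ c, γ c a b • extDeriv (wedge (formA b) (starF c)) p) := by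
  have hc := fun b c => contDiff_wedge (contDiff_formA (n := r + 2) b) (contDiff_starF (m := m) c)
  have h₀ : extDeriv (psi γ a) p = -extDeriv (extDeriv (starF a)) p -
      (1 / 4 : ℝ) • ∑ b, ∑ c, γ c a b • extDeriv (wedge (formA b) (starF c)) p := by
    rw [← extDeriv_smul_sum_sum _ _ hc, ← extDeriv_fun_neg]
    exact extDeriv_fun_sub (contDiff_extDeriv (contDiff_starF a)).neg
      (contDiff_smul_sum_sum _ _ hc)
  rw [h₀, extDeriv_extDeriv_of_smooth (contDiff_starF a), Pi.zero_apply, neg_zero, zero_sub]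

/-- Substitute dA = θ + F - ⅛ γ A ∧ A and d*F = -ψ - ¼ γ A ∧ *F. Only the first bracket lies visibly
in the ideal. -/
theorem extDeriv_formA_wedge_starF (b c : Fin m) (p : FieldSpace (r + 2) m)
    (w : Fin (r + 1 + 1) → FieldSpace (r + 2) m) :
    extDeriv (wedge (formA b) (starF c)) p w =
      (wedgeTheta γ b p (starF c p) + wedgeL (formA b p) (psi γ c p)) w +
      wedgeF b p (starF c p) w +
      (1 / 4 * ∑ d, ∑ e, γ e c d * wedgeL (formA b p) (wedgeL (formA d p) (starF e p)) w) -
      (1 / 8 * ∑ d, ∑ e, γ b d e * wedgeL (formA d p) (wedgeL (formA e p) (starF c p)) w) := by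
  have h : wedgeL (formA b p) (extDeriv (starF c) p) = -wedgeL (formA b p) (psi γ c p) -
      (1 / 4 : ℝ) • ∑ d, ∑ e, γ e c d • wedgeL (formA b p) (wedgeL (formA d p) (starF e p)) := by
    rw [extDeriv_starF_eq γ]
    simp only [map_sub, map_neg, map_smul, map_sum]
  refine (congrArg (fun f => f w) ((extDeriv_formA_wedge b (contDiff_starF c) p).trans
    (congrArg (fun f => dPot b (starF c p) - f) h))).trans ?_
  have h' := congrArg (fun f => f w) (wedgeTheta_apply γ b p (starF c p))
  simp only [ContinuousAlternatingMap.sub_apply,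
    ContinuousAlternatingMap.add_apply, ContinuousAlternatingMap.neg_apply,
    ContinuousAlternatingMap.smul_apply, ContinuousAlternatingMap.sum_apply, smul_eq_mul] at h' ⊢
  rw [h']
  ring

theorem sum_wedgeF_starF (hγ : ∀ a b c, γ c a b = -γ b a c) (a : Fin m)
    (p : FieldSpace (r + 2) m) (w : Fin (r + 1 + 1) → FieldSpace (r + 2) m) :
    ∑ b, ∑ c, γ c a b * wedgeF b p (starF c p) w = 0 := by
  have : ∑ b, ∑ c, γ c a b * wedgeF b p (starF c p) w =
      -∑ b, ∑ c, γ c a b * wedgeF b p (starF c p) w := by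
    conv_lhs => rw [Finset.sum_comm]
    simp only [← Finset.sum_neg_distrib]
    refine Finset.sum_congr rfl fun b _ => Finset.sum_congr rfl fun c _ => ?_
    rw [hγ a c b, wedgeF_starF_comm]
    ring
  linarith

theorem sum_four_terms {ι : Type*} [Fintype ι] (g A B C D : ι → ι → ℝ)
    (hB : ∑ b, ∑ c, g b c * B b c = 0)
    (hC : ∑ b, ∑ c, g b c * C b c = ∑ b, ∑ c, g b c * D b c) :
    -(1 / 4 * ∑ b, ∑ c, g b c * (A b c + B b c + C b c - D b c)) =
      -1 / 4 * ∑ b, ∑ c, g b c * A b c := by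
  simp only [mul_add, mul_sub, Finset.sum_add_distrib, Finset.sum_sub_distrib]
  rw [hB, hC]
  ring

/-- After contraction with γ the F ∧ *F terms vanish by symmetry against antisymmetry, and the two
cubic terms cancel by the Jacobi identity. -/
theorem extDeriv_psi (hγ : ∀ a b c, γ c a b = -γ b a c)
    (hJ : ∀ a c d e, ∑ f, γ f a d * γ c f e - ∑ f, γ f a e * γ c f d = ∑ f, γ c a f * γ f d e)
    (a : Fin m) (p : FieldSpace (r + 2) m) :
    extDeriv (psi γ a) p = (-1 / 4 : ℝ) • ∑ b, ∑ c, γ c a b •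
      (wedgeTheta γ b p (starF c p) + wedgeL (formA b p) (psi γ c p)) := by
  rw [extDeriv_psi_eq]
  refine ContinuousAlternatingMap.ext fun w => ?_
  have hX := structure_constants_sum γ hJ
    (fun d e c => wedgeL (formA d p) (wedgeL (formA e p) (starF c p)) w)
    (fun d e c => by rw [wedgeL_anticomm, ContinuousAlternatingMap.neg_apply]) a
  have h := sum_four_terms (fun b c => γ c a b)
    (fun b c => (wedgeTheta γ b p (starF c p) + wedgeL (formA b p) (psi γ c p)) w) _ _ _
    (sum_wedgeF_starF γ hγ a p w) hX
  simp only [ContinuousAlternatingMap.neg_apply, ContinuousAlternatingMap.smul_apply,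
    ContinuousAlternatingMap.sum_apply, smul_eq_mul, extDeriv_formA_wedge_starF γ]
  exact h

theorem gauge_closed (hγ : ∀ a b c, γ c a b = -γ b a c)
    (hJ : ∀ a c d e, ∑ f, γ f a d * γ c f e - ∑ f, γ f a e * γ c f d = ∑ f, γ c a f * γ f d e)
    {k : ℕ} {φ : Form (FieldSpace (r + 2) m) k} (h : Ideal (GaugeGenerator r γ) k φ) :
    Ideal (GaugeGenerator r γ) (k + 1) (extDeriv φ) := by
  refine h.extDeriv_mem (fun k φ hφ => hφ.contDiff) fun k φ hφ => ?_
  cases hφ with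
  | theta a => exact .gen (.dtheta a)
  | dtheta a =>
    rw [extDeriv_extDeriv_of_smooth (contDiff_theta γ a)]
    exact .zero
  | psi a =>
    rw [show extDeriv (psi γ a) = _ from funext (extDeriv_psi γ hγ hJ a)]
    exact Ideal.const_smul _ (Ideal.sum _ _ fun b _ => Ideal.sum _ _ fun c _ =>
      Ideal.const_smul _ ((wedgeTheta_starF_mem γ b c).add
        ((Ideal.gen (.psi c)).wedge _ (contDiff_formA b))))

end Closed

section Model

variable {n m r : ℕ}

/-! ### Horizontal forms -/

/-- The independent variables, as a linear map. -/
def xLin (n m : ℕ) : FieldSpace n m →ₗ[ℝ] (Fin n → ℝ) := LinearMap.fst ℝ _ _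

/-- A form is horizontal if it depends only on the components of vectors along the independent
variables. -/
def IsHorizontal {k : ℕ} (h : FieldSpace n m [⋀^Fin k]→L[ℝ] ℝ) : Prop :=
  ∀ w, h w = h fun i => ((w i).1, 0)

theorem IsHorizontal.sub {k : ℕ} {h h' : FieldSpace n m [⋀^Fin k]→L[ℝ] ℝ} (H : IsHorizontal h)
    (H' : IsHorizontal h') : IsHorizontal (h - h') := fun w => by
  rw [ContinuousAlternatingMap.sub_apply, ContinuousAlternatingMap.sub_apply, H w, H' w]

theorem IsHorizontal.smul {k : ℕ} {h : FieldSpace n m [⋀^Fin k]→L[ℝ] ℝ} (H : IsHorizontal h)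
    (c : ℝ) : IsHorizontal (c • h) := fun w => by
  rw [ContinuousAlternatingMap.smul_apply, ContinuousAlternatingMap.smul_apply, H w]

theorem IsHorizontal.sum {k : ℕ} {ι : Type*} (s : Finset ι)
    {h : ι → FieldSpace n m [⋀^Fin k]→L[ℝ] ℝ} (H : ∀ i, IsHorizontal (h i)) :
    IsHorizontal (∑ i ∈ s, h i) := fun w => by
  rw [ContinuousAlternatingMap.sum_apply, ContinuousAlternatingMap.sum_apply]
  exact Finset.sum_congr rfl fun i _ => H i w

theorem IsHorizontal.wedgeL {k : ℕ} {h : FieldSpace n m [⋀^Fin k]→L[ℝ] ℝ} (H : IsHorizontal h)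
    (b : Fin m) (p : FieldSpace n m) : IsHorizontal (EDS.wedgeL (formA b p) h) := fun w => by
  rw [wedgeL_apply, wedgeL_apply]
  refine Finset.sum_congr rfl fun i _ => ?_
  rw [formA_apply, formA_apply, H]
  rfl

theorem isHorizontal_unitForm : IsHorizontal (unitForm (FieldSpace n m)) := fun _ => rfl

theorem isHorizontal_formF (a : Fin m) (p : FieldSpace n m) : IsHorizontal (formF a p) := fun w => by
  rw [formF_apply, formF_apply]

theorem isHorizontal_starF (a : Fin m) (p : FieldSpace (r + 2) m) :
    IsHorizontal (starF a p) := fun w => by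
  rw [starF_apply, starF_apply]

/-- The alternating form on `ℝⁿ` defined by a horizontal form. -/
def descend {k : ℕ} (h : FieldSpace n m [⋀^Fin k]→L[ℝ] ℝ) : (Fin n → ℝ) [⋀^Fin k]→ₗ[ℝ] ℝ :=
  pullback (LinearMap.inl ℝ _ _) h.toAlternatingMap

theorem IsHorizontal.descend_apply {k : ℕ} {h : FieldSpace n m [⋀^Fin k]→L[ℝ] ℝ}
    (H : IsHorizontal h) (w : Fin k → FieldSpace n m) : descend h (fun i => (w i).1) = h w :=
  (H w).symm

/-! ### The generators modulo horizontal forms -/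

/-- A covector as an alternating form of degree one. -/
def covectorForm : (Fin n → ℝ) →ₗ[ℝ] (Fin n → ℝ) [⋀^Fin 1]→ₗ[ℝ] ℝ where
  toFun u := AlternatingMap.ofSubsingleton ℝ (Fin n → ℝ) ℝ (0 : Fin 1) (dotProductBilin ℝ ℝ u)
  map_add' u v := by ext w; simp
  map_smul' c u := by ext w; simp

theorem covectorForm_apply (u : Fin n → ℝ) (w : Fin 1 → Fin n → ℝ) :
    covectorForm u w = u ⬝ᵥ w 0 := rfl

/-- The vertical component `dAᵃ` of a tangent vector, as a covector. -/
def symbolA (a : Fin m) : FieldSpace n m →ₗ[ℝ] (Fin n → ℝ) [⋀^Fin 1]→ₗ[ℝ] ℝ :=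
  covectorForm.comp ((LinearMap.proj a).comp ((LinearMap.fst ℝ _ _).comp (LinearMap.snd ℝ _ _)))

/-- The vertical component `dFᵃ` of a tangent vector, as a two-form. -/
def symbolF (a : Fin m) : FieldSpace n m →ₗ[ℝ] (Fin n → ℝ) [⋀^Fin 2]→ₗ[ℝ] ℝ :=
  twoForm.comp ((LinearMap.proj a).comp ((LinearMap.snd ℝ _ _).comp (LinearMap.snd ℝ _ _)))

theorem symbolA_apply (a : Fin m) (v : FieldSpace n m) : symbolA a v = covectorForm (v.2.1 a) := rfl

theorem symbolF_apply (a : Fin m) (v : FieldSpace n m) : symbolF a v = twoForm (v.2.2 a) := rfl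

/-- The form with symbol `l` and horizontal part `-t`. -/
def modelForm {d : ℕ} (l : FieldSpace n m →ₗ[ℝ] (Fin n → ℝ) [⋀^Fin d]→ₗ[ℝ] ℝ)
    (t : (Fin n → ℝ) [⋀^Fin (d + 1)]→ₗ[ℝ] ℝ) : FieldSpace n m [⋀^Fin (d + 1)]→ₗ[ℝ] ℝ :=
  AlternatingMap.alternatizeUncurryFin ((pullback (xLin n m)).comp l) - pullback (xLin n m) t

theorem modelForm_apply {d : ℕ} (l : FieldSpace n m →ₗ[ℝ] (Fin n → ℝ) [⋀^Fin d]→ₗ[ℝ] ℝ)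
    (t : (Fin n → ℝ) [⋀^Fin (d + 1)]→ₗ[ℝ] ℝ) (w : Fin (d + 1) → FieldSpace n m) :
    modelForm l t w = ∑ i : Fin (d + 1), (-1) ^ (i : ℕ) * l (w i) (fun j => (i.removeNth w j).1) -
      t fun i => (w i).1 := by
  rw [modelForm, AlternatingMap.sub_apply, alternatingMap_alternatizeUncurryFin_apply_real]
  rfl

/-- A form vanishes on a subspace. -/
def VanishesOn {M : Type*} [AddCommGroup M] [Module ℝ M] {k : ℕ} (f : M [⋀^Fin k]→ₗ[ℝ] ℝ)
    (E : Submodule ℝ M) : Prop :=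
  ∀ w : Fin k → M, (∀ i, w i ∈ E) → f w = 0

variable (γ : Fin m → Fin m → Fin m → ℝ)

/-- The horizontal part of `θᵃ`. -/
def horTheta (a : Fin m) (p : FieldSpace n m) : FieldSpace n m [⋀^Fin 2]→L[ℝ] ℝ :=
  (1 / 8 : ℝ) • ∑ b, ∑ c, γ a b c • wedgeL (formA b p) (wedgeL (formA c p) (unitForm _)) -
    formF a p

theorem isHorizontal_horTheta (a : Fin m) (p : FieldSpace n m) :
    IsHorizontal (horTheta γ a p) :=
  IsHorizontal.sub (IsHorizontal.smul (IsHorizontal.sum _ fun b => IsHorizontal.sum _ fun c =>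
    IsHorizontal.smul ((isHorizontal_unitForm.wedgeL c p).wedgeL b p) _) _) (isHorizontal_formF a p)

theorem theta_eq_add_horTheta (a : Fin m) (p : FieldSpace n m) :
    theta γ a p = dPot a (unitForm _) + horTheta γ a p := by
  rw [theta_eq, horTheta]
  abel

/-- The horizontal part of `dθᵃ` modulo the `θᵇ`. -/
def horDTheta (a : Fin m) (p : FieldSpace n m) : FieldSpace n m [⋀^Fin 3]→L[ℝ] ℝ :=
  (1 / 8 : ℝ) • ∑ b, ∑ c, γ a b c •
    (wedgeL (formA c p) (horTheta γ b p) - wedgeL (formA b p) (horTheta γ c p))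

theorem isHorizontal_horDTheta (a : Fin m) (p : FieldSpace n m) :
    IsHorizontal (horDTheta γ a p) :=
  IsHorizontal.smul (IsHorizontal.sum _ fun b => IsHorizontal.sum _ fun c =>
    IsHorizontal.smul (((isHorizontal_horTheta γ b p).wedgeL c p).sub
      ((isHorizontal_horTheta γ c p).wedgeL b p)) _) _

/-- Replacing each dAᵇ by θᵇ minus its horizontal part removes dA from dθᵃ modulo the θᵇ, so the
equations for dA and for dF decouple. -/
theorem extDeriv_theta_eq (a : Fin m) (p : FieldSpace n m) :
    extDeriv (theta γ a) p = (1 / 8 : ℝ) • ∑ b, ∑ c, γ a b c •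
      (wedgeL (formA c p) (theta γ b p) - wedgeL (formA b p) (theta γ c p)) -
      (extDeriv (formF a) p + horDTheta γ a p) := by
  have h : ∀ b c, wedgeL (formA c p) (dPot b (unitForm (FieldSpace n m))) =
      wedgeL (formA c p) (theta γ b p) - wedgeL (formA c p) (horTheta γ b p) := fun b c => by
    rw [theta_eq_add_horTheta, map_add, add_sub_cancel_right]
  rw [extDeriv_theta, horDTheta]
  simp only [h]
  refine ContinuousAlternatingMap.ext fun w => ?_
  simp only [ContinuousAlternatingMap.add_apply, ContinuousAlternatingMap.neg_apply,
    ContinuousAlternatingMap.sub_apply, ContinuousAlternatingMap.smul_apply,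
    ContinuousAlternatingMap.sum_apply, smul_eq_mul, mul_sub, Finset.sum_sub_distrib]
  ring

/-- The horizontal part of `-ψ_a`. -/
def horPsi (a : Fin m) (p : FieldSpace (r + 2) m) : FieldSpace (r + 2) m [⋀^Fin (r + 1)]→L[ℝ] ℝ :=
  (1 / 4 : ℝ) • ∑ b, ∑ c, γ c a b • wedgeL (formA b p) (starF c p)

theorem isHorizontal_horPsi (a : Fin m) (p : FieldSpace (r + 2) m) :
    IsHorizontal (horPsi γ a p) :=
  IsHorizontal.smul (IsHorizontal.sum _ fun b => IsHorizontal.sum _ fun c =>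
    IsHorizontal.smul ((isHorizontal_starF c p).wedgeL b p) _) _

theorem psi_eq (a : Fin m) (p : FieldSpace (r + 2) m) :
    psi γ a p = -(extDeriv (starF a) p + horPsi γ a p) := by
  rw [psi, horPsi, neg_add]
  rfl

theorem modelForm_theta (a : Fin m) (p : FieldSpace n m) (w : Fin 2 → FieldSpace n m) :
    modelForm (symbolA a) (-descend (horTheta γ a p)) w = theta γ a p w := by
  rw [theta_eq_add_horTheta, ContinuousAlternatingMap.add_apply, dPot_unitForm_apply,
    modelForm_apply, AlternatingMap.neg_apply, (isHorizontal_horTheta γ a p).descend_apply,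
    Fin.sum_univ_two, symbolA_apply, symbolA_apply, covectorForm_apply, covectorForm_apply]
  simp [Fin.removeNth, sub_eq_add_neg]

theorem modelForm_dtheta (a : Fin m) (p : FieldSpace n m) (w : Fin 3 → FieldSpace n m) :
    modelForm (symbolF a) (-descend (horDTheta γ a p)) w =
      (extDeriv (formF a) p + horDTheta γ a p) w := by
  rw [ContinuousAlternatingMap.add_apply, extDeriv_apply_of_isLinearMap (isLinearMap_formF a),
    modelForm_apply, AlternatingMap.neg_apply, (isHorizontal_horDTheta γ a p).descend_apply,
    sub_neg_eq_add]
  congr 1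
  exact Finset.sum_congr rfl fun i _ => by rw [formF_apply, symbolF_apply]

theorem modelForm_psi (a : Fin m) (p : FieldSpace (r + 2) m)
    (w : Fin (r + 1) → FieldSpace (r + 2) m) :
    modelForm (dualForm.comp (symbolF a)) (-descend (horPsi γ a p)) w = -psi γ a p w := by
  rw [psi_eq, ContinuousAlternatingMap.neg_apply, neg_neg, ContinuousAlternatingMap.add_apply,
    extDeriv_apply_of_isLinearMap (isLinearMap_starF a), modelForm_apply, AlternatingMap.neg_apply,
    (isHorizontal_horPsi γ a p).descend_apply, sub_neg_eq_add]
  congr 1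
  exact Finset.sum_congr rfl fun i _ => by rw [starF_apply]; rfl

/-- The subspace `E` is annihilated by the model forms with horizontal parts `t₁`, `t₂`, `t₃`. -/
def IsModelElement (t₁ : Fin m → (Fin (r + 2) → ℝ) [⋀^Fin 2]→ₗ[ℝ] ℝ)
    (t₂ : Fin m → (Fin (r + 2) → ℝ) [⋀^Fin 3]→ₗ[ℝ] ℝ)
    (t₃ : Fin m → (Fin (r + 2) → ℝ) [⋀^Fin (r + 1)]→ₗ[ℝ] ℝ)
    (E : Submodule ℝ (FieldSpace (r + 2) m)) : Prop :=
  ∀ a, VanishesOn (modelForm (symbolA a) (t₁ a)) E ∧ VanishesOn (modelForm (symbolF a) (t₂ a)) E ∧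
    VanishesOn (modelForm (dualForm.comp (symbolF a)) (t₃ a)) E

/-- At every point, the integral elements are described by model forms. -/
theorem exists_isModelElement_iff (p : FieldSpace (r + 2) m) :
    ∃ (t₁ : Fin m → (Fin (r + 2) → ℝ) [⋀^Fin 2]→ₗ[ℝ] ℝ)
      (t₂ : Fin m → (Fin (r + 2) → ℝ) [⋀^Fin 3]→ₗ[ℝ] ℝ)
      (t₃ : Fin m → (Fin (r + 2) → ℝ) [⋀^Fin (r + 1)]→ₗ[ℝ] ℝ),
      ∀ E : Submodule ℝ (FieldSpace (r + 2) m),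
        IsIntegralElement (Ideal (GaugeGenerator r γ)) p E ↔ IsModelElement t₁ t₂ t₃ E := by
  refine ⟨fun a => -descend (horTheta γ a p), fun a => -descend (horDTheta γ a p),
    fun a => -descend (horPsi γ a p), fun E => ?_⟩
  -- On a subspace where all θᵇ vanish, their products with covectors vanish too, and dθᵃ may be
  -- replaced by its model form up to sign.
  have key : ∀ a, (∀ b, ∀ w : Fin 2 → FieldSpace (r + 2) m, (∀ i, w i ∈ E) → theta γ b p w = 0) →
      ∀ w : Fin 3 → FieldSpace (r + 2) m, (∀ i, w i ∈ E) →
        extDeriv (theta γ a) p w = -(extDeriv (formF a) p + horDTheta γ a p) w := by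
    intro a h w hw
    have h0 : ∀ b c, wedgeL (formA b p) (theta γ c p) w = 0 := by
      intro b c
      rw [wedgeL_apply]
      refine Finset.sum_eq_zero fun i _ => ?_
      rw [h c (i.removeNth w) fun j => hw _, mul_zero, mul_zero]
    rw [extDeriv_theta_eq, ContinuousAlternatingMap.sub_apply, ContinuousAlternatingMap.smul_apply,
      ContinuousAlternatingMap.sum_apply]
    simp only [ContinuousAlternatingMap.sum_apply, ContinuousAlternatingMap.smul_apply,
      ContinuousAlternatingMap.sub_apply, h0, sub_zero, smul_zero, Finset.sum_const_zero, zero_sub]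
  rw [isIntegralElement_ideal_iff]
  constructor
  · intro h a
    have hθ : ∀ b, ∀ w : Fin 2 → FieldSpace (r + 2) m, (∀ i, w i ∈ E) → theta γ b p w = 0 :=
      fun b => h _ _ (.theta b)
    refine ⟨fun w hw => ?_, fun w hw => ?_, fun w hw => ?_⟩
    · rw [modelForm_theta, hθ a w hw]
    · rw [modelForm_dtheta, ← neg_eq_zero, ← key a hθ w hw, h _ _ (.dtheta a) w hw]
    · rw [modelForm_psi, h _ _ (.psi a) w hw, neg_zero]
  · intro h k φ hφ w hw
    have hθ : ∀ b, ∀ w : Fin 2 → FieldSpace (r + 2) m, (∀ i, w i ∈ E) → theta γ b p w = 0 :=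
      fun b w hw => by rw [← modelForm_theta, (h b).1 w hw]
    cases hφ with
    | theta a => exact hθ a w hw
    | dtheta a => rw [key a hθ w hw, ← modelForm_dtheta, (h a).2.1 w hw, neg_zero]
    | psi a => rw [← neg_eq_zero, ← modelForm_psi, (h a).2.2 w hw]

end Model

section General

variable {M : Type} [NormedAddCommGroup M] [NormedSpace ℝ M]

theorem polarSpace_anti {I : ∀ k : ℕ, Form M k → Prop} {p : M} {E E' : Submodule ℝ M}
    (h : E ≤ E') : polarSpace I p E' ≤ polarSpace I p E :=
  fun _ hv k φ hφ w hw => hv k φ hφ w fun i => h (hw i)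

theorem mem_polarSpace_iff {I : ∀ k : ℕ, Form M k → Prop} {p : M} {E : Submodule ℝ M}
    (hE : IsIntegralElement I p E) {v : M} :
    v ∈ polarSpace I p E ↔ IsIntegralElement I p (E ⊔ Submodule.span ℝ {v}) :=
  ⟨hE.sup_span, fun h => polarSpace_anti le_sup_left
    (h.le_polarSpace (Submodule.mem_sup_right (Submodule.mem_span_singleton_self v)))⟩

end General

/-! ### Polar equations and polar ranks -/

section Polar

theorem vanishesOn_sup_span_iff {M : Type*} [AddCommGroup M] [Module ℝ M] {k : ℕ}
    {f : M [⋀^Fin (k + 1)]→ₗ[ℝ] ℝ} {E : Submodule ℝ M} (hE : VanishesOn f E) (v : M) :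
    VanishesOn f (E ⊔ Submodule.span ℝ {v}) ↔ pullback E.subtype (f.curryLeft v) = 0 := by
  constructor
  · intro h
    ext w
    refine h _ fun i => ?_
    cases i using Fin.cases with
    | zero => exact Submodule.mem_sup_right (Submodule.mem_span_singleton_self v)
    | succ i => exact Submodule.mem_sup_left (w i).2
  · intro h w hw
    refine eq_zero_on_sup_span f E v hE (fun w hw => ?_) w hw
    exact congrArg (fun g => g fun i => (⟨w i, hw i⟩ : E)) h

variable {m r : ℕ}

/-- The polar equations of `E`. -/
def polarMap (t₁ : Fin m → (Fin (r + 2) → ℝ) [⋀^Fin 2]→ₗ[ℝ] ℝ)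
    (t₂ : Fin m → (Fin (r + 2) → ℝ) [⋀^Fin 3]→ₗ[ℝ] ℝ)
    (t₃ : Fin m → (Fin (r + 2) → ℝ) [⋀^Fin (r + 1)]→ₗ[ℝ] ℝ)
    (E : Submodule ℝ (FieldSpace (r + 2) m)) : FieldSpace (r + 2) m →ₗ[ℝ]
      (Fin m → (E [⋀^Fin 1]→ₗ[ℝ] ℝ) × (E [⋀^Fin 2]→ₗ[ℝ] ℝ) × (E [⋀^Fin r]→ₗ[ℝ] ℝ)) :=
  LinearMap.pi fun a =>
    ((pullback E.subtype).comp (modelForm (symbolA a) (t₁ a)).curryLeft).prod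
      (((pullback E.subtype).comp (modelForm (symbolF a) (t₂ a)).curryLeft).prod
        ((pullback E.subtype).comp (modelForm (dualForm.comp (symbolF a)) (t₃ a)).curryLeft))

/-- A vertical vector contributes only through the symbol: in every other term its zero horizontal
component enters an alternating form. -/
theorem modelForm_curryLeft {n d : ℕ} (l : FieldSpace n m →ₗ[ℝ] (Fin n → ℝ) [⋀^Fin d]→ₗ[ℝ] ℝ)
    (t : (Fin n → ℝ) [⋀^Fin (d + 1)]→ₗ[ℝ] ℝ) {v : FieldSpace n m} (hv : v.1 = 0)
    (w : Fin d → FieldSpace n m) :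
    (modelForm l t).curryLeft v w = l v fun i => (w i).1 := by
  rw [alternatingMap_curryLeft_apply, modelForm_apply, Fin.sum_univ_succ,
    t.map_coord_zero (0 : Fin (d + 1)) (by simpa using hv), sub_zero, Finset.sum_eq_zero, add_zero]
  · simp
  · intro i _
    cases d with
    | zero => exact i.elim0
    | succ d =>
      rw [removeNth_succ_cons, AlternatingMap.map_coord_zero _ (0 : Fin (d + 1)), mul_zero]
      simpa using hv

theorem finrank_fieldSpace (n m : ℕ) :
    Module.finrank ℝ (FieldSpace n m) = n + m * (n + n.choose 2) := by
  have h : Fintype.card {q : Fin n × Fin n // q.1 < q.2} = n.choose 2 := by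
    rw [← Module.finrank_fintype_fun_eq_card ℝ, (twoFormEquiv n).finrank_eq,
      finrank_alternatingMap, Module.finrank_fintype_fun_eq_card, Fintype.card_fin]
  simp only [Module.finrank_prod, Module.finrank_pi_fintype, Module.finrank_self, h,
    Fintype.card_fin, Finset.sum_const, Finset.card_univ, smul_eq_mul, mul_one]
  ring

/-- A tangent vector is determined by its components. -/
theorem eq_zero_of_symbols {n : ℕ} {v : FieldSpace n m} (h : v.1 = 0)
    (hA : ∀ a, symbolA a v = 0) (hF : ∀ a, symbolF a v = 0) : v = 0 := by
  refine Prod.ext h (Prod.ext (funext fun a => funext fun i => ?_) (funext fun a => ?_))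
  · have := congrArg (fun f => f fun _ => stdVec i) (hA a)
    simpa [symbolA_apply, covectorForm_apply, stdVec] using this
  · exact (twoFormEquiv n).injective ((hF a).trans (map_zero _).symm)

variable {γ : Fin m → Fin m → Fin m → ℝ} {p : FieldSpace (r + 2) m}
  {t₁ : Fin m → (Fin (r + 2) → ℝ) [⋀^Fin 2]→ₗ[ℝ] ℝ}
  {t₂ : Fin m → (Fin (r + 2) → ℝ) [⋀^Fin 3]→ₗ[ℝ] ℝ}
  {t₃ : Fin m → (Fin (r + 2) → ℝ) [⋀^Fin (r + 1)]→ₗ[ℝ] ℝ}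
  {E : Submodule ℝ (FieldSpace (r + 2) m)}

theorem polarSpace_eq_ker
    (ht : ∀ E, IsIntegralElement (Ideal (GaugeGenerator r γ)) p E ↔ IsModelElement t₁ t₂ t₃ E)
    (hE : IsIntegralElement (Ideal (GaugeGenerator r γ)) p E) :
    polarSpace (Ideal (GaugeGenerator r γ)) p E = LinearMap.ker (polarMap t₁ t₂ t₃ E) := by
  ext v
  rw [mem_polarSpace_iff hE, ht, LinearMap.mem_ker, funext_iff]
  have hE' := (ht E).1 hE
  refine forall_congr' fun a => ?_
  rw [vanishesOn_sup_span_iff (hE' a).1, vanishesOn_sup_span_iff (hE' a).2.1,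
    vanishesOn_sup_span_iff (hE' a).2.2]
  simp only [Prod.ext_iff]
  rfl

theorem finrank_polarTarget (m r : ℕ) (E : Type*) [AddCommGroup E] [Module ℝ E]
    [FiniteDimensional ℝ E] : Module.finrank ℝ
    (Fin m → (E [⋀^Fin 1]→ₗ[ℝ] ℝ) × (E [⋀^Fin 2]→ₗ[ℝ] ℝ) × (E [⋀^Fin r]→ₗ[ℝ] ℝ)) =
    m * (Module.finrank ℝ E + (Module.finrank ℝ E).choose 2 + (Module.finrank ℝ E).choose r) := by
  have h : Module.Finite ℝ ((E [⋀^Fin 1]→ₗ[ℝ] ℝ) × (E [⋀^Fin 2]→ₗ[ℝ] ℝ) ×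
    (E [⋀^Fin r]→ₗ[ℝ] ℝ)) := inferInstance
  rw [Module.finrank_pi_fintype]
  simp only [Module.finrank_prod, finrank_alternatingMap, Finset.sum_const, Finset.card_univ,
    Fintype.card_fin, smul_eq_mul, Nat.choose_one_right]
  ring

/-- The number of polar equations bounds the polar rank of every integral element. -/
theorem polarRank_le (hE : IsIntegralElement (Ideal (GaugeGenerator r γ)) p E) :
    polarRank (Ideal (GaugeGenerator r γ)) p E ≤
      m * (Module.finrank ℝ E + (Module.finrank ℝ E).choose 2 + (Module.finrank ℝ E).choose r) := by
  obtain ⟨t₁, t₂, t₃, ht⟩ := exists_isModelElement_iff γ p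
  rw [polarRank, polarSpace_eq_ker ht hE, (LinearMap.quotKerEquivRange _).finrank_eq,
    ← finrank_polarTarget]
  exact Submodule.finrank_le _

/-- This bound, which comes from E ≤ H(E), is the sharp one in dimension n, where the polar
equations are no longer independent. -/
theorem polarRank_add_finrank_le (hE : IsIntegralElement (Ideal (GaugeGenerator r γ)) p E) :
    polarRank (Ideal (GaugeGenerator r γ)) p E + Module.finrank ℝ E ≤
      Module.finrank ℝ (FieldSpace (r + 2) m) := by
  rw [← Submodule.finrank_quotient_add_finrank (polarSpace (Ideal (GaugeGenerator r γ)) p E)]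
  exact Nat.add_le_add_left (Submodule.finrank_mono hE.le_polarSpace) _

/-- A subspace which projects injectively into a hyperplane that is not null. -/
structure IsNonNull (E : Submodule ℝ (FieldSpace (r + 2) m)) : Prop where
  injective : ∀ v ∈ E, v.1 = 0 → v = 0
  exists_normal : ∃ ν : Fin (r + 2) → ℝ, lorentzSq ν ≠ 0 ∧ ∀ v ∈ E, ν ⬝ᵥ v.1 = 0

theorem injective_xLin_comp_subtype (h : ∀ v ∈ E, v.1 = 0 → v = 0) :
    Function.Injective ((xLin (r + 2) m).comp E.subtype) := by
  rw [← LinearMap.ker_eq_bot, LinearMap.ker_eq_bot']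
  exact fun v hv => Subtype.ext (h v v.2 hv)

/-- The dA components are obtained by extending a covector from E by a left inverse of the
projection, the dF components from `exists_twoForm`. That a vertical solution exists also makes the
polar space project onto ℝⁿ. -/
theorem polarMap_surjective_vertical (hE : IsNonNull E) (y : Fin m →
      (E [⋀^Fin 1]→ₗ[ℝ] ℝ) × (E [⋀^Fin 2]→ₗ[ℝ] ℝ) × (E [⋀^Fin r]→ₗ[ℝ] ℝ)) :
    ∃ v : FieldSpace (r + 2) m, v.1 = 0 ∧ polarMap t₁ t₂ t₃ E v = y := by
  obtain ⟨ν, hν, hνE⟩ := hE.exists_normal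
  have hx := injective_xLin_comp_subtype hE.injective
  obtain ⟨g, hg⟩ := LinearMap.exists_leftInverse_of_injective _ (LinearMap.ker_eq_bot.2 hx)
  choose τ hτ₁ hτ₂ using fun a => exists_twoForm ν hν ((xLin (r + 2) m).comp E.subtype) hx
    (fun e => hνE e e.2) (y a).2.1 (y a).2.2
  let l : Fin m → (Fin (r + 2) → ℝ) →ₗ[ℝ] ℝ := fun a =>
    ((AlternatingMap.ofSubsingleton ℝ E ℝ (0 : Fin 1)).symm (y a).1).comp g
  refine ⟨(0, fun a i => l a (stdVec i), fun a => (twoFormEquiv (r + 2)).symm (τ a)), rfl, ?_⟩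
  funext a
  refine Prod.ext ?_ (Prod.ext ?_ ?_)
  · ext w
    refine (modelForm_curryLeft (symbolA a) (t₁ a) rfl fun i => (w i : FieldSpace (r + 2) m)).trans ?_
    rw [symbolA_apply, covectorForm_apply]
    have h : (fun i => l a (stdVec i)) ⬝ᵥ ((w 0 : FieldSpace (r + 2) m).1) =
        l a ((w 0 : FieldSpace (r + 2) m).1) := by
      rw [linear_eq_sum, dotProduct]
      exact Finset.sum_congr rfl fun i _ => mul_comm _ _
    refine h.trans ?_
    have hg0 : g ((w 0 : FieldSpace (r + 2) m).1) = w 0 := LinearMap.congr_fun hg (w 0)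
    change (y a).1 (fun _ => g ((w 0 : FieldSpace (r + 2) m).1)) = _
    rw [hg0]
    congr 1
    funext i
    rw [Fin.fin_one_eq_zero i]
  · ext w
    refine (modelForm_curryLeft (symbolF a) (t₂ a) rfl fun i => (w i : FieldSpace (r + 2) m)).trans ?_
    rw [← hτ₁ a]
    refine congrArg (fun f : (Fin (r + 2) → ℝ) [⋀^Fin 2]→ₗ[ℝ] ℝ => f _) ?_
    exact (twoFormEquiv (r + 2)).apply_symm_apply (τ a)
  · ext w
    refine (modelForm_curryLeft (dualForm.comp (symbolF a)) (t₃ a) rfl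
      fun i => (w i : FieldSpace (r + 2) m)).trans ?_
    rw [← hτ₂ a]
    refine congrArg (fun f : (Fin (r + 2) → ℝ) [⋀^Fin 2]→ₗ[ℝ] ℝ => dualForm f _) ?_
    exact (twoFormEquiv (r + 2)).apply_symm_apply (τ a)

theorem polarRank_eq (hE : IsIntegralElement (Ideal (GaugeGenerator r γ)) p E)
    (hE' : IsNonNull E) : polarRank (Ideal (GaugeGenerator r γ)) p E =
      m * (Module.finrank ℝ E + (Module.finrank ℝ E).choose 2 + (Module.finrank ℝ E).choose r) := by
  obtain ⟨t₁, t₂, t₃, ht⟩ := exists_isModelElement_iff γ p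
  have h : Function.Surjective (polarMap t₁ t₂ t₃ E) := fun y =>
    (polarMap_surjective_vertical hE' y).imp fun v hv => hv.2
  rw [polarRank, polarSpace_eq_ker ht hE, (LinearMap.quotKerEquivOfSurjective _ h).finrank_eq,
    finrank_polarTarget]

/-- The polar space of a non-null integral element projects onto the independent variables. -/
theorem exists_mem_polarSpace (hE : IsIntegralElement (Ideal (GaugeGenerator r γ)) p E)
    (hE' : IsNonNull E) (ξ : Fin (r + 2) → ℝ) :
    ∃ v ∈ polarSpace (Ideal (GaugeGenerator r γ)) p E, v.1 = ξ := by
  obtain ⟨t₁, t₂, t₃, ht⟩ := exists_isModelElement_iff γ p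
  -- The vertical vector cancels the defect of (ξ, 0) in the polar equations without changing ξ.
  obtain ⟨v, hv, hv'⟩ := polarMap_surjective_vertical (t₁ := t₁) (t₂ := t₂) (t₃ := t₃) hE'
    (-polarMap t₁ t₂ t₃ E (ξ, 0))
  refine ⟨(ξ, 0) + v, ?_, by simp [hv]⟩
  rw [polarSpace_eq_ker ht hE, LinearMap.mem_ker, map_add, hv', add_neg_cancel]

/-- An integral element which projects isomorphically onto the independent variables cannot be
enlarged. -/
theorem polarSpace_eq_self (hE : IsIntegralElement (Ideal (GaugeGenerator r γ)) p E)
    (hinj : ∀ v ∈ E, v.1 = 0 → v = 0) (hdim : Module.finrank ℝ E = r + 2) :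
    polarSpace (Ideal (GaugeGenerator r γ)) p E = E := by
  refine le_antisymm (fun v hv => ?_) hE.le_polarSpace
  obtain ⟨t₁, t₂, t₃, ht⟩ := exists_isModelElement_iff γ p
  have hx : Function.Surjective ((xLin (r + 2) m).comp E.subtype) := by
    apply (LinearMap.injective_iff_surjective_of_finrank_eq_finrank _).1
      (injective_xLin_comp_subtype hinj)
    simpa using hdim
  obtain ⟨e, he⟩ := hx v.1
  -- The difference is vertical, and since E projects onto ℝⁿ the polar equations say that its
  -- symbols vanish identically.
  have hu : v - e ∈ polarSpace (Ideal (GaugeGenerator r γ)) p E :=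
    Submodule.sub_mem _ hv (hE.le_polarSpace e.2)
  have hu0 : (v - e : FieldSpace (r + 2) m).1 = 0 := sub_eq_zero.2 he.symm
  rw [polarSpace_eq_ker ht hE, LinearMap.mem_ker, funext_iff] at hu
  choose s hs using hx
  have hs' : ∀ u, ((s u : E) : FieldSpace (r + 2) m).1 = u := hs
  have hzero : (v - e : FieldSpace (r + 2) m) = 0 := by
    refine eq_zero_of_symbols hu0 (fun a => ?_) fun a => ?_
    · ext w
      have h := congrArg (fun f => f.1 fun i => s (w i)) (hu a)
      refine Eq.trans ?_ h
      refine Eq.trans ?_ (modelForm_curryLeft (symbolA a) (t₁ a) hu0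
        fun i => (s (w i) : FieldSpace (r + 2) m)).symm
      simp only [hs']
    · ext w
      have h := congrArg (fun f => f.2.1 fun i => s (w i)) (hu a)
      refine Eq.trans ?_ h
      refine Eq.trans ?_ (modelForm_curryLeft (symbolF a) (t₂ a) hu0
        fun i => (s (w i) : FieldSpace (r + 2) m)).symm
      simp only [hs']
  rw [sub_eq_zero.1 hzero]
  exact e.2

end Polar

/-! ### Generic integral frames -/

section Frames

variable {M : Type} [NormedAddCommGroup M] [NormedSpace ℝ M] {I : ∀ k : ℕ, Form M k → Prop} {p : M}

theorem ForGeneric.mono {H : Submodule ℝ M} {P Q : M → Prop} (h : ∀ v, P v → Q v)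
    (hP : ForGeneric H P) : ForGeneric H Q := by
  obtain ⟨U, hU, hU', hUP⟩ := hP
  exact ⟨U, hU, hU', fun v hv => h v (hUP v hv)⟩

theorem ForGenericIntegralFrame.mono : ∀ {k : ℕ} {P Q : (Fin k → M) → Prop}, (∀ e, P e → Q e) →
    ForGenericIntegralFrame I p k P → ForGenericIntegralFrame I p k Q
  | 0, _, _, h, hP => h _ hP
  | k + 1, _, Q, h, hP =>
    ForGenericIntegralFrame.mono (k := k)
      (Q := fun e => ForGeneric (polarSpace I p (Submodule.span ℝ (Set.range e)))
        fun v => Q (Fin.snoc e v))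
      (fun _ he => ForGeneric.mono (fun _ hv => h _ hv) he) hP

theorem flag_snoc {k : ℕ} (e : Fin k → M) (v : M) {j : ℕ} (hj : j ≤ k) :
    flag (Fin.snoc e v : Fin (k + 1) → M) j = flag e j := by
  refine congrArg (Submodule.span ℝ) (Set.ext fun w => ⟨?_, ?_⟩)
  · rintro ⟨i, hi, rfl⟩
    exact ⟨⟨i, hi.trans_le hj⟩, hi, (Fin.snoc_castSucc (α := fun _ => M) v e _).symm⟩
  · rintro ⟨i, hi, rfl⟩
    exact ⟨i.castSucc, hi, Fin.snoc_castSucc (α := fun _ => M) v e _⟩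

theorem flag_eq_span {k : ℕ} (e : Fin k → M) : flag e k = Submodule.span ℝ (Set.range e) :=
  congrArg (Submodule.span ℝ) (Set.ext fun _ => ⟨fun ⟨i, _, h⟩ => ⟨i, h⟩, fun ⟨i, h⟩ => ⟨i, i.2, h⟩⟩)

theorem flag_snoc_last {k : ℕ} (e : Fin k → M) (v : M) :
    flag (Fin.snoc e v : Fin (k + 1) → M) (k + 1) = flag e k ⊔ Submodule.span ℝ {v} := by
  rw [flag_eq_span, flag_eq_span, ← Submodule.span_union]
  refine congrArg (Submodule.span ℝ) (Set.ext fun w => ⟨?_, ?_⟩)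
  · rintro ⟨i, rfl⟩
    cases i using Fin.lastCases with
    | last => exact Or.inr (Fin.snoc_last (α := fun _ => M) v e)
    | cast i => exact Or.inl ⟨i, (Fin.snoc_castSucc (α := fun _ => M) v e i).symm⟩
  · rintro (⟨i, rfl⟩ | rfl)
    · exact ⟨i.castSucc, Fin.snoc_castSucc (α := fun _ => M) v e i⟩
    · exact ⟨Fin.last k, Fin.snoc_last (α := fun _ => M) w e⟩

/-- A property of the subspaces of a flag holds for generic integral frames if it can be propagated
to generic extensions by one vector. -/
theorem forGenericIntegralFrame_flag {S : ℕ → Submodule ℝ M → Prop} {n : ℕ} (h₀ : S 0 ⊥)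
    (hstep : ∀ k < n, ∀ E, S k E → ForGeneric (polarSpace I p E)
      fun v => S (k + 1) (E ⊔ Submodule.span ℝ {v})) :
    ∀ k ≤ n, ForGenericIntegralFrame I p k fun e => ∀ j ≤ k, S j (flag e j)
  | 0, _ => by
    intro j hj
    obtain rfl := Nat.le_zero.1 hj
    rwa [flag_eq_span, Set.range_eq_empty, Submodule.span_empty]
  | k + 1, hk => by
    refine ForGenericIntegralFrame.mono (k := k)
      (Q := fun e => ForGeneric (polarSpace I p (Submodule.span ℝ (Set.range e)))
        fun v => ∀ j ≤ k + 1, S j (flag (Fin.snoc e v : Fin (k + 1) → M) j)) (fun e he => ?_)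
      (forGenericIntegralFrame_flag h₀ hstep k (Nat.le_of_succ_le hk))
    rw [← flag_eq_span]
    refine ForGeneric.mono (fun v hv j hj => ?_) (hstep k hk _ (he k le_rfl))
    rcases Nat.le_succ_iff.1 hj with hj | rfl
    · rw [flag_snoc e v hj]
      exact he j hj
    · rwa [flag_snoc_last]

/-- The complement of the zero set of a nonzero analytic function is dense. -/
theorem dense_ne_zero_of_contDiff {f : M → ℝ} (hf : ContDiff ℝ ω f) {x₀ : M} (h : f x₀ ≠ 0) :
    Dense {x | f x ≠ 0} := by
  rw [dense_iff_inter_open]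
  rintro U hU ⟨z, hz⟩
  by_contra hne
  refine h ((contDiff_omega_iff_analyticOnNhd.1 hf).eqOn_zero_of_preconnected_of_eventuallyEq_zero
    isPreconnected_univ (Set.mem_univ z) ?_ (Set.mem_univ x₀))
  filter_upwards [hU.mem_nhds hz] with x hx
  by_contra hfx
  exact hne ⟨x, hx, hfx⟩

end Frames

/-! ### Generic integral elements of the gauge system -/

section Generic

variable {m r : ℕ} {γ : Fin m → Fin m → Fin m → ℝ} {p : FieldSpace (r + 2) m}
  {E : Submodule ℝ (FieldSpace (r + 2) m)}

theorem isIntegralElement_bot : IsIntegralElement (Ideal (GaugeGenerator r γ)) p ⊥ := by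
  obtain ⟨t₁, t₂, t₃, ht⟩ := exists_isModelElement_iff γ p
  have h : ∀ {d : ℕ} (f : FieldSpace (r + 2) m [⋀^Fin (d + 1)]→ₗ[ℝ] ℝ), VanishesOn f ⊥ :=
    fun f w hw => f.map_coord_zero 0 ((Submodule.mem_bot ℝ).1 (hw 0))
  exact (ht ⊥).2 fun a => ⟨h _, h _, h _⟩

theorem isNonNull_bot : IsNonNull (⊥ : Submodule ℝ (FieldSpace (r + 2) m)) where
  injective _ hv _ := (Submodule.mem_bot ℝ).1 hv
  exists_normal := by
    refine ⟨stdVec 0, ?_, fun v hv => by rw [(Submodule.mem_bot ℝ).1 hv]; simp⟩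
    rw [lorentzSq, Finset.sum_eq_single 0]
    · simp [stdVec, lorentz]
    · intro i _ hi
      simp [stdVec, hi]
    · simp

theorem injective_sup_span (hE : ∀ v ∈ E, v.1 = 0 → v = 0) {v : FieldSpace (r + 2) m}
    (hv : ∀ e ∈ E, e.1 ≠ v.1) : ∀ w ∈ E ⊔ Submodule.span ℝ {v}, w.1 = 0 → w = 0 := by
  intro w hw hw0
  obtain ⟨e, he, z, hz, rfl⟩ := Submodule.mem_sup.1 hw
  obtain ⟨c, rfl⟩ := Submodule.mem_span_singleton.1 hz
  have h : e.1 + c • v.1 = 0 := hw0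
  by_cases hc : c = 0
  · subst hc
    rw [zero_smul, add_zero] at h ⊢
    exact hE e he h
  · refine absurd ?_ (hv (-(c⁻¹ • e)) (E.neg_mem (E.smul_mem _ he)))
    change -(c⁻¹ • e.1) = v.1
    rw [eq_neg_of_add_eq_zero_left h, smul_neg, neg_neg, smul_smul, inv_mul_cancel₀ hc, one_smul]

/-- The normals of E form a space of dimension at least 2, too large for one line. -/
theorem exists_normal_notMem_span (hE : Module.finrank ℝ E + 1 < r + 2) (ν : Fin (r + 2) → ℝ) :
    ∃ ν' : Fin (r + 2) → ℝ, ν' ∉ Submodule.span ℝ {ν} ∧ ∀ v ∈ E, ν' ⬝ᵥ v.1 = 0 := by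
  let T : (Fin (r + 2) → ℝ) →ₗ[ℝ] (E →ₗ[ℝ] ℝ) :=
    (LinearMap.lcomp ℝ ℝ ((xLin (r + 2) m).comp E.subtype)).comp (dotProductBilin ℝ ℝ)
  by_contra! hne
  have h : LinearMap.ker T ≤ Submodule.span ℝ {ν} := fun ν' hν' => by
    by_contra hmem
    obtain ⟨v, hv, hv'⟩ := hne ν' hmem
    exact hv' (LinearMap.congr_fun hν' (⟨v, hv⟩ : E))
  have h₁ := T.finrank_range_add_finrank_ker
  have h₂ := (Submodule.finrank_mono h).trans (finrank_span_le_card ({ν} : Set (Fin (r + 2) → ℝ)))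
  have h₃ := Submodule.finrank_le (LinearMap.range T)
  rw [Module.finrank_linearMap_self] at h₃
  rw [Module.finrank_fintype_fun_eq_card, Fintype.card_fin] at h₁
  simp only [Set.toFinset_singleton, Finset.card_singleton] at h₂
  omega

theorem contDiff_lorentzSq : ContDiff ℝ ω (lorentzSq : (Fin r → ℝ) → ℝ) := by
  unfold lorentzSq
  fun_prop

theorem contDiff_dotProduct (ν : Fin r → ℝ) : ContDiff ℝ ω fun ξ : Fin r → ℝ => ν ⬝ᵥ ξ := by
  unfold dotProduct
  fun_prop

theorem lorentzSq_smul (c : ℝ) (ν : Fin r → ℝ) : lorentzSq (c • ν) = c ^ 2 * lorentzSq ν := by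
  simp only [lorentzSq, Finset.mul_sum, Pi.smul_apply, smul_eq_mul]
  exact Finset.sum_congr rfl fun i _ => by ring

/-- A generic extension of a non-null subspace is again non-null. -/
theorem IsNonNull.exists_contDiff (hE : IsNonNull E) (hdim : Module.finrank ℝ E + 1 < r + 2) :
    ∃ f : (Fin (r + 2) → ℝ) → ℝ, ContDiff ℝ ω f ∧ (∃ ξ, f ξ ≠ 0) ∧
      ∀ v : FieldSpace (r + 2) m, f v.1 ≠ 0 →
        (∀ e ∈ E, e.1 ≠ v.1) ∧ IsNonNull (E ⊔ Submodule.span ℝ {v}) := by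
  obtain ⟨ν, hν, hνE⟩ := hE.exists_normal
  obtain ⟨μ, hμ, hμE⟩ := exists_normal_notMem_span hdim ν
  -- This combination of the normals μ and ν also annihilates ξ, so it is a normal of the extension;
  -- being non-null is a polynomial condition on ξ.
  refine ⟨fun ξ => lorentzSq ((ν ⬝ᵥ ξ) • μ - (μ ⬝ᵥ ξ) • ν), ?_, ?_, ?_⟩
  · exact contDiff_lorentzSq.comp (((contDiff_dotProduct ν).smul contDiff_const).sub
      ((contDiff_dotProduct μ).smul contDiff_const))
  · have hν0 : ν ⬝ᵥ ν ≠ 0 := fun h => hν (by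
      rw [dotProduct_self_eq_zero.1 h]
      simp [lorentzSq])
    -- For ξ orthogonal to ν in the Euclidean sense, the new normal is a multiple of ν, nonzero
    -- because μ is not on the line of ν.
    let ξ := μ - ((ν ⬝ᵥ μ) / (ν ⬝ᵥ ν)) • ν
    have h₁ : ν ⬝ᵥ ξ = 0 := by
      rw [dotProduct_sub, dotProduct_smul, smul_eq_mul, div_mul_cancel₀ _ hν0, sub_self]
    have h₂ : μ ⬝ᵥ ξ = ξ ⬝ᵥ ξ := by
      rw [sub_dotProduct, smul_dotProduct, h₁, smul_zero, sub_zero]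
    have h₃ : ξ ⬝ᵥ ξ ≠ 0 := fun h => hμ (by
      rw [sub_eq_zero.1 (dotProduct_self_eq_zero.1 h)]
      exact Submodule.smul_mem _ _ (Submodule.mem_span_singleton_self ν))
    refine ⟨ξ, ?_⟩
    dsimp only
    rw [h₁, zero_smul, zero_sub, ← neg_smul, lorentzSq_smul, h₂]
    exact mul_ne_zero (pow_ne_zero 2 (neg_ne_zero.2 h₃)) hν
  · intro v hv
    -- If ξ lay in the projection of E, both coefficients of the new normal would vanish.
    have hv' : ∀ e ∈ E, e.1 ≠ v.1 := fun e he h => hv (by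
      dsimp only
      rw [← h, hνE e he, hμE e he]
      simp [lorentzSq])
    refine ⟨hv', injective_sup_span hE.injective hv', _, hv, fun w hw => ?_⟩
    obtain ⟨e, he, z, hz, rfl⟩ := Submodule.mem_sup.1 hw
    obtain ⟨c, rfl⟩ := Submodule.mem_span_singleton.1 hz
    simp only [Prod.fst_add, Prod.smul_fst, dotProduct_add, dotProduct_smul, sub_dotProduct,
      smul_dotProduct, hνE e he, hμE e he, smul_eq_mul]
    ring

/-- The integral elements of a generic chain. -/
structure IsGenericElement (γ : Fin m → Fin m → Fin m → ℝ) (p : FieldSpace (r + 2) m) (k : ℕ)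
    (E : Submodule ℝ (FieldSpace (r + 2) m)) : Prop where
  integral : IsIntegralElement (Ideal (GaugeGenerator r γ)) p E
  finrank_eq : Module.finrank ℝ E = k
  injective : ∀ v ∈ E, v.1 = 0 → v = 0
  isNonNull : k < r + 2 → IsNonNull E

theorem isGenericElement_bot : IsGenericElement γ p 0 ⊥ :=
  ⟨isIntegralElement_bot, finrank_bot _ _, isNonNull_bot.injective, fun _ => isNonNull_bot⟩

/-- The polar space maps onto ℝⁿ by an open map, so a dense open condition on the horizontal
component pulls back to one on the polar space. -/
theorem forGeneric_polarSpace (hE : IsIntegralElement (Ideal (GaugeGenerator r γ)) p E)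
    (hE' : IsNonNull E) {f : (Fin (r + 2) → ℝ) → ℝ} (hf : ContDiff ℝ ω f) {ξ : Fin (r + 2) → ℝ}
    (hξ : f ξ ≠ 0) : ForGeneric (polarSpace (Ideal (GaugeGenerator r γ)) p E) fun v =>
      v ∈ polarSpace (Ideal (GaugeGenerator r γ)) p E ∧ f v.1 ≠ 0 := by
  let π := (xLin (r + 2) m).comp (polarSpace (Ideal (GaugeGenerator r γ)) p E).subtype
  have hπ : Function.Surjective π := fun u => by
    obtain ⟨v, hv, h⟩ := exists_mem_polarSpace hE hE' u
    exact ⟨⟨v, hv⟩, h⟩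
  refine ⟨π ⁻¹' {x | f x ≠ 0}, ?_, ?_, fun v hv => ⟨v.2, hv⟩⟩
  · exact (isOpen_ne_fun hf.continuous continuous_const).preimage
      (LinearMap.continuous_of_finiteDimensional π)
  · exact (dense_ne_zero_of_contDiff hf hξ).preimage (π.isOpenMap_of_finiteDimensional hπ)

theorem IsGenericElement.forGeneric {k : ℕ} (hk : k < r + 2) (hE : IsGenericElement γ p k E) :
    ForGeneric (polarSpace (Ideal (GaugeGenerator r γ)) p E) fun v =>
      IsGenericElement γ p (k + 1) (E ⊔ Submodule.span ℝ {v}) := by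
  have hE' := hE.isNonNull hk
  have key : ∀ v ∈ polarSpace (Ideal (GaugeGenerator r γ)) p E, (∀ e ∈ E, e.1 ≠ v.1) →
      (k + 1 < r + 2 → IsNonNull (E ⊔ Submodule.span ℝ {v})) →
      IsGenericElement γ p (k + 1) (E ⊔ Submodule.span ℝ {v}) := fun v hv hne h =>
    ⟨hE.integral.sup_span hv, by
      rw [Submodule.finrank_sup_span_singleton fun hvE => hne v hvE rfl, hE.finrank_eq],
      injective_sup_span hE.injective hne, h⟩
  rcases Nat.lt_or_ge (k + 1) (r + 2) with hk' | hk'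
  · obtain ⟨f, hf, ⟨ξ, hξ⟩, h⟩ := hE'.exists_contDiff (by rwa [hE.finrank_eq])
    refine ForGeneric.mono (fun v hv => ?_) (forGeneric_polarSpace hE.integral hE' hf hξ)
    exact key v hv.1 (h v hv.2).1 fun _ => (h v hv.2).2
  -- In the last step the extension fills ℝⁿ and no normal is needed: it is enough to leave the
  -- hyperplane, and ν♯ does so because ν is not null.
  · obtain ⟨ν, hν, hνE⟩ := hE'.exists_normal
    have hν0 : ν ⬝ᵥ sharp ν ≠ 0 := by rwa [dotProduct_sharp]
    refine ForGeneric.mono (fun v hv => ?_)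
      (forGeneric_polarSpace hE.integral hE' (contDiff_dotProduct ν) hν0)
    exact key v hv.1 (fun e he h => hv.2 (by rw [← h, hνE e he]))
      fun h => absurd hk' (not_le.2 h)

theorem forGenericIntegralFrame_isGenericElement (γ : Fin m → Fin m → Fin m → ℝ)
    (p : FieldSpace (r + 2) m) :
    ForGenericIntegralFrame (Ideal (GaugeGenerator r γ)) p (r + 2) fun e =>
      ∀ j ≤ r + 2, IsGenericElement γ p j (flag e j) :=
  forGenericIntegralFrame_flag isGenericElement_bot (fun _ hk _ hE => hE.forGeneric hk) _ le_rfl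

theorem IsGenericElement.linearIndependent {e : Fin (r + 2) → FieldSpace (r + 2) m}
    (he : IsGenericElement γ p (r + 2) (flag e (r + 2))) :
    LinearIndependent ℝ fun i => xProj (r + 2) m (e i) := by
  rw [flag_eq_span] at he
  have h : LinearIndependent ℝ e := by
    rw [linearIndependent_iff_card_eq_finrank_span, Fintype.card_fin]
    exact he.finrank_eq.symm
  refine h.map (f := xLin (r + 2) m) ?_
  rw [Submodule.disjoint_def]
  exact fun v hv hv' => he.injective v hv hv'

/-- The polar ranks of generic integral elements. -/
theorem IsGenericElement.polarRank_eq {k : ℕ} (hk : k < r + 2) (hE : IsGenericElement γ p k E) :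
    polarRank (Ideal (GaugeGenerator r γ)) p E = m * (k + k.choose 2 + k.choose r) := by
  rw [EDS.polarRank_eq hE.integral (hE.isNonNull hk), hE.finrank_eq]

theorem IsGenericElement.polarSpace_eq (hE : IsGenericElement γ p (r + 2) E) :
    polarSpace (Ideal (GaugeGenerator r γ)) p E = E :=
  polarSpace_eq_self hE.integral hE.injective hE.finrank_eq

theorem IsGenericElement.polarRank_add (hE : IsGenericElement γ p (r + 2) E) :
    polarRank (Ideal (GaugeGenerator r γ)) p E + (r + 2) =
      Module.finrank ℝ (FieldSpace (r + 2) m) := by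
  rw [polarRank, hE.polarSpace_eq]
  exact (congrArg _ hE.finrank_eq.symm).trans (Submodule.finrank_quotient_add_finrank E)

/-- Below dimension n the number of polar equations is attained; in dimension n the bound N - n is
attained. -/
theorem IsGenericElement.isRegular {k : ℕ} (hk : k ≤ r + 2) (hE : IsGenericElement γ p k E) :
    IsRegular (Ideal (GaugeGenerator r γ)) p E := by
  refine ⟨hE.integral, fun q E' hE' hdim => ?_⟩
  rcases hk.lt_or_eq with hk | rfl
  · rw [hE.polarRank_eq hk, ← hE.finrank_eq, ← hdim]
    exact polarRank_le hE'
  · have h := polarRank_add_finrank_le hE'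
    rw [hdim, hE.finrank_eq, ← hE.polarRank_add] at h
    exact Nat.le_of_add_le_add_right h

end Generic

/-! ### Integral sections, Cartan's test and Cauchy vectors -/

section Sections

variable {m n r d : ℕ}

/-- The value of a model form without horizontal part on a section of the independent variables. -/
def sectionForm (l : FieldSpace n m →ₗ[ℝ] (Fin n → ℝ) [⋀^Fin d]→ₗ[ℝ] ℝ) :
    ((Fin n → ℝ) →ₗ[ℝ] FieldSpace n m) →ₗ[ℝ] (Fin n → ℝ) [⋀^Fin (d + 1)]→ₗ[ℝ] ℝ :=
  AlternatingMap.alternatizeUncurryFinLM.comp (LinearMap.compRight ℝ l)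

theorem sectionForm_apply (l : FieldSpace n m →ₗ[ℝ] (Fin n → ℝ) [⋀^Fin d]→ₗ[ℝ] ℝ)
    (L : (Fin n → ℝ) →ₗ[ℝ] FieldSpace n m) :
    sectionForm l L = AlternatingMap.alternatizeUncurryFin (l.comp L) := rfl

theorem vanishesOn_range_iff (l : FieldSpace n m →ₗ[ℝ] (Fin n → ℝ) [⋀^Fin d]→ₗ[ℝ] ℝ)
    (t : (Fin n → ℝ) [⋀^Fin (d + 1)]→ₗ[ℝ] ℝ) {L : (Fin n → ℝ) →ₗ[ℝ] FieldSpace n m}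
    (hL : ∀ u, (L u).1 = u) :
    VanishesOn (modelForm l t) (LinearMap.range L) ↔ sectionForm l L = t := by
  have h : ∀ u : Fin (d + 1) → Fin n → ℝ,
      modelForm l t (fun i => L (u i)) = sectionForm l L u - t u := fun u => by
    rw [modelForm_apply, sectionForm_apply, alternatingMap_alternatizeUncurryFin_apply_real]
    simp only [Fin.removeNth_apply, hL]
    rfl
  constructor
  · intro hv
    ext u
    exact sub_eq_zero.1 ((h u).symm.trans (hv _ fun i => LinearMap.mem_range_self L (u i)))
  · intro hv w hw
    choose u hu using hw
    obtain rfl : (fun i => L (u i)) = w := funext hu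
    rw [h, hv, sub_self]

/-- The equations for integral sections, without their inhomogeneous terms. -/
def sectionMap (r m : ℕ) : ((Fin (r + 2) → ℝ) →ₗ[ℝ] FieldSpace (r + 2) m) →ₗ[ℝ]
    ((Fin (r + 2) → ℝ) →ₗ[ℝ] (Fin (r + 2) → ℝ)) ×
      (Fin m → ((Fin (r + 2) → ℝ) [⋀^Fin 2]→ₗ[ℝ] ℝ) × ((Fin (r + 2) → ℝ) [⋀^Fin 3]→ₗ[ℝ] ℝ) ×
        ((Fin (r + 2) → ℝ) [⋀^Fin (r + 1)]→ₗ[ℝ] ℝ)) :=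
  (LinearMap.compRight ℝ (xLin (r + 2) m)).prod (LinearMap.pi fun a =>
    (sectionForm (symbolA a)).prod
      ((sectionForm (symbolF a)).prod (sectionForm (dualForm.comp (symbolF a)))))

/-- Every two-form is the alternatization of the potential part of a section. -/
theorem exists_potential (B : (Fin n → ℝ) [⋀^Fin 2]→ₗ[ℝ] ℝ) :
    ∃ A : (Fin n → ℝ) →ₗ[ℝ] (Fin n → ℝ),
      AlternatingMap.alternatizeUncurryFin (covectorForm.comp A) = B := by
  -- The factor 1/2 compensates that alternating the contraction of a two-form returns the form
  -- twice.
  let A : (Fin n → ℝ) →ₗ[ℝ] (Fin n → ℝ) :=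
    { toFun := fun u i => (1 / 2 : ℝ) * B.curryLeft u fun _ => stdVec i
      map_add' := fun u v => funext fun i => by
        rw [map_add, AlternatingMap.add_apply, mul_add]
        rfl
      map_smul' := fun c u => funext fun i => by
        rw [map_smul, AlternatingMap.smul_apply, smul_eq_mul, mul_left_comm]
        rfl }
  refine ⟨A, ?_⟩
  have h : covectorForm.comp A = (1 / 2 : ℝ) • B.curryLeft := by
    refine LinearMap.ext fun u => AlternatingMap.ext fun w => ?_
    refine (dotProduct_comm (A u) (w 0)).trans ?_
    change ∑ i, w 0 i * ((1 / 2 : ℝ) * B.curryLeft u fun _ => stdVec i) =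
      (1 / 2 : ℝ) * B.curryLeft u w
    have hl := linear_eq_sum ((AlternatingMap.ofSubsingleton ℝ (Fin n → ℝ) ℝ (0 : Fin 1)).symm
      (B.curryLeft u)) (w 0)
    have hw : (fun _ => w 0) = w := funext fun i => by rw [Fin.fin_one_eq_zero i]
    have hl' : B.curryLeft u w = ∑ i, w 0 i * B.curryLeft u fun _ => stdVec i := by
      conv_lhs => rw [← hw]
      exact hl
    rw [hl', Finset.mul_sum]
    exact Finset.sum_congr rfl fun i _ => mul_left_comm _ _ _
  rw [h, AlternatingMap.alternatizeUncurryFin_smul, AlternatingMap.alternatizeUncurryFin_curryLeft]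
  ext w
  simp

/-- The equations decouple: the x-part is free, the dA-part is solved by `exists_potential`, and the
two equations for dF are solved simultaneously by `exists_field`. -/
theorem sectionMap_surjective (r m : ℕ) : Function.Surjective (sectionMap r m) := by
  rintro ⟨X, y⟩
  choose A hA using fun a => exists_potential (y a).1
  choose Φ hΦ hΦ' using fun a => exists_field (y a).2.1 (y a).2.2
  let L : (Fin (r + 2) → ℝ) →ₗ[ℝ] FieldSpace (r + 2) m := X.prod ((LinearMap.pi A).prod
    (LinearMap.pi fun a => (twoFormEquiv (r + 2)).symm.toLinearMap.comp (Φ a)))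
  have hF : ∀ a, (symbolF a).comp L = Φ a := fun a =>
    LinearMap.ext fun u => (twoFormEquiv (r + 2)).apply_symm_apply (Φ a u)
  refine ⟨L, Prod.ext rfl (funext fun a => Prod.ext (hA a) (Prod.ext ?_ ?_))⟩
  · exact (congrArg AlternatingMap.alternatizeUncurryFin (hF a)).trans (hΦ a)
  · exact (congrArg (fun f => AlternatingMap.alternatizeUncurryFin (dualForm.comp f)) (hF a)).trans
      (hΦ' a)

theorem isModelElement_range_iff {t₁ : Fin m → (Fin (r + 2) → ℝ) [⋀^Fin 2]→ₗ[ℝ] ℝ}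
    {t₂ : Fin m → (Fin (r + 2) → ℝ) [⋀^Fin 3]→ₗ[ℝ] ℝ}
    {t₃ : Fin m → (Fin (r + 2) → ℝ) [⋀^Fin (r + 1)]→ₗ[ℝ] ℝ}
    {L : (Fin (r + 2) → ℝ) →ₗ[ℝ] FieldSpace (r + 2) m} :
    ((∀ u, (L u).1 = u) ∧ IsModelElement t₁ t₂ t₃ (LinearMap.range L)) ↔
      sectionMap r m L = (LinearMap.id, fun a => (t₁ a, t₂ a, t₃ a)) := by
  rw [Prod.ext_iff]
  have h : (∀ u, (L u).1 = u) ↔ (sectionMap r m L).1 = LinearMap.id := by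
    rw [LinearMap.ext_iff]
    rfl
  refine (and_congr_right fun hL => ?_).trans (and_congr_left fun _ => h)
  rw [funext_iff]
  refine forall_congr' fun a => ?_
  rw [vanishesOn_range_iff _ _ hL, vanishesOn_range_iff _ _ hL, vanishesOn_range_iff _ _ hL]
  simp only [Prod.ext_iff]
  rfl

theorem finrank_sectionTarget (m d : ℕ) (V : Type*) [AddCommGroup V] [Module ℝ V]
    [FiniteDimensional ℝ V] : Module.finrank ℝ ((V →ₗ[ℝ] V) × (Fin m →
      (V [⋀^Fin 2]→ₗ[ℝ] ℝ) × (V [⋀^Fin 3]→ₗ[ℝ] ℝ) × (V [⋀^Fin d]→ₗ[ℝ] ℝ))) =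
    Module.finrank ℝ V * Module.finrank ℝ V + m * ((Module.finrank ℝ V).choose 2 +
      (Module.finrank ℝ V).choose 3 + (Module.finrank ℝ V).choose d) := by
  have h : Module.Finite ℝ ((V [⋀^Fin 2]→ₗ[ℝ] ℝ) × (V [⋀^Fin 3]→ₗ[ℝ] ℝ) ×
    (V [⋀^Fin d]→ₗ[ℝ] ℝ)) := inferInstance
  rw [Module.finrank_prod, Module.finrank_linearMap, Module.finrank_pi_fintype]
  simp only [Module.finrank_prod, finrank_alternatingMap, Finset.sum_const, Finset.card_univ,
    Fintype.card_fin, smul_eq_mul]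
  ring

theorem finrank_ker_sectionMap (r m : ℕ) :
    (r + 2) * (r + 2) + m * ((r + 2).choose 2 + (r + 2).choose 3 + (r + 2).choose (r + 1)) +
      Module.finrank ℝ (LinearMap.ker (sectionMap r m)) =
    (r + 2) * (r + 2 + m * (r + 2 + (r + 2).choose 2)) := by
  have h := (sectionMap r m).finrank_range_add_finrank_ker
  rw [LinearMap.range_eq_top.2 (sectionMap_surjective r m), finrank_top, finrank_sectionTarget,
    Module.finrank_linearMap, finrank_fieldSpace, Module.finrank_fintype_fun_eq_card,
    Fintype.card_fin] at h
  exact h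

variable (γ : Fin m → Fin m → Fin m → ℝ) (p : FieldSpace (r + 2) m)

/-- The integral sections of the independent variables form an affine space. -/
theorem exists_affineSubspace :
    ∃ Q : AffineSubspace ℝ ((Fin (r + 2) → ℝ) →ₗ[ℝ] FieldSpace (r + 2) m),
      (Q : Set ((Fin (r + 2) → ℝ) →ₗ[ℝ] FieldSpace (r + 2) m)) =
        {L | (∀ u, xProj (r + 2) m (L u) = u) ∧
          IsIntegralElement (Ideal (GaugeGenerator r γ)) p (LinearMap.range L)} ∧
      (Q : Set ((Fin (r + 2) → ℝ) →ₗ[ℝ] FieldSpace (r + 2) m)).Nonempty ∧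
      Q.direction = LinearMap.ker (sectionMap r m) := by
  obtain ⟨t₁, t₂, t₃, ht⟩ := exists_isModelElement_iff γ p
  obtain ⟨L₀, hL₀⟩ := sectionMap_surjective r m (LinearMap.id, fun a => (t₁ a, t₂ a, t₃ a))
  refine ⟨AffineSubspace.mk' L₀ (LinearMap.ker (sectionMap r m)), ?_, ⟨L₀, ?_⟩,
    AffineSubspace.direction_mk' _ _⟩
  · refine Set.ext fun L => AffineSubspace.mem_mk'.trans ?_
    rw [vsub_eq_sub, LinearMap.mem_ker, map_sub, sub_eq_zero, hL₀]
    refine isModelElement_range_iff.symm.trans (and_congr_right fun _ => ?_)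
    exact (ht _).symm
  · exact AffineSubspace.self_mem_mk' _ _

/-- A section with constant symmetric derivative of the potentials. -/
def symmetricSection (r m : ℕ) : (Fin (r + 2) → ℝ) →ₗ[ℝ] FieldSpace (r + 2) m :=
  LinearMap.prod 0 ((LinearMap.pi fun _ => LinearMap.id).prod 0)

theorem symmetricSection_mem_ker (r m : ℕ) :
    symmetricSection r m ∈ LinearMap.ker (sectionMap r m) := by
  have hF : ∀ a, (symbolF a).comp (symmetricSection r m) = 0 := fun a =>
    LinearMap.ext fun _ => map_zero twoForm
  refine LinearMap.mem_ker.2 (Prod.ext rfl (funext fun a => Prod.ext ?_ (Prod.ext ?_ ?_)))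
  · refine AlternatingMap.ext fun w => ?_
    refine (alternatingMap_alternatizeUncurryFin_apply_real _ _).trans ?_
    rw [Fin.sum_univ_two]
    change (-1) ^ 0 * (w 0 ⬝ᵥ w 1) + (-1) ^ 1 * (w 1 ⬝ᵥ w 0) = 0
    rw [dotProduct_comm (w 1)]
    ring
  · refine (congrArg AlternatingMap.alternatizeUncurryFin (hF a)).trans ?_
    exact map_zero AlternatingMap.alternatizeUncurryFinLM
  · refine (congrArg (fun f => AlternatingMap.alternatizeUncurryFin (dualForm.comp f))
      (hF a)).trans ?_
    rw [LinearMap.comp_zero]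
    exact map_zero AlternatingMap.alternatizeUncurryFinLM

/-- The contraction of a form of the ideal with v is again in the ideal at p, hence vanishes on E.
-/
theorem IsCauchyVector.mem_polarSpace {M : Type} [NormedAddCommGroup M] [NormedSpace ℝ M]
    {I : ∀ k : ℕ, Form M k → Prop} {p v : M} (hv : IsCauchyVector I p v) {E : Submodule ℝ M}
    (hE : IsIntegralElement I p E) : v ∈ polarSpace I p E := fun k φ hφ w hw => by
  obtain ⟨χ, hχ, h⟩ := hv k φ hφ
  rw [← h]
  exact hE k χ hχ w hw

/-- There are no Cauchy vectors. -/
theorem IsCauchyVector.eq_zero (hm : 0 < m) {v : FieldSpace (r + 2) m}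
    (hv : IsCauchyVector (Ideal (GaugeGenerator r γ)) p v) : v = 0 := by
  obtain ⟨Q, hQ, ⟨L₀, hL₀⟩, hdir⟩ := exists_affineSubspace γ p
  -- The range of an integral section is its own polar space, so it contains v; a section is
  -- determined by its horizontal component.
  have key : ∀ L ∈ Q, L v.1 = v := fun L hL => by
    have hL' : (∀ u, (L u).1 = u) ∧
        IsIntegralElement (Ideal (GaugeGenerator r γ)) p (LinearMap.range L) := by
      have : L ∈ (Q : Set ((Fin (r + 2) → ℝ) →ₗ[ℝ] FieldSpace (r + 2) m)) := hL
      rwa [hQ] at this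
    have hinj : Function.Injective L := fun u u' h => by rw [← hL'.1 u, h, hL'.1]
    have hH := hv.mem_polarSpace hL'.2
    rw [polarSpace_eq_self hL'.2] at hH
    · obtain ⟨u, hu⟩ := hH
      rw [← hu, hL'.1]
    · rintro _ ⟨u, rfl⟩ hu
      rw [hL'.1] at hu
      rw [hu, map_zero]
    · rw [LinearMap.finrank_range_of_inj hinj, Module.finrank_fintype_fun_eq_card, Fintype.card_fin]
  -- Two integral sections differing by the symmetric one both send the horizontal part of v to v;
  -- the difference records that part in dA, so it is zero.
  have hmem : symmetricSection r m +ᵥ L₀ ∈ Q :=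
    AffineSubspace.vadd_mem_of_mem_direction (hdir ▸ symmetricSection_mem_ker r m) hL₀
  have h₀ := key L₀ hL₀
  have h₁ : symmetricSection r m v.1 + L₀ v.1 = v := key _ hmem
  rw [h₀, add_eq_right] at h₁
  have h₂ : v.1 = 0 := congrFun (congrArg (fun w : FieldSpace (r + 2) m => w.2.1) h₁) ⟨0, hm⟩
  rw [← h₀, h₂, map_zero]

end Sections

/-! ### Assembly of the Cartan tables -/

section Table

variable {m r : ℕ} {γ : Fin m → Fin m → Fin m → ℝ}

/-- The Cartan characters of a gauge field system. -/
theorem hasCartanTable (hm : 0 < m) (hγ : ∀ a b c, γ c a b = -γ b a c)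
    (hJ : ∀ a c d e, ∑ f, γ f a d * γ c f e - ∑ f, γ f a e * γ c f d = ∑ f, γ c a f * γ f d e)
    {N : ℕ} {s : Fin (r + 2 + 1) → ℕ} (hN : N = r + 2 + m * (r + 2 + (r + 2).choose 2))
    (hs : ∀ k : Fin (r + 2), ∑ j ∈ Finset.Iic k.castSucc, s j =
      m * (k + (k : ℕ).choose 2 + (k : ℕ).choose r))
    (hsum : ∑ j, s j = m * (r + 2 + (r + 2).choose 2))
    (hcartan : (r + 2) * (r + 2) +
      m * ((r + 2).choose 2 + (r + 2).choose 3 + (r + 2).choose (r + 1)) +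
        ∑ j : Fin (r + 2 + 1), (j : ℕ) * s j = (r + 2) * N) :
    HasCartanTable (Ideal (GaugeGenerator r γ)) (xProj (r + 2) m) N s where
  dim := by rw [finrank_fieldSpace, hN]
  closed _ _ := gauge_closed γ hγ hJ
  no_cauchy p _ hv := hv.eq_zero γ p hm
  characters p := by
    refine ForGenericIntegralFrame.mono (fun e he => ⟨fun k => ?_, ?_, ?_⟩)
      (forGenericIntegralFrame_isGenericElement γ p)
    · have hk := he k (Nat.lt_succ_iff.1 k.2)
      refine ⟨hk.isRegular (Nat.lt_succ_iff.1 k.2), ?_⟩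
      -- Only the last rank does not come from counting equations: there H(E) = E gives the
      -- codimension N - n.
      cases k using Fin.lastCases with
      | last =>
        have h := hk.polarRank_add
        rw [finrank_fieldSpace] at h
        have hI : Finset.Iic (Fin.last (r + 2)) = Finset.univ :=
          Finset.eq_univ_of_forall fun i => Finset.mem_Iic.2 (Fin.le_last i)
        rw [hI, hsum]
        exact Nat.add_right_cancel (h.trans (add_comm _ _))
      | cast k =>
        rw [hs]
        exact hk.polarRank_eq k.2
    · exact (he (r + 2) le_rfl).linearIndependent
    · exact (he (r + 2) le_rfl).polarSpace_eq
  sum_eq := by rw [hsum, hN, add_comm]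
  cartan_test p := by
    obtain ⟨Q, hQ, hne, hdir⟩ := exists_affineSubspace γ p
    refine ⟨Q, hQ, hne, ?_⟩
    rw [hdir]
    -- The hypothesis `hcartan` is this rank-nullity identity with the kernel dimension replaced by
    -- ∑ j s_j.
    have h := finrank_ker_sectionMap r m
    rw [← hN, ← hcartan] at h
    exact Nat.add_left_cancel h

/-- The right side is a Vandermonde product normalized by its value 2 at (0, 1, 2). It turns
antisymmetry and the Jacobi identity into arithmetic. -/
theorem leviCivita_cons_three (a b c : Fin 3) :
    leviCivita ![a, b, c] = (((b : ℕ) : ℝ) - (a : ℕ)) * (((c : ℕ) : ℝ) - (b : ℕ)) *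
      (((c : ℕ) : ℝ) - (a : ℕ)) / 2 := by
  rw [leviCivita, Matrix.det_fin_three]
  fin_cases a <;> fin_cases b <;> fin_cases c <;>
    simp [Matrix.one_apply] <;> norm_num

theorem hasCartanTable_maxwell {r N : ℕ} {s : Fin (r + 2 + 1) → ℕ}
    (hN : N = r + 2 + 1 * (r + 2 + (r + 2).choose 2))
    (hs : ∀ k : Fin (r + 2), ∑ j ∈ Finset.Iic k.castSucc, s j =
      1 * (k + (k : ℕ).choose 2 + (k : ℕ).choose r))
    (hsum : ∑ j, s j = 1 * (r + 2 + (r + 2).choose 2))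
    (hcartan : (r + 2) * (r + 2) +
      1 * ((r + 2).choose 2 + (r + 2).choose 3 + (r + 2).choose (r + 1)) +
        ∑ j : Fin (r + 2 + 1), (j : ℕ) * s j = (r + 2) * N) :
    HasCartanTable (maxwell r) (xProj (r + 2) 1) N s :=
  hasCartanTable Nat.one_pos (fun _ _ _ => neg_zero.symm) (fun _ _ _ _ => by simp)
    hN hs hsum hcartan

theorem hasCartanTable_yangMills {r N : ℕ} {s : Fin (r + 2 + 1) → ℕ}
    (hN : N = r + 2 + 3 * (r + 2 + (r + 2).choose 2))
    (hs : ∀ k : Fin (r + 2), ∑ j ∈ Finset.Iic k.castSucc, s j =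
      3 * (k + (k : ℕ).choose 2 + (k : ℕ).choose r))
    (hsum : ∑ j, s j = 3 * (r + 2 + (r + 2).choose 2))
    (hcartan : (r + 2) * (r + 2) +
      3 * ((r + 2).choose 2 + (r + 2).choose 3 + (r + 2).choose (r + 1)) +
        ∑ j : Fin (r + 2 + 1), (j : ℕ) * s j = (r + 2) * N) :
    HasCartanTable (yangMills r) (xProj (r + 2) 3) N s := by
  refine hasCartanTable (by norm_num) (fun a b c => ?_) (fun a c d e => ?_) hN hs hsum hcartan
  · simp only [leviCivita_cons_three]
    ring
  · simp only [leviCivita_cons_three, Fin.sum_univ_three]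
    fin_cases a <;> fin_cases c <;> fin_cases d <;> fin_cases e <;> norm_num

end Table

end EDS

end

/-- Cartan characters of the Maxwell and `SU(2)` Yang–Mills systems in `3`, `4`, `5` and `6`
dimensions; the vectors list `s₀, …, s_n`. -/
theorem mainTheorem1 :
    (EDS.HasCartanTable (EDS.maxwell 1) (EDS.xProj 3 1) 9 ![0, 2, 3, 1] ∧
      EDS.HasCartanTable (EDS.maxwell 2) (EDS.xProj 4 1) 14 ![0, 1, 3, 5, 1] ∧
      EDS.HasCartanTable (EDS.maxwell 3) (EDS.xProj 5 1) 20 ![0, 1, 2, 4, 7, 1] ∧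
      EDS.HasCartanTable (EDS.maxwell 4) (EDS.xProj 6 1) 27 ![0, 1, 2, 3, 5, 9, 1]) ∧
    (EDS.HasCartanTable (EDS.yangMills 1) (EDS.xProj 3 3) 21 ![0, 6, 9, 3] ∧
      EDS.HasCartanTable (EDS.yangMills 2) (EDS.xProj 4 3) 34 ![0, 3, 9, 15, 3] ∧
      EDS.HasCartanTable (EDS.yangMills 3) (EDS.xProj 5 3) 50 ![0, 3, 6, 12, 21, 3] ∧
      EDS.HasCartanTable (EDS.yangMills 4) (EDS.xProj 6 3) 69 ![0, 3, 6, 9, 15, 27, 3]) := by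
  -- In each case what remains is arithmetic with binomial coefficients: the dimension, the partial
  -- sums of the characters, their total, and Cartan's count.
  refine ⟨⟨?_, ?_, ?_, ?_⟩, ?_, ?_, ?_, ?_⟩
  · exact EDS.hasCartanTable_maxwell (by decide) (by decide) (by decide) (by decide)
  · exact EDS.hasCartanTable_maxwell (by decide) (by decide) (by decide) (by decide)
  · exact EDS.hasCartanTable_maxwell (by decide) (by decide) (by decide) (by decide)
  · exact EDS.hasCartanTable_maxwell (by decide) (by decide) (by decide) (by decide)
  · exact EDS.hasCartanTable_yangMills (by decide) (by decide) (by decide) (by decide)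
  · exact EDS.hasCartanTable_yangMills (by decide) (by decide) (by decide) (by decide)
  · exact EDS.hasCartanTable_yangMills (by decide) (by decide) (by decide) (by decide)
  · exact EDS.hasCartanTable_yangMills (by decide) (by decide) (by decide) (by decide)
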